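/- Let $X=\mathbb C^n$, write $\langle v,\zeta\rangle=\sum_i v_i\zeta_i$, and identify $T^*X$, $TX$ with $X\times\mathbb C^n$; let $\pi,\tau,p_1$ be the projections of $T^*X$, $TX$, $X\times X$ to the first factor $X$, and put $\varrho(z,z')=(z,z'-z)\in TX$ for $(z,z')\in X\times X$. *Cones and symbols.* A cone is a set $V\subset\{(z;\zeta)\in T^*X:\zeta\neq 0\}$ stable under $(z;\zeta)\mapsto(z;t\zeta)$, $t>0$; it is convex (proper) if all its fibres are convex (have closures containing no line). $A\Subset B$ means that $\overline A$ is compact and contained in $B$; for cones, $V'\Subset_{\rm cone}V$ means $V'=\mathbb R_{>0}K$ for some $K\Subset V$. A set $W\subset V$ is an infinitesimal wedge of type $V$ if for each $K\Subset V$ there is $\delta>0$ with $(z;t\zeta)\in W$ for all $(z;\zeta)\in K$, $t>\delta$. A function $f(z,\zeta)$ is a *null-symbol of $C^\infty$-type* on an open cone $V$ if there is an open infinitesimal wedge $W$ of type $V$ on which $f$ is $C^\infty$ and holomorphic in $\zeta$, and for each open cone $V''\Subset_{\rm cone}V$ there is an infinitesimal wedge $W''\subset W$ of type $V''$ such that for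 all multi-indices $\alpha,\beta$ there are $h,C>0$ with $|\partial_z^\alpha\partial_{\bar z}^\beta f|\le Ce^{-h|\zeta|}$ on $W''$. It is a *symbol of $C^\infty$-type* on $V$ if the same holds with the estimate replaced by "for all $\alpha,\beta$ and all $h>0$ there is $C>0$ with $|\partial_z^\alpha\partial_{\bar z}^\beta f|\le Ce^{h|\zeta|}$ on $W''$", and each $\partial f/\partial\bar z_i$ is a null-symbol of $C^\infty$-type on $V$. *Setting.* Let $V'\Subset_{\rm cone}V$ be open convex proper cones with $\pi(V)$, $\pi(V')$ relatively compact, $U\subset X\times X$ open with $U\cap\Delta=\{(z,z):z\in\pi(V)\}$, where $\Delta$ is the diagonal, and $G\subset X\times X$ closed. For a cone $\Gamma$ put $\Gamma^\circ=\{(z,v)\in TX: z\in\pi(\Gamma),\ \mathrm{Re}\langle v,\zeta\rangle\le 0\text{ for all }(z;\zeta)\in\Gamma\}$. Let $\Gamma_1,\Gamma_2$ be open convex proper cones with $V'\Subset_{\rm cone}\Gamma_2\Subset_{\rm cone}\Gamma_1\Subset_{\rm cone}V$ and $G\cap U\subset\varrho^{-1}(\mathrm{Int}\,\Gamma_1^\circ)\cup\Delta$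 over $\pi(V')$, and put $\gamma_i=\Gamma_i^\circ$. Let $D_1,D_2\subset X\times X$ be open sets with $C^\infty$ boundary over $\pi(V')$ such that, with $D=D_1\setminus D_2$ and $E=\partial D_1\setminus D_2$, 1. $\varrho(D_i)$ is $\gamma_i$-open, i.e. open and stable under fibrewise addition of $\gamma_i$ ($i=1,2$); 2. $(z,z)\in D_1$ for $z\in\pi(V')$; 3. $\overline{D_2}\cap p_1^{-1}(\pi(V'))\subset\varrho^{-1}(\mathrm{Int}\,\gamma_2)$; 4. $\overline D\cap p_1^{-1}(\pi(V'))\subset U$, and $D\cap p_1^{-1}(K)$ is bounded for each compact $K\subset\pi(V')$; 5. $\overline E\cap p_1^{-1}(\pi(V'))\subset U\setminus G$; 6. for each $z\in\pi(V')$ the fibre $p_1^{-1}(z)$ is transversal to $\partial D_1$ and to $\partial D_2$, and inside this fibre $\partial D_1$ and $\partial D_2$ intersect transversally. Let $\omega=(\omega_1,\omega_{01})$ represent a class in $H^{0,n,n}_{\bar\vartheta}(U,U\setminus G)$: $\omega_1=\sum_{|K|=n}f_K\,dz'\wedge d\bar z^K$ is a $C^\infty$ form on $U$ and $\omega_{01}=\sum_{|K|=n-1}g_K\,dz'\wedge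 d\bar z^K$ is a $C^\infty$ form on $U\setminus G$, where $dz'=dz'_1\wedge\dots\wedge dz'_n$ and $d\bar z^K$ runs over the monomials in $d\bar z_1,\dots,d\bar z_n,d\bar z'_1,\dots,d\bar z'_n$, with $\bar\partial\omega_1=0$ and $\omega_1=\bar\partial\omega_{01}$ on $U\setminus G$. It is cohomologous to $0$ if $\omega_1=\bar\partial\tau_1$ and $\omega_{01}=\tau_1-\bar\partial\tau_{01}$ for such forms $\tau_1$ on $U$, $\tau_{01}$ on $U\setminus G$ of degree one less (in $d\bar z,d\bar z'$). With $D_z=D\cap p_1^{-1}(z)$, and $E_z=E\cap p_1^{-1}(z)$ oriented as part of the boundary of $D_z$, put $$\widetilde\varsigma(\omega)(z,\zeta)=\int_{D_z}\omega_1(z,z')\,e^{\langle z'-z,\zeta\rangle}-\int_{E_z}\omega_{01}(z,z')\,e^{\langle z'-z,\zeta\rangle}.$$ *Claim.* For $z\in\pi(V')$ and $\zeta\in\mathbb C^n$ the integrals converge, and: 1. $\widetilde\varsigma(\omega)$ is a symbol of $C^\infty$-type on $V'$. 2. If $\omega$ is cohomologous to $0$, then $\widetilde\varsigma(\omega)$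 is a null-symbol of $C^\infty$-type on $V'$. 3. Modulo null-symbols of $C^\infty$-type on $V'$, $\widetilde\varsigma(\omega)$ does not depend on the choice of $D_1,D_2$ (nor of $\Gamma_1,\Gamma_2$). Consequently $\widetilde\varsigma$ is well defined: if $\omega$ and $\omega'$ represent the same class, then the functions $\widetilde\varsigma(\omega)$ and $\widetilde\varsigma(\omega')$, computed with any two choices of $(\Gamma_1,\Gamma_2,D_1,D_2)$, differ by a null-symbol of $C^\infty$-type on $V'$. -/

import Mathlib

open scoped ContDiff Topology MeasureTheory
open MeasureTheory Set Filter

noncomputable section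

namespace CDSymbol

/-! ### The spaces

`X = ℂⁿ`.  The spaces `X × X`, `TX` and `T*X` are all trivialised as `Cn n × Cn n`: a point of
`X × X` is `(z, z')`, a point of `TX` is `(z, v)`, a point of `T*X` is `(z, ζ)`. -/

/-- The complex vector space `X = ℂⁿ` with its Euclidean norm. -/
abbrev Cn (n : ℕ) : Type := EuclideanSpace ℂ (Fin n)

/-- The complex bilinear pairing `⟨v, ζ⟩ = ∑ vᵢ ζᵢ` of a vector with a covector. -/
def pairing {n : ℕ} (v ζ : Cn n) : ℂ := ∑ i, v i * ζ i

/-- The projection to `X` (that is `π`, `τ` or `p₁`) of a subset of `T*X`, `TX` or `X × X`. -/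
def base {n : ℕ} (A : Set (Cn n × Cn n)) : Set (Cn n) := Prod.fst '' A

/-- The fibre of a subset over `z`. -/
def fibre {n : ℕ} (A : Set (Cn n × Cn n)) (z : Cn n) : Set (Cn n) := {w | (z, w) ∈ A}

/-! ### Cones and infinitesimal wedges -/

/-- A cone in `T*X` minus its zero section. -/
structure IsCone {n : ℕ} (V : Set (Cn n × Cn n)) : Prop where
  ne_zero : ∀ p ∈ V, p.2 ≠ 0
  smul_mem : ∀ p ∈ V, ∀ t : ℝ, 0 < t → (p.1, t • p.2) ∈ V

/-- An open convex proper cone; convexity and properness are fibrewise, and a set is proper when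
its closure contains no line. -/
structure IsOpenConvexProperCone {n : ℕ} (V : Set (Cn n × Cn n)) : Prop where
  isOpen : IsOpen V
  isCone : IsCone V
  convex : ∀ z, Convex ℝ (fibre V z)
  proper : ∀ z, ∀ a v : Cn n, v ≠ 0 → ∃ t : ℝ, a + t • v ∉ closure (fibre V z)

/-- `A ⋐ B`: the set `A` is relatively compact in `B`. -/
def RelCompact {E : Type*} [TopologicalSpace E] (A B : Set E) : Prop :=
  IsCompact (closure A) ∧ closure A ⊆ B

/-- `V'` is a relatively compact cone in `V`. -/
def ConeRelCompact {n : ℕ} (V' V : Set (Cn n × Cn n)) : Prop :=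
  ∃ K : Set (Cn n × Cn n), RelCompact K V ∧
    V' = {p | ∃ q ∈ K, ∃ t : ℝ, 0 < t ∧ p = (q.1, t • q.2)}

/-- `W` is an infinitesimal wedge of type `V` (at infinity). -/
def IsInfWedge {n : ℕ} (V W : Set (Cn n × Cn n)) : Prop :=
  W ⊆ V ∧ ∀ K : Set (Cn n × Cn n), RelCompact K V →
    ∃ δ : ℝ, 0 < δ ∧ ∀ q ∈ K, ∀ t : ℝ, δ < t → (q.1, t • q.2) ∈ W

/-! ### Wirtinger derivatives -/

/-- For a unit coordinate vector `v`, the derivative `∂/∂z` in the complex coordinate of `v`. -/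
def dDir {n : ℕ} (v : Cn n × Cn n) (f : Cn n × Cn n → ℂ) (p : Cn n × Cn n) : ℂ :=
  (1 / 2) * (fderiv ℝ f p v - Complex.I * fderiv ℝ f p (Complex.I • v))

/-- For a unit coordinate vector `v`, the derivative `∂/∂z̄` in the complex coordinate of `v`. -/
def dbarDir {n : ℕ} (v : Cn n × Cn n) (f : Cn n × Cn n → ℂ) (p : Cn n × Cn n) : ℂ :=
  (1 / 2) * (fderiv ℝ f p v + Complex.I * fderiv ℝ f p (Complex.I • v))

/-- `∂/∂zᵢ`, where `z` is the first variable. -/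
def dz {n : ℕ} (i : Fin n) (f : Cn n × Cn n → ℂ) : Cn n × Cn n → ℂ :=
  dDir (EuclideanSpace.single i (1 : ℂ), 0) f

/-- `∂/∂z̄ᵢ`, where `z` is the first variable. -/
def dzbar {n : ℕ} (i : Fin n) (f : Cn n × Cn n → ℂ) : Cn n × Cn n → ℂ :=
  dbarDir (EuclideanSpace.single i (1 : ℂ), 0) f

/-- The iterated derivative with multi-index `α` built from first order operators `D i`. -/
def multiDeriv {n : ℕ} (D : Fin n → (Cn n × Cn n → ℂ) → Cn n × Cn n → ℂ) (α : Fin n → ℕ)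
    (f : Cn n × Cn n → ℂ) : Cn n × Cn n → ℂ :=
  (List.finRange n).foldr (fun i g => (D i)^[α i] g) f

/-! ### Symbols and null-symbols of `C^∞`-type -/

/-- `f(z, ζ)` is `C^∞` on the open set `W` and holomorphic there in `ζ`. -/
structure MemCinfO {n : ℕ} (W : Set (Cn n × Cn n)) (f : Cn n × Cn n → ℂ) : Prop where
  isOpen : IsOpen W
  smooth : ContDiffOn ℝ ∞ f W
  holo : ∀ p ∈ W, DifferentiableAt ℂ (fun ζ => f (p.1, ζ)) p.2

/-- Null-symbols of `C^∞`-type on `V`. -/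
def IsNullSymbol {n : ℕ} (V : Set (Cn n × Cn n)) (f : Cn n × Cn n → ℂ) : Prop :=
  ∃ W, IsInfWedge V W ∧ MemCinfO W f ∧
    ∀ V' : Set (Cn n × Cn n), IsOpen V' → IsCone V' → ConeRelCompact V' V →
      ∃ W' ⊆ W, IsInfWedge V' W' ∧
        ∀ α β : Fin n → ℕ, ∃ h : ℝ, 0 < h ∧ ∃ C : ℝ, 0 < C ∧
          ∀ p ∈ W', ‖multiDeriv dz α (multiDeriv dzbar β f) p‖ ≤ C * Real.exp (-h * ‖p.2‖)

/-- Symbols of `C^∞`-type on `V`. -/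
def IsSymbol {n : ℕ} (V : Set (Cn n × Cn n)) (f : Cn n × Cn n → ℂ) : Prop :=
  (∃ W, IsInfWedge V W ∧ MemCinfO W f ∧
    ∀ V' : Set (Cn n × Cn n), IsOpen V' → IsCone V' → ConeRelCompact V' V →
      ∃ W' ⊆ W, IsInfWedge V' W' ∧
        ∀ α β : Fin n → ℕ, ∀ h : ℝ, 0 < h → ∃ C : ℝ, 0 < C ∧
          ∀ p ∈ W', ‖multiDeriv dz α (multiDeriv dzbar β f) p‖ ≤ C * Real.exp (h * ‖p.2‖)) ∧
  ∀ i : Fin n, IsNullSymbol V (dzbar i f)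

/-! ### Forms of type `(0, n; r)` and the Čech-Dolbeault complex -/

/-- Indices of the antiholomorphic differentials on `X × X`, in the order
`dz̄₁, …, dz̄ₙ, dz̄'₁, …, dz̄'ₙ`. -/
abbrev Idx (n : ℕ) : Type := Fin n ⊕ₗ Fin n

/-- The coordinate vector of `X × X` belonging to an index. -/
def dir {n : ℕ} (k : Idx n) : Cn n × Cn n :=
  Sum.elim (fun i => (EuclideanSpace.single i (1 : ℂ), (0 : Cn n)))
    (fun i => ((0 : Cn n), EuclideanSpace.single i (1 : ℂ))) (ofLex k)

/-- The coefficients of a form of type `(0, n; r)`: the family `f` stands for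
`∑_{|K| = r} f_K dz'₁ ∧ ⋯ ∧ dz'ₙ ∧ dz̄^K`, where `dz̄^K` is the wedge product in increasing order
of the `dz̄_k`, `k ∈ K`.  Members with `|K| ≠ r` are irrelevant. -/
abbrev Coeffs (n : ℕ) : Type := Finset (Idx n) → Cn n × Cn n → ℂ

/-- The Dolbeault operator of `X × X` in coefficients:
`∂̄(f dz' ∧ dz̄^J) = ∑_k (∂f/∂z̄_k) dz̄_k ∧ dz' ∧ dz̄^J`.  Moving `dz̄_k` past `dz'` gives the factor
`(-1)^n`, sorting it into `dz̄^J` the second sign. -/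
def dbar {n : ℕ} (f : Coeffs n) : Coeffs n := fun K p =>
  (-1) ^ n * ∑ k ∈ K, (-1) ^ (K.filter (· < k)).card * dbarDir (dir k) (f (K.erase k)) p

/-- A cochain `(ω₁, ω₀₁)` of degree `r` of the relative Čech-Dolbeault complex of `(U, U ∖ G)`:
`ω₁` is a smooth form of type `(0, n; r)` on `U`, and `ω₀₁` is one of type `(0, n; r - 1)` on
`U ∖ G`. -/
structure Cochain {n : ℕ} (U G : Set (Cn n × Cn n)) (r : ℤ) where
  form1 : Coeffs n
  form01 : Coeffs n
  smooth1 : ∀ K : Finset (Idx n), (K.card : ℤ) = r → ContDiffOn ℝ ∞ (form1 K) U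
  smooth01 : ∀ K : Finset (Idx n), (K.card : ℤ) = r - 1 → ContDiffOn ℝ ∞ (form01 K) (U \ G)

/-- `ϑ̄ τ = (a, b)`, where `ϑ̄(τ₁, τ₀₁) = (∂̄τ₁, τ₁ - ∂̄τ₀₁)`. -/
def HasDifferential {n : ℕ} {U G : Set (Cn n × Cn n)} {r : ℤ} (τ : Cochain U G r)
    (a b : Coeffs n) : Prop :=
  (∀ K : Finset (Idx n), (K.card : ℤ) = r + 1 → ∀ p ∈ U, dbar τ.form1 K p = a K p) ∧
  (∀ K : Finset (Idx n), (K.card : ℤ) = r → ∀ p ∈ U \ G,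
    τ.form1 K p - dbar τ.form01 K p = b K p)

/-- Cocycles, that is, representatives of classes of the cohomology `H^{0,n,r}(U, U ∖ G)`. -/
def IsCocycle {n : ℕ} {U G : Set (Cn n × Cn n)} {r : ℤ} (η : Cochain U G r) : Prop :=
  HasDifferential η 0 0

/-- `η` is zero in cohomology. -/
def IsCoboundary {n : ℕ} {U G : Set (Cn n × Cn n)} {r : ℤ} (η : Cochain U G r) : Prop :=
  ∃ τ : Cochain U G (r - 1), HasDifferential τ η.form1 η.form01

/-- `η` and `η'` have the same class in cohomology. -/
def Cohomologous {n : ℕ} {U G : Set (Cn n × Cn n)} {r : ℤ} (η η' : Cochain U G r) : Prop :=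
  ∃ τ : Cochain U G (r - 1),
    HasDifferential τ (η.form1 - η'.form1) (η.form01 - η'.form01)

/-! ### Polar sets, the `γ`-topology, domains -/

/-- The polar set in `TX` of a set in `T*X`.  The sign is the one for which `e^{⟨v, ζ⟩}` is bounded
for `ζ ∈ V` and `v` in the polar set. -/
def polar {n : ℕ} (V : Set (Cn n × Cn n)) : Set (Cn n × Cn n) :=
  {p | p.1 ∈ base V ∧ ∀ ζ ∈ fibre V p.1, (pairing p.2 ζ).re ≤ 0}

/-- The identification `(z, z') ↦ (z, z' - z)` of `X × X` with `TX`. -/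
def rho {n : ℕ} (p : Cn n × Cn n) : Cn n × Cn n := (p.1, p.2 - p.1)

/-- The fibrewise sum `Ω + γ`, with `Ω_z + γ_z` read as `Ω_z` where `γ_z` is empty. -/
def fibreSum {n : ℕ} (Ω γ : Set (Cn n × Cn n)) : Set (Cn n × Cn n) :=
  {p | (fibre γ p.1 = ∅ ∧ p ∈ Ω) ∨
    ∃ v ∈ fibre Ω p.1, ∃ w ∈ fibre γ p.1, p.2 = v + w}

/-- Open sets of the `γ`-topology on `TX`. -/
def IsGammaOpen {n : ℕ} (γ Ω : Set (Cn n × Cn n)) : Prop :=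
  IsOpen Ω ∧ fibreSum Ω γ = Ω

/-- `ρ` is a smooth defining function of the open set `D` near its boundary point `p`. -/
structure IsDefFun {n : ℕ} (D : Set (Cn n × Cn n)) (ρ : Cn n × Cn n → ℝ) (p : Cn n × Cn n) :
    Prop where
  smooth : ContDiff ℝ ∞ ρ
  deriv_ne : fderiv ℝ ρ p ≠ 0
  mem_iff : ∀ᶠ q in 𝓝 p, q ∈ D ↔ ρ q < 0

/-- The differential of `ρ` along the fibre `p₁⁻¹(z)` of `X × X` through `p`. -/
def fibreDeriv {n : ℕ} (ρ : Cn n × Cn n → ℝ) (p : Cn n × Cn n) : Cn n →L[ℝ] ℝ :=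
  (fderiv ℝ ρ p).comp (ContinuousLinearMap.inr ℝ (Cn n) (Cn n))

/-- The auxiliary cones `Γ₁` and `Γ₂`. -/
structure AdmissibleCones {n : ℕ} (V V' U G Γ₁ Γ₂ : Set (Cn n × Cn n)) : Prop where
  cone₁ : IsOpenConvexProperCone Γ₁
  cone₂ : IsOpenConvexProperCone Γ₂
  sub₂ : ConeRelCompact V' Γ₂
  sub₁₂ : ConeRelCompact Γ₂ Γ₁
  sub₁ : ConeRelCompact Γ₁ V
  support : ∀ p ∈ G ∩ U, p.1 ∈ base V' → rho p ∈ interior (polar Γ₁) ∨ p.2 = p.1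

/-- The conditions on the domains `D₁` and `D₂`, all over `π(V')`. -/
structure AdmissibleDomains {n : ℕ} (V' U G Γ₁ Γ₂ D₁ D₂ : Set (Cn n × Cn n)) : Prop where
  isOpen₁ : IsOpen D₁
  isOpen₂ : IsOpen D₂
  smooth₁ : ∀ p ∈ frontier D₁, p.1 ∈ base V' → ∃ ρ, IsDefFun D₁ ρ p
  smooth₂ : ∀ p ∈ frontier D₂, p.1 ∈ base V' → ∃ ρ, IsDefFun D₂ ρ p
  gammaOpen₁ : IsGammaOpen (polar Γ₁) (rho '' D₁)
  gammaOpen₂ : IsGammaOpen (polar Γ₂) (rho '' D₂)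
  diag_mem : ∀ z ∈ base V', (z, z) ∈ D₁
  closure₂ : ∀ p ∈ closure D₂, p.1 ∈ base V' → rho p ∈ interior (polar Γ₂)
  closure_D : ∀ p ∈ closure (D₁ \ D₂), p.1 ∈ base V' → p ∈ U
  closure_E : ∀ p ∈ closure (frontier D₁ \ D₂), p.1 ∈ base V' → p ∈ U \ G
  /-- The fibres are transversal to each of the two boundaries. -/
  transversal₁ : ∀ p ∈ frontier D₁, p.1 ∈ base V' → ∀ ρ, IsDefFun D₁ ρ p → fibreDeriv ρ p ≠ 0
  transversal₂ : ∀ p ∈ frontier D₂, p.1 ∈ base V' → ∀ ρ, IsDefFun D₂ ρ p → fibreDeriv ρ p ≠ 0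
  /-- Within each fibre the two boundaries are transversal to each other. -/
  transversal₁₂ : ∀ p ∈ frontier D₁ ∩ frontier D₂, p.1 ∈ base V' →
    ∀ ρ₁ ρ₂, IsDefFun D₁ ρ₁ p → IsDefFun D₂ ρ₂ p →
      LinearIndependent ℝ ![fibreDeriv ρ₁ p, fibreDeriv ρ₂ p]
  /-- The domain of integration is bounded, locally uniformly in `z`. -/
  bounded : ∀ K : Set (Cn n), IsCompact K → K ⊆ base V' →
    Bornology.IsBounded ((D₁ \ D₂) ∩ Prod.fst ⁻¹' K)

/-! ### Integration in a fibre -/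

/-- `ν` is the outer unit normal at the boundary point `x` of a set `A` with smooth boundary. -/
def IsOuterUnitNormal {n : ℕ} (A : Set (Cn n)) (x ν : Cn n) : Prop :=
  ‖ν‖ = 1 ∧ ∀ v : Cn n,
    (inner ℝ v ν < 0 → ∀ᶠ t : ℝ in 𝓝[>] 0, x + t • v ∈ A) ∧
    (0 < inner ℝ v ν → ∀ᶠ t : ℝ in 𝓝[>] 0, x + t • v ∉ A)

open Classical in
/-- The outer unit normal (unique if it exists). -/
def outerNormal {n : ℕ} (A : Set (Cn n)) (x : Cn n) : Cn n :=
  if h : ∃ ν, IsOuterUnitNormal A x ν then h.choose else 0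

/-- The constant `c` in `dz'₁ ∧ ⋯ ∧ dz'ₙ ∧ dz̄'₁ ∧ ⋯ ∧ dz̄'ₙ = c · (Lebesgue measure)`, for the
orientation `dx'₁ ∧ dy'₁ ∧ ⋯ ∧ dx'ₙ ∧ dy'ₙ` of `ℂⁿ`. -/
def volConst (n : ℕ) : ℂ := (-1) ^ (n * (n - 1) / 2) * (-2 * Complex.I) ^ n

/-- The set of all indices of the `dz̄'_k`; the only one that contributes to the restriction of a
form of type `(0, n; n)` to a fibre `p₁⁻¹(z)`. -/
def fibreIdx (n : ℕ) : Finset (Idx n) :=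
  (Finset.univ : Finset (Fin n)).image (fun k => toLex (Sum.inr k))

/-- The density with respect to Lebesgue measure of the restriction to `p₁⁻¹(z)` of
`ω₁ e^{⟨z' - z, ζ⟩}`. -/
def density1 {n : ℕ} (a : Coeffs n) (z ζ w : Cn n) : ℂ :=
  volConst n * (a (fibreIdx n) (z, w) * Complex.exp (pairing (w - z) ζ))

/-- The density with respect to surface measure of the restriction of `ω₀₁ e^{⟨z' - z, ζ⟩}` to a
hypersurface in `p₁⁻¹(z)` with unit normal `ν`, the hypersurface being oriented so that `ν` followed
by a positive frame of it is a positive frame of `ℂⁿ`.  With `b_k` the coefficient of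
`dz' ∧ ⋀_{j ≠ k} dz̄'_j`, that density is the coefficient of the volume form in
`ν^♭ ∧ ∑_k b_k dz' ∧ ⋀_{j ≠ k} dz̄'_j`, where
`ν^♭ = ½ ∑_k (ν̄_k dz'_k + ν_k dz̄'_k)`; the index `k` runs from `0`. -/
def density01 {n : ℕ} (b : Coeffs n) (ν z ζ w : Cn n) : ℂ :=
  volConst n * ∑ k : Fin n, (-1) ^ (n + (k : ℕ)) * (ν k / 2) *
    (b ((fibreIdx n).erase (toLex (Sum.inr k))) (z, w) * Complex.exp (pairing (w - z) ζ))

/-- The integrand over `E_z`, with `E_z` oriented as part of the boundary of the fibre of `D₁`. -/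
def boundaryDensity {n : ℕ} (D₁ : Set (Cn n × Cn n)) (b : Coeffs n) (z ζ w : Cn n) : ℂ :=
  density01 b (outerNormal (fibre D₁ z) w) z ζ w

/-- Both integrals that define the symbol map converge at every point over `π(V')`. -/
def IntegralsConverge {n : ℕ} (V' D₁ D₂ : Set (Cn n × Cn n)) (a b : Coeffs n) : Prop :=
  ∀ z ∈ base V', ∀ ζ : Cn n,
    IntegrableOn (density1 a z ζ) (fibre (D₁ \ D₂) z) volume ∧
    IntegrableOn (boundaryDensity D₁ b z ζ) (fibre (frontier D₁ \ D₂) z) μHE[2 * n - 1]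

/-- The integral map
`∫_{D_z} ω₁ e^{⟨z' - z, ζ⟩} - ∫_{E_z} ω₀₁ e^{⟨z' - z, ζ⟩}` with `D = D₁ ∖ D₂`, `E = ∂D₁ ∖ D₂`. -/
def symbolMap {n : ℕ} (D₁ D₂ : Set (Cn n × Cn n)) {U G : Set (Cn n × Cn n)} {r : ℤ}
    (η : Cochain U G r) : Cn n × Cn n → ℂ := fun p =>
  (∫ w in fibre (D₁ \ D₂) p.1, density1 η.form1 p.1 p.2 w) -
    ∫ w in fibre (frontier D₁ \ D₂) p.1, boundaryDensity D₁ η.form01 p.1 p.2 w ∂μHE[2 * n - 1]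

end CDSymbol

end

open CDSymbol

open scoped ContDiff Topology MeasureTheory
open MeasureTheory Set Filter

noncomputable section

namespace CDSymbol

section

/-! ### Smoothness of parametric integrals -/

section Parametric

variable {P G : Type*} [NormedAddCommGroup P] [NormedSpace ℝ P]
  [NormedAddCommGroup G] [NormedSpace ℝ G] [MeasurableSpace G]
  [BorelSpace G] {μ : Measure G} [IsLocallyFiniteMeasure μ] {F : P × G → ℂ} {k : Set G}

/-! Everything is measured in one class of functions. Near a point (z₀, ζ₀) of V', take
combinations, with coefficients polynomial in ζ, of integrals ∫ A(z, s) e^{⟨Φ(z, s), ζ⟩} dμ(s),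
where A is smooth with compact support, Φ is smooth, μ does not depend on z, and Re⟨Φ, ζ₀⟩ ≤ a on
the support of A (`IsOsc`, `IsLocOsc`). The class is stable under ∂/∂z and ∂/∂z̄, its members are
holomorphic in ζ, and they are O(e^{bt}) at (z, tζ) for every b > a and (z, ζ) near (z₀, ζ₀)
(`IsOsc.bound`). By compactness a function is a null-symbol if some a < 0 is available at each
point, and it has the growth of a symbol if every a > 0 is.

Integrals over D_z and E_z with smooth compactly supported amplitudes belong to this class.
Fibrewise diffeomorphisms (`Straightening`) turn the moving boundaries into fixed hyperplanes and
push the dependence on z into A and Φ; transversality provides them, also at the corners ∂D₁ ∩ ∂D₂.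
Surface measure is transported by the area formula `map_restrict_image_eq_withDensity`, and the same
coordinates give Stokes' formula for ∂/∂z̄'ₖ (`Straightening.integral_dbarDir_eq_surface`). A
partition of unity glues the pieces (`AdmissibleDomains.isIntegrationChart`).

The geometry enters through the phase Re⟨z' - z, ζ₀⟩. Since V' is open, a vector in the polar of a
neighbourhood of ζ₀ has phase at most -(δ/2)|z' - z|. As the closure of D₂ avoids the diagonal, the
phase is ≤ -4c on D₂ for some c > 0, while G ∩ U lies in D₁ and has phase ≤ 0
(`exists_isLocalFrame`). Choose a cut-off φ equal to 1 near the part of G with phase > -3c and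
supported in D₁ and in {phase < ε}. Where the phase exceeds -3c, the form ω₁ - ∂̄((1 - φ)ω₀₁) is
smooth and ∂̄-closed, and it vanishes off supp φ. Stokes' formula absorbs the integral over E_z,
where φ = 0; a ramp in the phase keeps ∂D₂ out of it. Hence, up to terms with a ≤ -c/2, the symbol
is an integral over the whole fibre of a density in which D₁ and D₂ no longer appear
(`IsLocalFrame.isLocOsc_symbolMap_sub`).

All claims follow from this local formula. The bound phase < ε on supp φ gives subexponential
growth. Closedness turns ∂/∂z̄ᵢ of the density into a divergence along the fibre, and for a
coboundary the density itself is one; after integration by parts only derivatives of the ramp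
survive, and these have phase ≤ -c/2. Two choices of domains are compared by taking φ supported in
both D₁ and D₁'. -/

theorem contDiff_integral_param (hk : IsCompact k) (hF : ContDiff ℝ ∞ F)
    (h0 : ∀ p, ∀ x ∉ k, F (p, x) = 0) : ContDiff ℝ ∞ (fun p => ∫ x, F (p, x) ∂μ) := by
  -- The integral is the convolution of the constant 1 with x ↦ F(p, -x), evaluated at 0, so
  -- smoothness of convolutions with parameters applies.
  have h := contDiffOn_convolution_right_with_param_comp (𝕜 := ℝ) (μ := μ) (n := ⊤)
    (ContinuousLinearMap.lsmul ℝ ℝ) (s := (univ : Set P)) (v := fun _ => (0 : G))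
    contDiffOn_const (f := fun _ : G => (1 : ℝ)) (g := fun p x => F (p, -x)) (k := -k)
    isOpen_univ hk.neg (fun p x _ hx => h0 p _ (by simpa using hx))
    (locallyIntegrable_const _) (by
      apply ContDiff.contDiffOn
      exact hF.comp (contDiff_fst.prodMk contDiff_snd.neg))
  rw [contDiffOn_univ] at h
  convert! h using 2 with p
  simp [convolution]

/-- Dominated convergence: on the unit ball about p the derivative is bounded on a compact set and
vanishes off k, so a multiple of the indicator of k dominates it. Integrability is part of the
conclusion because evaluating the integral of a linear map at a vector requires it. -/
theorem hasFDerivAt_integral_param [FiniteDimensional ℝ P] [FiniteDimensional ℝ G]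
    (hk : IsCompact k) (hF : ContDiff ℝ ∞ F)
    (h0 : ∀ p, ∀ x ∉ k, F (p, x) = 0) (p : P) :
    Integrable (fun x => (fderiv ℝ F (p, x)).comp (ContinuousLinearMap.inl ℝ P G)) μ ∧
    HasFDerivAt (fun p => ∫ x, F (p, x) ∂μ)
      (∫ x, (fderiv ℝ F (p, x)).comp (ContinuousLinearMap.inl ℝ P G) ∂μ) p := by
  have := FiniteDimensional.proper ℝ P
  have := FiniteDimensional.proper ℝ G
  have hd : ∀ q x, HasFDerivAt (fun p => F (p, x))
      ((fderiv ℝ F (q, x)).comp (ContinuousLinearMap.inl ℝ P G)) q := fun q x =>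
    ((hF.differentiable (by simp)) (q, x)).hasFDerivAt.comp q (hasFDerivAt_prodMk_left q x)
  have hcont : Continuous fun y : P × G =>
      (fderiv ℝ F y).comp (ContinuousLinearMap.inl ℝ P G) :=
    ((hF.continuous_fderiv (by simp)).clm_comp continuous_const)
  have hz : ∀ q, ∀ x ∉ k, (fderiv ℝ F (q, x)).comp (ContinuousLinearMap.inl ℝ P G) = 0 := by
    intro q x hx
    refine (hd q x).unique ?_
    have : (fun p => F (p, x)) = fun _ => 0 := funext fun p => h0 p x hx
    rw [this]; exact hasFDerivAt_const _ _
  obtain ⟨M, hM⟩ := ((isCompact_closedBall p 1).prod hk).exists_bound_of_continuousOn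
    hcont.continuousOn
  have hint : Integrable (fun x => (fderiv ℝ F (p, x)).comp (ContinuousLinearMap.inl ℝ P G)) μ :=
    (hcont.comp (by fun_prop : Continuous fun x : G => (p, x))).integrable_of_hasCompactSupport
      (HasCompactSupport.intro hk (hz p))
  refine ⟨hint, ?_⟩
  refine hasFDerivAt_integral_of_dominated_of_fderiv_le (s := Metric.closedBall p 1)
    (bound := k.indicator fun _ => M) (Metric.closedBall_mem_nhds p one_pos) ?_ ?_ ?_ ?_ ?_ ?_
    (F' := fun q x => (fderiv ℝ F (q, x)).comp (ContinuousLinearMap.inl ℝ P G))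
  · exact Eventually.of_forall fun q =>
      (hF.continuous.comp (by fun_prop : Continuous fun x : G => (q, x))).aestronglyMeasurable
  · exact (hF.continuous.comp (by fun_prop : Continuous fun x : G =>
      (p, x))).integrable_of_hasCompactSupport (HasCompactSupport.intro hk (h0 p))
  · exact hint.aestronglyMeasurable
  · refine Eventually.of_forall fun x q hq => ?_
    by_cases hx : x ∈ k
    · rw [indicator_of_mem hx]; exact hM (q, x) ⟨hq, hx⟩
    · rw [hz q x hx, indicator_of_notMem hx]; simp
  · exact (integrable_indicator_iff hk.measurableSet).2 (integrableOn_const hk.measure_lt_top.ne)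
  · exact Eventually.of_forall fun x q _ => hd q x

end Parametric

/-! ### The pairing -/

section Pairing

variable {n : ℕ}

/-- The pairing as a real bilinear map. -/
def pairingL (n : ℕ) : Cn n →L[ℝ] Cn n →L[ℝ] ℂ :=
  LinearMap.toContinuousLinearMap
    ((LinearMap.toContinuousLinearMap (𝕜 := ℝ) (E := Cn n) (F' := ℂ)).toLinearMap ∘ₗ
      (LinearMap.mk₂ ℝ (fun v ζ : Cn n => pairing v ζ)
        (fun a b c => by simp [pairing, add_mul, Finset.sum_add_distrib])
        (fun a b c => by simp [pairing, Finset.mul_sum, mul_assoc])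
        (fun a b c => by simp [pairing, mul_add, Finset.sum_add_distrib])
        (fun a b c => by simp [pairing, Finset.mul_sum, mul_left_comm])))

theorem pairingL_apply (v ζ : Cn n) : pairingL n v ζ = pairing v ζ := rfl

theorem pairing_add_left (v w ζ : Cn n) : pairing (v + w) ζ = pairing v ζ + pairing w ζ := by
  simp [← pairingL_apply]

theorem pairing_sub_right (v ζ ξ : Cn n) : pairing v (ζ - ξ) = pairing v ζ - pairing v ξ := by
  simp [← pairingL_apply]

theorem pairing_smul_right (t : ℝ) (v ζ : Cn n) : pairing v (t • ζ) = t * pairing v ζ := by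
  simp [← pairingL_apply]

theorem norm_pairing_le (v ζ : Cn n) : ‖pairing v ζ‖ ≤ ‖pairingL n‖ * ‖v‖ * ‖ζ‖ :=
  (pairingL n).le_opNorm₂ v ζ

@[fun_prop]
theorem contDiff_pairing {E : Type*} [NormedAddCommGroup E] [NormedSpace ℝ E] {f g : E → Cn n}
    (hf : ContDiff ℝ ∞ f) (hg : ContDiff ℝ ∞ g) : ContDiff ℝ ∞ fun x => pairing (f x) (g x) :=
  ((pairingL n).contDiff.comp hf).clm_apply hg

theorem continuous_pairing : Continuous fun q : Cn n × Cn n => pairing q.1 q.2 :=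
  (contDiff_pairing contDiff_fst contDiff_snd).continuous

theorem hasFDerivAt_pairing {E : Type*} [NormedAddCommGroup E] [NormedSpace ℝ E] {f g : E → Cn n}
    {f' g' : E →L[ℝ] Cn n} {x : E} (hf : HasFDerivAt f f' x) (hg : HasFDerivAt g g' x) :
    HasFDerivAt (fun x => pairing (f x) (g x))
      ((pairingL n (f x)).comp g' + ((pairingL n).flip (g x)).comp f') x := by
  have := (pairingL n).hasFDerivAt_of_bilinear hf hg
  convert! this using 1

end Pairing

end

section

/-! ### Exponential integrals depending on parameters -/

variable {n : ℕ}

/-- The integral `∫ A(z, s) e^{⟨Φ(z, s), ζ⟩} dμ(s)`. -/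
def oscInt (μ : Measure (Cn n)) (A : Cn n × Cn n → ℂ) (Φ : Cn n × Cn n → Cn n) :
    Cn n × Cn n → ℂ :=
  fun p => ∫ s, A (p.1, s) * Complex.exp (pairing (Φ (p.1, s)) p.2) ∂μ

/-- Finite combinations, with coefficients that are polynomial in `ζ`, of integrals
`∫ A(z, s) e^{⟨Φ(z, s), ζ⟩} dμ(s)` with smooth compactly supported amplitude and
`Re ⟨Φ, ζ₀⟩ ≤ a` on its support. -/
inductive IsOsc (ζ₀ : Cn n) (a : ℝ) : (Cn n × Cn n → ℂ) → Prop
  | osc (μ : Measure (Cn n)) (hμ : IsLocallyFiniteMeasure μ) (A : Cn n × Cn n → ℂ)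
      (Φ : Cn n × Cn n → Cn n) (hA : ContDiff ℝ ∞ A) (hc : HasCompactSupport A)
      (hΦ : ContDiff ℝ ∞ Φ) (hle : ∀ q ∈ tsupport A, (pairing (Φ q) ζ₀).re ≤ a) :
      IsOsc ζ₀ a (oscInt μ A Φ)
  | add (f g : Cn n × Cn n → ℂ) : IsOsc ζ₀ a f → IsOsc ζ₀ a g → IsOsc ζ₀ a (fun p => f p + g p)
  | const_mul (c : ℂ) (f : Cn n × Cn n → ℂ) : IsOsc ζ₀ a f → IsOsc ζ₀ a (fun p => c * f p)
  | coord_mul (j : Fin n) (f : Cn n × Cn n → ℂ) :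
      IsOsc ζ₀ a f → IsOsc ζ₀ a (fun p => p.2 j * f p)

section oscInt

variable {μ : Measure (Cn n)} [IsLocallyFiniteMeasure μ] {A : Cn n × Cn n → ℂ}
  {Φ : Cn n × Cn n → Cn n}

theorem oscInt_amplitude_eq_zero {z s ζ : Cn n} (hs : s ∉ Prod.snd '' tsupport A) :
    A (z, s) * Complex.exp (pairing (Φ (z, s)) ζ) = 0 := by
  rw [image_eq_zero_of_notMem_tsupport (f := A) fun h => hs ⟨_, h, rfl⟩, zero_mul]

theorem contDiff_oscIntegrand (hA : ContDiff ℝ ∞ A) (hΦ : ContDiff ℝ ∞ Φ) :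
    ContDiff ℝ ∞ (fun y : (Cn n × Cn n) × Cn n =>
      A (y.1.1, y.2) * Complex.exp (pairing (Φ (y.1.1, y.2)) y.1.2)) := by
  have h1 : ContDiff ℝ ∞ (fun y : (Cn n × Cn n) × Cn n => (y.1.1, y.2)) := by fun_prop
  exact (hA.comp h1).mul ((contDiff_pairing (hΦ.comp h1) (by fun_prop)).cexp)

theorem contDiff_oscInt (hA : ContDiff ℝ ∞ A) (hc : HasCompactSupport A) (hΦ : ContDiff ℝ ∞ Φ) :
    ContDiff ℝ ∞ (oscInt μ A Φ) :=
  contDiff_integral_param (μ := μ) (hc.isCompact.image continuous_snd) (contDiff_oscIntegrand hA hΦ)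
    fun _ _ hx => oscInt_amplitude_eq_zero hx

theorem integrable_oscIntegrand (hA : Continuous A) (hc : HasCompactSupport A)
    (hΦ : Continuous Φ) (z ζ : Cn n) :
    Integrable (fun s => A (z, s) * Complex.exp (pairing (Φ (z, s)) ζ)) μ := by
  refine Continuous.integrable_of_hasCompactSupport ?_
    (HasCompactSupport.intro (hc.isCompact.image continuous_snd)
      fun x hx => oscInt_amplitude_eq_zero hx)
  have h1 : Continuous fun s : Cn n => (z, s) := by fun_prop
  have h2 : Continuous fun s : Cn n => pairing (Φ (z, s)) ζ :=
    continuous_pairing.comp ((hΦ.comp h1).prodMk continuous_const)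
  exact (hA.comp h1).mul (Complex.continuous_exp.comp h2)

theorem pairing_single_sum (v ζ : Cn n) : pairing v ζ = ∑ j, ζ j * v j := by
  simp [pairing, mul_comm]

/-- A derivative in z falls on the amplitude or brings down ⟨∂Φ, ζ⟩, which is linear in ζ; this is
why `IsOsc` admits multiplication by coordinates of ζ. A derivative in ζ brings down Φ and is
therefore complex linear in the direction. -/
theorem fderiv_oscInt (hA : ContDiff ℝ ∞ A) (hc : HasCompactSupport A) (hΦ : ContDiff ℝ ∞ Φ)
    (p v : Cn n × Cn n) :
    fderiv ℝ (oscInt μ A Φ) p v =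
      oscInt μ (fun q => fderiv ℝ A q (v.1, 0)) Φ p +
      (∑ j, p.2 j * oscInt μ (fun q => A q * (fderiv ℝ Φ q (v.1, 0)) j) Φ p) +
      ∑ j, v.2 j * oscInt μ (fun q => A q * Φ q j) Φ p := by
  obtain ⟨hi, hd⟩ := hasFDerivAt_integral_param (μ := μ) (hc.isCompact.image continuous_snd)
    (contDiff_oscIntegrand hA hΦ) (fun p _ hx => oscInt_amplitude_eq_zero hx) p
  have hcA : HasCompactSupport (fun q => fderiv ℝ A q (v.1, 0)) :=
    hc.fderiv_apply (𝕜 := ℝ) (v.1, 0)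
  have hsA : ContDiff ℝ ∞ (fun q => fderiv ℝ A q (v.1, 0)) :=
    (hA.fderiv_right (by simp)).clm_apply contDiff_const
  have hsΦ : ContDiff ℝ ∞ (fun q => fderiv ℝ Φ q (v.1, 0)) :=
    (hΦ.fderiv_right (by simp)).clm_apply contDiff_const
  rw [show oscInt μ A Φ = fun p => ∫ s, A (p.1, s) * Complex.exp (pairing (Φ (p.1, s)) p.2) ∂μ
    from rfl, hd.fderiv, ContinuousLinearMap.integral_apply hi]
  have key : ∀ s, ((fderiv ℝ (fun y : (Cn n × Cn n) × Cn n =>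
      A (y.1.1, y.2) * Complex.exp (pairing (Φ (y.1.1, y.2)) y.1.2)) (p, s)).comp
      (ContinuousLinearMap.inl ℝ (Cn n × Cn n) (Cn n))) v =
      (fderiv ℝ A (p.1, s) (v.1, 0)) * Complex.exp (pairing (Φ (p.1, s)) p.2) +
      (∑ j, p.2 j * ((A (p.1, s) * (fderiv ℝ Φ (p.1, s) (v.1, 0)) j) *
        Complex.exp (pairing (Φ (p.1, s)) p.2))) +
      ∑ j, v.2 j * ((A (p.1, s) * Φ (p.1, s) j) * Complex.exp (pairing (Φ (p.1, s)) p.2)) := by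
    intro s
    have hl : HasFDerivAt (fun y : (Cn n × Cn n) × Cn n => (y.1.1, y.2))
        (((ContinuousLinearMap.fst ℝ (Cn n) (Cn n)).comp
          (ContinuousLinearMap.fst ℝ (Cn n × Cn n) (Cn n))).prod
          (ContinuousLinearMap.snd ℝ (Cn n × Cn n) (Cn n))) (p, s) :=
      (((ContinuousLinearMap.fst ℝ (Cn n) (Cn n)).comp
          (ContinuousLinearMap.fst ℝ (Cn n × Cn n) (Cn n))).prod
          (ContinuousLinearMap.snd ℝ (Cn n × Cn n) (Cn n))).hasFDerivAt
    have hz : HasFDerivAt (fun y : (Cn n × Cn n) × Cn n => y.1.2)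
        ((ContinuousLinearMap.snd ℝ (Cn n) (Cn n)).comp
          (ContinuousLinearMap.fst ℝ (Cn n × Cn n) (Cn n))) (p, s) :=
      ((ContinuousLinearMap.snd ℝ (Cn n) (Cn n)).comp
          (ContinuousLinearMap.fst ℝ (Cn n × Cn n) (Cn n))).hasFDerivAt
    have h1 := ((hA.differentiable (by simp)) (p.1, s)).hasFDerivAt.comp (p, s) hl
    have h2 := ((hΦ.differentiable (by simp)) (p.1, s)).hasFDerivAt.comp (p, s) hl
    have h3 := h1.fun_mul (hasFDerivAt_pairing h2 hz).cexp
    have e := h3.fderiv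
    simp only [Function.comp_def] at e
    rw [e]
    simp only [ContinuousLinearMap.comp_apply, add_apply,
      smul_apply, ContinuousLinearMap.inl_apply,
      ContinuousLinearMap.prod_apply, ContinuousLinearMap.coe_fst', ContinuousLinearMap.coe_snd',
      ContinuousLinearMap.flip_apply, pairingL_apply, smul_eq_mul]
    rw [pairing_single_sum _ v.2, pairing_single_sum _ p.2]
    simp only [pairing, mul_add, Finset.mul_sum]
    rw [add_comm, add_comm (∑ _, _) (∑ _, _), ← add_assoc]
    congr 1
    · congr 1
      · ring
      · exact Finset.sum_congr rfl fun j _ => by ring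
    · exact Finset.sum_congr rfl fun j _ => by ring
  simp_rw [key]
  have i1 := integrable_oscIntegrand (μ := μ) hsA.continuous hcA hΦ.continuous p.1 p.2
  have i2 : ∀ j, Integrable (fun s => (A (p.1, s) * (fderiv ℝ Φ (p.1, s) (v.1, 0)) j) *
        Complex.exp (pairing (Φ (p.1, s)) p.2)) μ := fun j =>
    integrable_oscIntegrand (μ := μ) (A := fun q => A q * (fderiv ℝ Φ q (v.1, 0)) j)
      (hA.continuous.mul (by have := hsΦ.continuous; fun_prop)) hc.mul_right
      hΦ.continuous p.1 p.2
  have i3 : ∀ j, Integrable (fun s => (A (p.1, s) * Φ (p.1, s) j) *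
        Complex.exp (pairing (Φ (p.1, s)) p.2)) μ := fun j =>
    integrable_oscIntegrand (μ := μ) (A := fun q => A q * Φ q j)
      (hA.continuous.mul (by have := hΦ.continuous; fun_prop)) hc.mul_right
      hΦ.continuous p.1 p.2
  have i4 := integrable_finsetSum Finset.univ fun j _ => (i2 j).const_mul (p.2 j)
  rw [integral_add (i1.fun_add i4) (integrable_finsetSum _ fun j _ => (i3 j).const_mul _),
    integral_add i1 i4,
    integral_finsetSum _ (fun j _ => (i2 j).const_mul _),
    integral_finsetSum _ (fun j _ => (i3 j).const_mul _)]
  simp only [integral_const_mul, oscInt]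

end oscInt

namespace IsOsc

variable {ζ₀ : Cn n} {a : ℝ} {f g : Cn n × Cn n → ℂ}

theorem contDiff (h : IsOsc ζ₀ a f) : ContDiff ℝ ∞ f := by
  induction h with
  | osc μ hμ A Φ hA hc hΦ hle => exact contDiff_oscInt hA hc hΦ
  | add f g _ _ hf hg => exact hf.add hg
  | const_mul c f _ hf => exact contDiff_const.mul hf
  | coord_mul j f _ hf => exact ContDiff.mul (by fun_prop) hf

theorem zero : IsOsc ζ₀ a (fun _ => 0) := by
  have := const_mul 0 _ (osc (ζ₀ := ζ₀) (a := a) 0 inferInstance (fun _ => 0) (fun _ => 0)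
    contDiff_const HasCompactSupport.zero contDiff_const (by simp [tsupport]))
  simpa using this

theorem sum {ι : Type*} (s : Finset ι) (F : ι → Cn n × Cn n → ℂ)
    (h : ∀ i ∈ s, IsOsc ζ₀ a (F i)) : IsOsc ζ₀ a (fun p => ∑ i ∈ s, F i p) := by
  classical
  induction s using Finset.induction_on with
  | empty => simpa using zero
  | insert i s hi ih =>
    simp only [Finset.sum_insert hi]
    exact add _ _ (h i (by simp)) (ih fun j hj => h j (by simp [hj]))

theorem mono {b : ℝ} (hab : a ≤ b) (h : IsOsc ζ₀ a f) : IsOsc ζ₀ b f := by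
  induction h with
  | osc μ hμ A Φ hA hc hΦ hle => exact osc μ hμ A Φ hA hc hΦ fun q hq => (hle q hq).trans hab
  | add f g _ _ hf hg => exact add _ _ hf hg
  | const_mul c f _ hf => exact const_mul c _ hf
  | coord_mul j f _ hf => exact coord_mul j _ hf

/-- Differentiation in z does not enlarge the support of the amplitude and leaves Φ in place, so the
same bound a survives; coordinates of ζ are constant in z. -/
theorem fderiv_fst (h : IsOsc ζ₀ a f) (v : Cn n) : IsOsc ζ₀ a (fun p => fderiv ℝ f p (v, 0)) := by
  induction h with
  | osc μ hμ A Φ hA hc hΦ hle =>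
    have e : (fun p => fderiv ℝ (oscInt μ A Φ) p (v, 0)) = fun p =>
        oscInt μ (fun q => fderiv ℝ A q (v, 0)) Φ p +
        (∑ j, p.2 j * oscInt μ (fun q => A q * (fderiv ℝ Φ q (v, 0)) j) Φ p) := by
      funext p
      rw [fderiv_oscInt hA hc hΦ]
      simp
    rw [e]
    refine add _ _ ?_ (sum _ _ fun j _ => coord_mul j _ ?_)
    · exact osc μ hμ _ _ ((hA.fderiv_right (by simp)).clm_apply contDiff_const)
        (hc.fderiv_apply (𝕜 := ℝ) (v, 0)) hΦ
        fun q hq => hle q (tsupport_fderiv_apply_subset ℝ (v, 0) hq)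
    · have hsΦ : ContDiff ℝ ∞ (fun q => fderiv ℝ Φ q (v, 0)) :=
        (hΦ.fderiv_right (by simp)).clm_apply contDiff_const
      exact osc μ hμ _ _ (hA.mul (by fun_prop)) hc.mul_right hΦ
        fun q hq => hle q (tsupport_mul_subset_left hq)
  | add f g hf' hg' hf hg =>
    convert! add _ _ hf hg using 2 with p
    rw [fderiv_fun_add (hf'.contDiff.differentiable (by simp) p)
      (hg'.contDiff.differentiable (by simp) p)]; rfl
  | const_mul c f hf' hf =>
    convert! const_mul c _ hf using 2 with p
    rw [fderiv_const_mul (hf'.contDiff.differentiable (by simp) p)]; rfl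
  | coord_mul j f hf' hf =>
    convert! coord_mul j _ hf using 2 with p
    have h1 : HasFDerivAt (fun p : Cn n × Cn n => p.2 j)
        (((EuclideanSpace.proj j : Cn n →L[ℂ] ℂ).restrictScalars ℝ).comp
          (ContinuousLinearMap.snd ℝ (Cn n) (Cn n))) p :=
      (((EuclideanSpace.proj j : Cn n →L[ℂ] ℂ).restrictScalars ℝ).comp
          (ContinuousLinearMap.snd ℝ (Cn n) (Cn n))).hasFDerivAt
    rw [(h1.fun_mul (hf'.contDiff.differentiable (by simp) p).hasFDerivAt).fderiv]
    simp

/-- Real differentiability is known; holomorphy follows because the real derivative in ζ is the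
restriction of the complex linear map `L`. -/
theorem differentiableAt_snd (h : IsOsc ζ₀ a f) (p : Cn n × Cn n) :
    DifferentiableAt ℂ (fun ζ => f (p.1, ζ)) p.2 := by
  induction h with
  | osc μ hμ A Φ hA hc hΦ hle =>
    have hr : HasFDerivAt (fun ζ => oscInt μ A Φ (p.1, ζ)) ((fderiv ℝ (oscInt μ A Φ) p).comp
        (ContinuousLinearMap.inr ℝ (Cn n) (Cn n))) p.2 :=
      HasFDerivAt.comp p.2 (f := fun ζ => (p.1, ζ))
        ((contDiff_oscInt hA hc hΦ).differentiable (by simp) (p.1, p.2)).hasFDerivAt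
        (hasFDerivAt_prodMk_right p.1 p.2)
    let L : Cn n →L[ℂ] ℂ := ∑ j, (oscInt μ (fun q => A q * Φ q j) Φ p) •
      (EuclideanSpace.proj j : Cn n →L[ℂ] ℂ)
    have hL : L.restrictScalars ℝ = (fderiv ℝ (oscInt μ A Φ) p).comp
        (ContinuousLinearMap.inr ℝ (Cn n) (Cn n)) := by
      ext η
      simp [fderiv_oscInt hA hc hΦ, L, mul_comm, oscInt, Prod.mk_zero_zero]
    exact (hasFDerivAt_of_restrictScalars ℝ hr hL).differentiableAt
  | add f g _ _ hf hg => exact hf.add hg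
  | const_mul c f _ hf => exact hf.const_mul c
  | coord_mul j f _ hf =>
    exact DifferentiableAt.mul ((EuclideanSpace.proj j : Cn n →L[ℂ] ℂ).differentiableAt) hf

/-- On the compact support of A the real part of ⟨Φ, ζ⟩ exceeds its value at ζ₀ by at most a
constant times |ζ - ζ₀|, hence stays below b for ζ near ζ₀. Scaling ζ by t multiplies the exponent
by t. -/
theorem bound (h : IsOsc ζ₀ a f) (z₀ : Cn n) {b : ℝ} (hab : a < b) :
    ∃ N ∈ 𝓝 (z₀, ζ₀), ∃ C : ℝ, 0 < C ∧ ∀ p ∈ N, ∀ t : ℝ, 0 < t →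
      ‖f (p.1, t • p.2)‖ ≤ C * Real.exp (b * t) := by
  induction h generalizing b with
  | osc μ hμ A Φ hA hc hΦ hle =>
    obtain ⟨M, hM⟩ := hc.isCompact.exists_bound_of_continuousOn hΦ.continuous.continuousOn
    obtain ⟨M', hM'⟩ := hc.isCompact.exists_bound_of_continuousOn hA.continuous.continuousOn
    set k := Prod.snd '' tsupport A
    have hk : IsCompact k := hc.isCompact.image continuous_snd
    have hN : ∀ᶠ ζ in 𝓝 ζ₀, ‖pairingL n‖ * |M| * ‖ζ - ζ₀‖ < b - a := by
      have : Tendsto (fun ζ => ‖pairingL n‖ * |M| * ‖ζ - ζ₀‖) (𝓝 ζ₀) (𝓝 0) := by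
        have : Continuous fun ζ : Cn n => ‖pairingL n‖ * |M| * ‖ζ - ζ₀‖ := by fun_prop
        convert! this.tendsto ζ₀ using 2
        simp
      exact this.eventually_lt_const (by linarith)
    refine ⟨Prod.snd ⁻¹' {ζ | ‖pairingL n‖ * |M| * ‖ζ - ζ₀‖ < b - a},
      continuous_snd.continuousAt.preimage_mem_nhds hN, |M'| * μ.real k + 1, by positivity, ?_⟩
    rintro ⟨z, ζ⟩ hζ t ht
    have hbd : ∀ s, ‖A (z, s) * Complex.exp (pairing (Φ (z, s)) (t • ζ))‖ ≤
        k.indicator (fun _ => |M'| * Real.exp (b * t)) s := by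
      intro s
      by_cases hs : (z, s) ∈ tsupport A
      · rw [indicator_of_mem (show s ∈ k from ⟨_, hs, rfl⟩), norm_mul, Complex.norm_exp]
        refine mul_le_mul ((hM' _ hs).trans (le_abs_self _)) (Real.exp_le_exp.2 ?_)
          (Real.exp_pos _).le (abs_nonneg _)
        rw [pairing_smul_right, Complex.re_ofReal_mul, mul_comm b]
        refine mul_le_mul_of_nonneg_left ?_ ht.le
        have h1 : pairing (Φ (z, s)) ζ = pairing (Φ (z, s)) ζ₀ + pairing (Φ (z, s)) (ζ - ζ₀) := by
          rw [pairing_sub_right]; ring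
        rw [h1, Complex.add_re]
        have h2 := (Complex.re_le_norm _).trans (norm_pairing_le (Φ (z, s)) (ζ - ζ₀))
        have h3 : ‖pairingL n‖ * ‖Φ (z, s)‖ * ‖ζ - ζ₀‖ ≤ ‖pairingL n‖ * |M| * ‖ζ - ζ₀‖ := by
          gcongr
          exact (hM _ hs).trans (le_abs_self _)
        have h4 : ‖pairingL n‖ * |M| * ‖ζ - ζ₀‖ < b - a := hζ
        linarith [hle _ hs]
      · rw [image_eq_zero_of_notMem_tsupport hs]
        simp only [zero_mul, norm_zero]
        exact indicator_nonneg (fun _ _ => by positivity) s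
    calc ‖oscInt μ A Φ (z, t • ζ)‖ ≤ ∫ s, k.indicator (fun _ => |M'| * Real.exp (b * t)) s ∂μ :=
          norm_integral_le_of_norm_le ((integrable_indicator_iff hk.measurableSet).2
            (integrableOn_const hk.measure_lt_top.ne)) (Eventually.of_forall hbd)
      _ = (|M'| * μ.real k) * Real.exp (b * t) := by
          rw [integral_indicator hk.measurableSet, setIntegral_const, smul_eq_mul]; ring
      _ ≤ _ := by gcongr; linarith
  | add f g _ _ hf hg =>
    obtain ⟨N, hN, C, hC, h⟩ := hf hab
    obtain ⟨N', hN', C', hC', h'⟩ := hg hab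
    refine ⟨N ∩ N', inter_mem hN hN', C + C', by positivity, fun p hp t ht => ?_⟩
    rw [add_mul]
    exact (norm_add_le _ _).trans (add_le_add (h p hp.1 t ht) (h' p hp.2 t ht))
  | const_mul c f _ hf =>
    obtain ⟨N, hN, C, hC, h⟩ := hf hab
    refine ⟨N, hN, (‖c‖ + 1) * C, by positivity, fun p hp t ht => ?_⟩
    rw [norm_mul, mul_assoc]
    refine mul_le_mul (by linarith) (h p hp t ht) (norm_nonneg _) (by positivity)
  | coord_mul j f _ hf =>
    -- The additional factor tζⱼ grows linearly in t and is absorbed by e^{(b - b')t}; this is where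
    -- b > a must be strict.
    obtain ⟨b', hb', hb''⟩ := exists_between hab
    obtain ⟨N, hN, C, hC, h⟩ := hf hb'
    refine ⟨N ∩ Prod.snd ⁻¹' Metric.ball ζ₀ 1, inter_mem hN
      (continuous_snd.continuousAt.preimage_mem_nhds (Metric.ball_mem_nhds _ one_pos)),
      (‖ζ₀‖ + 1) / (b - b') * C, by have : 0 < b - b' := by linarith
                                    positivity, fun p hp t ht => ?_⟩
    have hb : 0 < b - b' := by linarith
    have h1 : ‖p.2 j‖ ≤ ‖ζ₀‖ + 1 := by
      refine (PiLp.norm_apply_le p.2 j).trans ?_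
      have := hp.2
      rw [mem_preimage, mem_ball_iff_norm] at this
      have h2 := norm_sub_norm_le p.2 ζ₀
      linarith
    have h3 : t ≤ Real.exp ((b - b') * t) / (b - b') := by
      rw [le_div_iff₀ hb]
      have := Real.add_one_le_exp ((b - b') * t)
      linarith
    have h4 : Real.exp (b * t) = Real.exp ((b - b') * t) * Real.exp (b' * t) := by
      rw [← Real.exp_add]; ring_nf
    have h5 : ‖(t • p.2) j‖ = t * ‖p.2 j‖ := by
      simp [abs_of_pos ht]
    simp only [norm_mul, h5]
    calc t * ‖p.2 j‖ * ‖f (p.1, t • p.2)‖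
        ≤ (Real.exp ((b - b') * t) / (b - b')) * (‖ζ₀‖ + 1) * (C * Real.exp (b' * t)) := by
          gcongr
          exact h p hp.1 t ht
      _ = _ := by rw [h4]; ring

theorem dz (h : IsOsc ζ₀ a f) (i : Fin n) : IsOsc ζ₀ a (dz i f) := by
  have h1 := h.fderiv_fst (EuclideanSpace.single i 1)
  have h2 := h.fderiv_fst (Complex.I • EuclideanSpace.single i 1)
  convert! const_mul (1 / 2) _ (add _ _ h1 (const_mul (-Complex.I) _ h2)) using 2 with p
  simp [CDSymbol.dz, dDir, Prod.smul_mk]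
  ring

theorem dzbar (h : IsOsc ζ₀ a f) (i : Fin n) : IsOsc ζ₀ a (dzbar i f) := by
  have h1 := h.fderiv_fst (EuclideanSpace.single i 1)
  have h2 := h.fderiv_fst (Complex.I • EuclideanSpace.single i 1)
  convert! const_mul (1 / 2) _ (add _ _ h1 (const_mul (Complex.I) _ h2)) using 2 with p
  simp [CDSymbol.dzbar, dbarDir, Prod.smul_mk]

end IsOsc

/-! ### Local criteria for symbols and null-symbols -/

/-- Near `p₀.1`, and for all `ζ`, the function `f` is of the form `IsOsc p₀.2 a`. -/
def IsLocOsc (p₀ : Cn n × Cn n) (a : ℝ) (f : Cn n × Cn n → ℂ) : Prop :=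
  ∃ g, IsOsc p₀.2 a g ∧ ∀ᶠ z in 𝓝 p₀.1, ∀ ζ, f (z, ζ) = g (z, ζ)

namespace IsLocOsc

variable {p₀ : Cn n × Cn n} {a b : ℝ} {f g : Cn n × Cn n → ℂ}

theorem mono (hab : a ≤ b) (h : IsLocOsc p₀ a f) : IsLocOsc p₀ b f :=
  let ⟨g, hg, he⟩ := h
  ⟨g, hg.mono hab, he⟩

theorem add (hf : IsLocOsc p₀ a f) (hg : IsLocOsc p₀ a g) :
    IsLocOsc p₀ a (fun p => f p + g p) := by
  obtain ⟨f', hf', hf⟩ := hf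
  obtain ⟨g', hg', hg⟩ := hg
  exact ⟨_, .add _ _ hf' hg', by filter_upwards [hf, hg] with z h1 h2 ζ; rw [h1, h2]⟩

theorem congr (hf : IsLocOsc p₀ a f) (h : ∀ᶠ z in 𝓝 p₀.1, ∀ ζ, g (z, ζ) = f (z, ζ)) :
    IsLocOsc p₀ a g := by
  obtain ⟨f', hf', hf⟩ := hf
  exact ⟨f', hf', by filter_upwards [hf, h] with z h1 h2 ζ; rw [h2, h1]⟩

/-- The equality with a global model holds for z near p₀.1 and all ζ, that is, on an open set, so
any operator depending only on germs preserves it. -/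
theorem of_dirs {D : (Cn n × Cn n → ℂ) → Cn n × Cn n → ℂ}
    (hD : ∀ (f g : Cn n × Cn n → ℂ) p, f =ᶠ[𝓝 p] g → D f p = D g p)
    (hO : ∀ g, IsOsc p₀.2 a g → IsOsc p₀.2 a (D g)) (h : IsLocOsc p₀ a f) :
    IsLocOsc p₀ a (D f) := by
  obtain ⟨g, hg, he⟩ := h
  refine ⟨D g, hO g hg, ?_⟩
  filter_upwards [eventually_eventually_nhds.2 he] with z hz ζ
  refine hD _ _ _ ?_
  have : Tendsto Prod.fst (𝓝 (z, ζ)) (𝓝 z) := continuous_fst.tendsto (z, ζ)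
  filter_upwards [this.eventually hz] with q hq using hq q.2

theorem dz (h : IsLocOsc p₀ a f) (i : Fin n) : IsLocOsc p₀ a (dz i f) :=
  h.of_dirs (fun f g p e => by simp [CDSymbol.dz, dDir, e.fderiv_eq]) fun _ hg => hg.dz i

theorem dzbar (h : IsLocOsc p₀ a f) (i : Fin n) : IsLocOsc p₀ a (dzbar i f) :=
  h.of_dirs (fun f g p e => by simp [CDSymbol.dzbar, dbarDir, e.fderiv_eq]) fun _ hg => hg.dzbar i

theorem multiDeriv {D : Fin n → (Cn n × Cn n → ℂ) → Cn n × Cn n → ℂ}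
    (hD : ∀ i f, IsLocOsc p₀ a f → IsLocOsc p₀ a (D i f)) (α : Fin n → ℕ) (h : IsLocOsc p₀ a f) :
    IsLocOsc p₀ a (multiDeriv D α f) := by
  have key : ∀ l : List (Fin n), IsLocOsc p₀ a (l.foldr (fun i g => (D i)^[α i] g) f) := by
    intro l
    induction l with
    | nil => exact h
    | cons i l ih =>
      rw [List.foldr_cons]
      generalize α i = m
      induction m with
      | zero => exact ih
      | succ m ihm => rw [Function.iterate_succ_apply']; exact hD i _ ihm
  exact key _

theorem bound (h : IsLocOsc p₀ a f) (hab : a < b) :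
    ∃ N ∈ 𝓝 p₀, ∃ C : ℝ, 0 < C ∧ ∀ p ∈ N, ∀ t : ℝ, 0 < t →
      ‖f (p.1, t • p.2)‖ ≤ C * Real.exp (b * t) := by
  obtain ⟨g, hg, he⟩ := h
  obtain ⟨N, hN, C, hC, hb⟩ := hg.bound p₀.1 hab
  refine ⟨N ∩ {p | ∀ ζ, f (p.1, ζ) = g (p.1, ζ)}, inter_mem hN
    (continuous_fst.continuousAt.eventually he), C, hC, fun p hp t ht => ?_⟩
  rw [hp.2]
  exact hb p hp.1 t ht

end IsLocOsc

variable {V : Set (Cn n × Cn n)} {f : Cn n × Cn n → ℂ}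

/-- All the estimates below hold for every t > 0, so the cone itself serves as the wedge; the value
δ = 1 is arbitrary. -/
theorem IsCone.isInfWedge_self (hV : IsCone V) : IsInfWedge V V :=
  ⟨subset_rfl, fun _ hK => ⟨1, one_pos, fun q hq t ht =>
    hV.smul_mem q (hK.2 (subset_closure hq)) t (one_pos.trans ht)⟩⟩

theorem memCinfO_of_isLocOsc (hV : IsOpen V) (h : ∀ p ∈ V, ∃ a, IsLocOsc p a f) :
    MemCinfO V f := by
  refine ⟨hV, fun p hp => ?_, fun p hp => ?_⟩
  · obtain ⟨a, g, hg, he⟩ := h p hp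
    have : f =ᶠ[𝓝 p] g := by
      filter_upwards [continuous_fst.continuousAt.eventually he] with q hq using hq q.2
    exact (hg.contDiff.contDiffAt.congr_of_eventuallyEq this).contDiffWithinAt
  · obtain ⟨a, g, hg, he⟩ := h p hp
    have : (fun ζ => f (p.1, ζ)) = fun ζ => g (p.1, ζ) := funext he.self_of_nhds
    rw [this]
    exact hg.differentiableAt_snd p

/-- Bounds near each point of a compact set of directions give a bound on the cone it spans. -/
theorem exists_cone_bound {K : Set (Cn n × Cn n)} (hK : IsCompact K)
    {f : Cn n × Cn n → ℂ} {V' : Set (Cn n × Cn n)}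
    (hV' : ∀ p ∈ V', ∃ q ∈ K, ∃ t : ℝ, 0 < t ∧ p = (q.1, t • q.2))
    (P : ℝ → Prop) (hP : ∀ h₁ h₂, P h₁ → P h₂ → ∃ h, P h ∧ h₁ ≤ h ∧ h₂ ≤ h) (hP0 : ∃ h, P h)
    (hE : ∀ q ∈ K, ∃ N ∈ 𝓝 q, ∃ h, P h ∧ ∃ C : ℝ, 0 < C ∧ ∀ p ∈ N ∩ K, ∀ t : ℝ, 0 < t →
      ‖f (p.1, t • p.2)‖ ≤ C * Real.exp (h * ‖t • p.2‖)) :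
    ∃ h, P h ∧ ∃ C : ℝ, 0 < C ∧ ∀ p ∈ V', ‖f p‖ ≤ C * Real.exp (h * ‖p.2‖) := by
  have key : ∃ h, P h ∧ ∃ C : ℝ, 0 < C ∧ ∀ p ∈ K, ∀ t : ℝ, 0 < t →
      ‖f (p.1, t • p.2)‖ ≤ C * Real.exp (h * ‖t • p.2‖) := by
    -- Finitely many neighbourhoods cover K, and their exponents are merged by `hP`. The predicate P
    -- is h < 0 for null-symbols and h = ε for symbols.
    have := hK.induction_on (p := fun S => ∃ h, P h ∧ ∃ C : ℝ, 0 < C ∧ ∀ p ∈ S ∩ K, ∀ t : ℝ, 0 < t →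
      ‖f (p.1, t • p.2)‖ ≤ C * Real.exp (h * ‖t • p.2‖)) ?_ ?_ ?_ ?_
    · obtain ⟨h, hh, C, hC, hb⟩ := this
      exact ⟨h, hh, C, hC, fun p hp => hb p ⟨hp, hp⟩⟩
    · obtain ⟨h, hh⟩ := hP0
      exact ⟨h, hh, 1, one_pos, by simp⟩
    · rintro S T hST ⟨h, hh, C, hC, hb⟩
      exact ⟨h, hh, C, hC, fun p hp => hb p ⟨hST hp.1, hp.2⟩⟩
    · rintro S T ⟨h, hh, C, hC, hb⟩ ⟨h', hh', C', hC', hb'⟩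
      obtain ⟨h'', hp, h1, h2⟩ := hP h h' hh hh'
      refine ⟨h'', hp, max C C', by positivity, ?_⟩
      rintro p ⟨hp | hp, hpK⟩ t ht
      · refine (hb p ⟨hp, hpK⟩ t ht).trans ?_
        gcongr
        exact le_max_left _ _
      · refine (hb' p ⟨hp, hpK⟩ t ht).trans ?_
        gcongr
        exact le_max_right _ _
    · intro q hq
      obtain ⟨N, hN, h⟩ := hE q hq
      exact ⟨N, mem_nhdsWithin_of_mem_nhds hN, h⟩
  obtain ⟨h, hh, C, hC, hb⟩ := key
  refine ⟨h, hh, C, hC, fun p hp => ?_⟩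
  obtain ⟨q, hq, t, ht, rfl⟩ := hV' p hp
  exact hb q hq t ht

/-- The local bound is in terms of t, the required one in terms of |tζ|. For decay an upper bound of
|ζ| on the compact set of directions suffices to convert one into the other. -/
theorem isNullSymbol_of_isLocOsc (hV : IsOpen V) (hc : IsCone V)
    (h : ∀ p ∈ V, ∃ a < 0, IsLocOsc p a f) : IsNullSymbol V f := by
  refine ⟨V, hc.isInfWedge_self, memCinfO_of_isLocOsc hV fun p hp =>
    let ⟨a, _, h⟩ := h p hp; ⟨a, h⟩, ?_⟩
  rintro V' hV'o hV'c ⟨K, ⟨hKc, hKV⟩, rfl⟩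
  refine ⟨_, ?_, hV'c.isInfWedge_self, fun α β => ?_⟩
  · rintro p ⟨q, hq, t, ht, rfl⟩
    exact hc.smul_mem q (hKV (subset_closure hq)) t ht
  obtain ⟨M, hM⟩ := hKc.isBounded.exists_norm_le
  have := exists_cone_bound (f := multiDeriv dz α (multiDeriv dzbar β f))
    (V' := {p | ∃ q ∈ K, ∃ t : ℝ, 0 < t ∧ p = (q.1, t • q.2)}) hKc ?_ (fun h => h < 0) ?_ ?_ ?_
  · obtain ⟨h, hh, C, hC, hb⟩ := this
    exact ⟨-h, by linarith, C, hC, by simpa using hb⟩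
  · rintro p ⟨q, hq, t, ht, rfl⟩
    exact ⟨q, subset_closure hq, t, ht, rfl⟩
  · exact fun h₁ h₂ h1 h2 => ⟨max h₁ h₂, max_lt h1 h2, le_max_left _ _, le_max_right _ _⟩
  · exact ⟨-1, by norm_num⟩
  · intro q hq
    obtain ⟨a, ha, hosc⟩ := h q (hKV hq)
    have h1 := (hosc.multiDeriv (fun i _ h => h.dzbar i) β).multiDeriv (fun i _ h => h.dz i) α
    obtain ⟨N, hN, C, hC, hb⟩ := h1.bound (b := a / 2) (by linarith)
    refine ⟨N, hN, a / 2 / (|M| + 1), div_neg_of_neg_of_pos (by linarith) (by positivity), C, hC,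
      fun p hp t ht => (hb p hp.1 t ht).trans ?_⟩
    gcongr ?_ * Real.exp ?_
    have hM0 : 0 < |M| + 1 := by positivity
    rw [norm_smul, Real.norm_of_nonneg ht.le, div_mul_eq_mul_div (a / 2), le_div_iff₀ hM0]
    have h2 : ‖p.2‖ ≤ |M| + 1 := by
      have := (norm_snd_le p).trans (hM p hp.2)
      linarith [le_abs_self M]
    have : t * ‖p.2‖ ≤ t * (|M| + 1) := by gcongr
    nlinarith

/-- For growth the conversion from t to |tζ| runs the other way and needs a positive lower bound m
of |ζ|; a rate εm in t then becomes the rate ε in |tζ|. -/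
theorem isSymbol_of_isLocOsc (hV : IsOpen V) (hc : IsCone V)
    (h : ∀ p ∈ V, ∀ a > 0, IsLocOsc p a f) (h' : ∀ i, IsNullSymbol V (dzbar i f)) :
    IsSymbol V f := by
  refine ⟨⟨V, hc.isInfWedge_self, memCinfO_of_isLocOsc hV fun p hp => ⟨1, h p hp 1 one_pos⟩, ?_⟩,
    h'⟩
  rintro V' hV'o hV'c ⟨K, ⟨hKc, hKV⟩, rfl⟩
  refine ⟨_, ?_, hV'c.isInfWedge_self, fun α β ε hε => ?_⟩
  · rintro p ⟨q, hq, t, ht, rfl⟩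
    exact hc.smul_mem q (hKV (subset_closure hq)) t ht
  obtain ⟨m, hm, hmK⟩ : ∃ m : ℝ, 0 < m ∧ ∀ q ∈ closure K, m ≤ ‖q.2‖ := by
    rcases (closure K).eq_empty_or_nonempty with he | hne
    · exact ⟨1, one_pos, by simp [he]⟩
    · obtain ⟨q, hq, hmin⟩ := hKc.exists_isMinOn hne
        (f := fun q : Cn n × Cn n => ‖q.2‖) (by fun_prop)
      exact ⟨‖q.2‖, norm_pos_iff.2 (hc.ne_zero q (hKV hq)), fun q' hq' => hmin hq'⟩
  have := exists_cone_bound (f := multiDeriv dz α (multiDeriv dzbar β f))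
    (V' := {p | ∃ q ∈ K, ∃ t : ℝ, 0 < t ∧ p = (q.1, t • q.2)}) hKc ?_ (fun h => h = ε) ?_ ?_ ?_
  · obtain ⟨h, rfl, C, hC, hb⟩ := this
    exact ⟨C, hC, hb⟩
  · rintro p ⟨q, hq, t, ht, rfl⟩
    exact ⟨q, subset_closure hq, t, ht, rfl⟩
  · rintro _ _ rfl rfl
    exact ⟨_, rfl, le_rfl, le_rfl⟩
  · exact ⟨_, rfl⟩
  · intro q hq
    have hosc := h q (hKV hq) (ε * m / 2) (by positivity)
    have h1 := (hosc.multiDeriv (fun i _ h => h.dzbar i) β).multiDeriv (fun i _ h => h.dz i) α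
    obtain ⟨N, hN, C, hC, hb⟩ := h1.bound (b := ε * m) (by have := mul_pos hε hm; linarith)
    refine ⟨N, hN, ε, rfl, C, hC, fun p hp t ht => (hb p hp.1 t ht).trans ?_⟩
    gcongr ?_ * Real.exp ?_
    rw [norm_smul, Real.norm_of_nonneg ht.le, mul_assoc, mul_comm m]
    gcongr
    exact hmK p hp.2

end

section

/-! ### The area formula for pieces of hyperplanes -/

section Area

open Module

variable {E : Type*} [NormedAddCommGroup E] [InnerProductSpace ℝ E] [FiniteDimensional ℝ E]

theorem surjective_of_ne_zero {E : Type*} [NormedAddCommGroup E] [NormedSpace ℝ E] {ℓ : E →L[ℝ] ℝ} (hℓ : ℓ ≠ 0) :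
    Function.Surjective ℓ.toLinearMap :=
  LinearMap.surjective fun h => hℓ (by ext x; exact congrArg (fun m : E →ₗ[ℝ] ℝ => m x) h)

/-- A linear isomorphism multiplies the area in the hyperplane `ℓ = 0` by
`|det T| ‖ℓ ∘ T⁻¹‖ / ‖ℓ‖`. -/
theorem normDet_domRestrict_ker (ℓ : E →L[ℝ] ℝ) (hℓ : ℓ ≠ 0) (T : E ≃L[ℝ] E) :
    ((T : E →ₗ[ℝ] E).domRestrict (LinearMap.ker ℓ.toLinearMap)).normDet =
      |(T : E →L[ℝ] E).det| * ‖ℓ.comp (T.symm : E →L[ℝ] E)‖ / ‖ℓ‖ := by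
  set ℓ' : E →L[ℝ] ℝ := ℓ.comp (T.symm : E →L[ℝ] E) with hℓ'
  have hℓ'0 : ℓ' ≠ 0 := by
    intro h
    apply hℓ
    ext x
    have := congrArg (fun m : E →L[ℝ] ℝ => m (T x)) h
    simpa [hℓ'] using this
  set H := LinearMap.ker ℓ.toLinearMap with hH
  set D := InnerProductSpace.toDual ℝ E
  set ν : E := ‖ℓ‖⁻¹ • D.symm ℓ with hν
  set ν' : E := ‖ℓ'‖⁻¹ • D.symm ℓ' with hν'
  have p1 : 0 < ‖ℓ‖ := norm_pos_iff.2 hℓ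
  have p2 : 0 < ‖ℓ'‖ := norm_pos_iff.2 hℓ'0
  have e1 : ∀ x, ℓ x = ‖ℓ‖ * inner ℝ ν x := by
    intro x
    rw [hν, inner_smul_left, InnerProductSpace.toDual_symm_apply]
    simp [p1.ne']
  have e2 : ∀ x, ℓ' x = ‖ℓ'‖ * inner ℝ ν' x := by
    intro x
    rw [hν', inner_smul_left, InnerProductSpace.toDual_symm_apply]
    simp [p2.ne']
  have n1 : ‖ν'‖ = ‖ν‖ := by
    rw [hν, hν', norm_smul, norm_smul, LinearIsometryEquiv.norm_map, LinearIsometryEquiv.norm_map]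
    simp [p1.ne', p2.ne']
  -- The reflection takes the unit normal of T(H) to that of H. Thus R = O ∘ T maps H to itself
  -- without changing areas, and the restricted determinant can be obtained from det R = det(R|H) ·
  -- det(R on E/H).
  set O : E ≃ₗᵢ[ℝ] E := Submodule.reflection (ℝ ∙ (ν' - ν))ᗮ
  have hO : O ν' = ν := Submodule.reflection_sub n1
  set R : E →ₗ[ℝ] E := O.toLinearIsometry.toLinearMap ∘ₗ (T : E →ₗ[ℝ] E) with hR
  have hRℓ : ∀ x, ℓ (R x) = ‖ℓ‖ / ‖ℓ'‖ * ℓ x := by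
    intro x
    have h1 : R x = O (T x) := rfl
    have h2 : ℓ x = ℓ' (T x) := by simp [hℓ']
    rw [h1, e1, h2, e2, ← hO, LinearIsometryEquiv.inner_map_map]
    field_simp
  have hRH : H ≤ H.comap R := by
    intro x hx
    have : ℓ x = 0 := hx
    change ℓ (R x) = 0
    rw [hRℓ, this, mul_zero]
  have d1 : (R.domRestrict H).normDet = ((T : E →ₗ[ℝ] E).domRestrict H).normDet := by
    have : R.domRestrict H = O.toLinearIsometry.toLinearMap ∘ₗ (T : E →ₗ[ℝ] E).domRestrict H := rfl
    rw [this, LinearMap.normDet_comp]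
    have h3 : (O.toLinearIsometry.toLinearMap.domRestrict
        ((T : E →ₗ[ℝ] E).domRestrict H).range).normDet = 1 :=
      (O.toLinearIsometry.comp ((T : E →ₗ[ℝ] E).domRestrict H).range.subtypeₗᵢ).normDet_eq_one
    rw [h3, one_mul]
  have d2 : (R.domRestrict H).normDet = |(R.restrict hRH).det| := by
    rw [← LinearMap.normDet_eq_abs_det]
    exact (LinearMap.normDet_codRestrict (f := R.domRestrict H) (p := H) fun c => hRH c.2).symm
  have d3 : |R.det| = |(T : E →L[ℝ] E).det| := by
    rw [hR, LinearMap.det_comp, abs_mul, ← LinearMap.normDet_eq_abs_det,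
      LinearIsometry.normDet_eq_one, one_mul]
    rfl
  -- R multiplies ℓ by ‖ℓ‖/‖ℓ'‖, so it acts by this scalar on the one-dimensional quotient E/H.
  have d4 : H.mapQ H R hRH = (‖ℓ‖ / ‖ℓ'‖) • LinearMap.id := by
    apply Submodule.linearMap_qext
    ext x
    change H.mkQ (R x) = _
    simp only [LinearMap.comp_apply, LinearMap.smul_apply, LinearMap.id_apply, ← map_smul]
    rw [← sub_eq_zero, ← map_sub, ← LinearMap.mem_ker, Submodule.ker_mkQ]
    change ℓ (R x - (‖ℓ‖ / ‖ℓ'‖) • x) = 0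
    rw [map_sub, hRℓ, map_smul, smul_eq_mul, sub_self]
  have d5 : finrank ℝ (E ⧸ H) = 1 := by
    have := (ℓ.toLinearMap.quotKerEquivOfSurjective (surjective_of_ne_zero hℓ)).finrank_eq
    simpa using this
  have d6 := LinearMap.det_eq_det_mul_det H R hRH
  rw [d4, LinearMap.det_smul, d5] at d6
  simp only [pow_one, LinearMap.det_id, mul_one] at d6
  rw [← d1, d2, ← d3, d6, abs_mul, abs_of_pos (div_pos p1 p2)]
  field_simp

theorem finrank_ker_of_ne_zero {d : ℕ} (hd : finrank ℝ E = d + 1) {ℓ : E →L[ℝ] ℝ} (hℓ : ℓ ≠ 0) :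
    finrank ℝ (LinearMap.ker ℓ.toLinearMap) = d := by
  have hs : Function.Surjective ℓ.toLinearMap := surjective_of_ne_zero hℓ
  have := ℓ.toLinearMap.finrank_range_add_finrank_ker
  rw [LinearMap.range_eq_top.2 hs] at this
  simp at this
  omega

variable [MeasurableSpace E] [BorelSpace E]

theorem euclideanHausdorffMeasure_image_of_subset_ker {d : ℕ} (hd : finrank ℝ E = d + 1)
    {ℓ : E →L[ℝ] ℝ} (hℓ : ℓ ≠ 0) (T : E ≃L[ℝ] E) {A : Set E} (hA : ∀ x ∈ A, ℓ x = 0) :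
    μHE[d] (T '' A) = ENNReal.ofReal (|(T : E →L[ℝ] E).det| * ‖ℓ.comp (T.symm : E →L[ℝ] E)‖ / ‖ℓ‖) *
      μHE[d] A := by
  set H := LinearMap.ker ℓ.toLinearMap
  have hdH : finrank ℝ H = d := finrank_ker_of_ne_zero hd hℓ
  set s : Set H := Subtype.val ⁻¹' A
  have hsA : Subtype.val '' s = A := by
    refine (Subtype.image_preimage_coe _ _).trans ?_
    exact inter_eq_right.2 fun x hx => hA x hx
  have h1 := ((T : E →ₗ[ℝ] E).domRestrict H).euclideanHausdorffMeasure_image s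
  rw [hdH, normDet_domRestrict_ker ℓ hℓ T] at h1
  have h2 : ((T : E →ₗ[ℝ] E).domRestrict H) '' s = T '' A := by
    rw [← hsA, image_image]; rfl
  have h3 : (μHE[d] : Measure H) s = μHE[d] A := by
    rw [← hsA]
    exact (isometry_subtype_coe.euclideanHausdorffMeasure_image s).symm
  rw [← h2, h1, h3]

theorem euclideanHausdorffMeasure_image_le_of_lipschitzOnWith {X Y : Type*} [EMetricSpace X]
    [MeasurableSpace X] [BorelSpace X] [EMetricSpace Y] [MeasurableSpace Y] [BorelSpace Y]
    {K : NNReal} {f : X → Y} {s : Set X} (h : LipschitzOnWith K f s) (d : ℕ) :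
    μHE[d] (f '' s) ≤ (K : ENNReal) ^ d * μHE[d] s := by
  simp_rw [Measure.euclideanHausdorffMeasure_def, Measure.smul_apply, Measure.nnreal_smul_coe_apply]
  rw [mul_left_comm]
  gcongr
  simpa using h.hausdorffMeasure_image_le (d := d) (by simp)

/-- An inequality between measures that holds locally on a set holds on it. -/
theorem measure_le_of_locally_le {X : Type*} [TopologicalSpace X] [SecondCountableTopology X]
    [MeasurableSpace X] [OpensMeasurableSpace X] {ν₁ ν₂ : Measure X} {S : Set X}
    (h : ∀ x ∈ S, ∃ N ∈ 𝓝 x, ∀ B, MeasurableSet B → B ⊆ N ∩ S → ν₁ B ≤ ν₂ B) {A : Set X}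
    (hA : MeasurableSet A) (hAS : A ⊆ S) : ν₁ A ≤ ν₂ A := by
  choose! N hN hle using h
  obtain ⟨t, hts, htc, htU⟩ := TopologicalSpace.countable_cover_nhdsWithin
    (f := fun x => interior (N x)) (s := S)
    fun x hx => mem_nhdsWithin_of_mem_nhds (interior_mem_nhds.2 (hN x hx))
  rcases t.eq_empty_or_nonempty with rfl | hne
  · have : A = ∅ := by
      have := hAS.trans htU
      simpa using this
    simp [this]
  obtain ⟨u, rfl⟩ := htc.exists_eq_range hne
  have huS : ∀ i, u i ∈ S := fun i => hts ⟨i, rfl⟩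
  -- Second countability reduces the cover to a countable one; disjoint measurable pieces, each
  -- inside one neighbourhood, let the inequalities be summed.
  set B : ℕ → Set X := fun i => A ∩ disjointed (fun i => interior (N (u i))) i
  have hBm : ∀ i, MeasurableSet (B i) := fun i =>
    hA.inter (MeasurableSet.disjointed (fun _ => isOpen_interior.measurableSet) i)
  have hBU : A = ⋃ i, B i := by
    rw [← inter_iUnion, iUnion_disjointed]
    refine (inter_eq_left.2 fun x hx => ?_).symm
    have := htU (hAS hx)
    simpa using this
  have hBd : Pairwise (Function.onFun Disjoint B) := fun i j hij =>
    (disjoint_disjointed _ hij).mono inter_subset_right inter_subset_right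
  rw [hBU, measure_iUnion hBd hBm, measure_iUnion hBd hBm]
  exact ENNReal.tsum_le_tsum fun i => hle (u i) (huS i) _ (hBm i) fun x hx =>
    ⟨interior_subset (disjointed_subset (fun i => interior (N (u i))) i hx.2), hAS hx.1⟩

variable {f g : E → E} {S : Set E} {f' : E → E ≃L[ℝ] E}

/-- Strict differentiability makes f - T Lipschitz with arbitrarily small constant near x. Measured
against ‖T⁻¹‖ this shows that f ∘ T⁻¹ and its inverse are nearly isometric. -/
theorem exists_nhds_lipschitz {E : Type*} [NormedAddCommGroup E] [NormedSpace ℝ E] {f : E → E}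
    {T : E ≃L[ℝ] E} {x : E} (hf : HasStrictFDerivAt f (T : E →L[ℝ] E) x)
    {L : NNReal} (hL : 1 < L) :
    ∃ N ∈ 𝓝 x, LipschitzOnWith L (f ∘ T.symm) (T '' N) ∧
      ∀ a ∈ N, ∀ b ∈ N, ‖T a - T b‖ ≤ L * ‖f a - f b‖ := by
  set M := ‖(T.symm : E →L[ℝ] E)‖
  -- The first inequality on c gives the Lipschitz bound for f ∘ T⁻¹, the second the bound in the
  -- opposite direction.
  obtain ⟨c, hc0, hc1, hc2⟩ : ∃ c : ℝ, 0 < c ∧ c * M ≤ L - 1 ∧ L * (c * M) ≤ L - 1 := by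
    have hL0 : (0 : ℝ) < L := by have : (1 : ℝ) < L := hL; linarith
    have hL1 : (1 : ℝ) < L := hL
    refine ⟨(L - 1) / (L * (M + 1)), by have : 0 ≤ M := norm_nonneg _
                                        apply div_pos <;> [linarith; positivity], ?_, ?_⟩
    · have hM : 0 ≤ M := norm_nonneg _
      rw [div_mul_eq_mul_div, div_le_iff₀ (by positivity)]
      have : M ≤ L * (M + 1) := by nlinarith
      nlinarith
    · have hM : 0 ≤ M := norm_nonneg _
      rw [div_mul_eq_mul_div, mul_div_assoc', div_le_iff₀ (by positivity)]
      have h1 : 0 ≤ (L - 1 : ℝ) := by linarith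
      have : L * ((L - 1) * M) ≤ L * ((L - 1) * (M + 1)) := by gcongr; linarith
      nlinarith
  obtain ⟨N, hN, happ⟩ := hf.approximates_deriv_on_nhds (c := ⟨c, hc0.le⟩) (Or.inr hc0)
  have hTs : ∀ v, ‖v‖ ≤ M * ‖T v‖ := fun v => by
    simpa using (T.symm : E →L[ℝ] E).le_opNorm (T v)
  have key : ∀ a ∈ N, ∀ b ∈ N, ‖f a - f b - T (a - b)‖ ≤ c * M * ‖T a - T b‖ := by
    intro a ha b hb
    refine (happ a ha b hb).trans ?_
    have h := hTs (a - b)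
    rw [map_sub] at h
    calc c * ‖a - b‖ ≤ c * (M * ‖T a - T b‖) := by gcongr
      _ = _ := by ring
  refine ⟨N, hN, ?_, fun a ha b hb => ?_⟩
  · apply LipschitzOnWith.of_dist_le_mul
    rintro _ ⟨a, ha, rfl⟩ _ ⟨b, hb, rfl⟩
    simp only [Function.comp_apply, ContinuousLinearEquiv.symm_apply_apply, dist_eq_norm]
    have h1 := key a ha b hb
    have h2 : ‖f a - f b‖ ≤ ‖f a - f b - T (a - b)‖ + ‖T (a - b)‖ := by
      simpa using norm_add_le (f a - f b - T (a - b)) (T (a - b))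
    rw [map_sub] at h1 h2
    nlinarith [norm_nonneg (T a - T b)]
  · have h1 := key a ha b hb
    have h2 : ‖T (a - b)‖ ≤ ‖f a - f b‖ + ‖f a - f b - T (a - b)‖ := by
      have := norm_sub_le (f a - f b) (f a - f b - T (a - b))
      simpa using this
    rw [map_sub] at h1 h2
    have h3 := norm_nonneg (T a - T b)
    have hL0 : (0 : ℝ) ≤ L := L.2
    have : L * ‖T a - T b‖ ≤ L * ‖f a - f b‖ + L * (c * M) * ‖T a - T b‖ := by nlinarith
    nlinarith

/-- The area formula for a diffeomorphism restricted to a piece of a hyperplane. -/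
theorem map_restrict_image_eq_withDensity {d : ℕ} (hd : finrank ℝ E = d + 1) {ℓ : E →L[ℝ] ℝ}
    (hℓ : ℓ ≠ 0) (hS : MeasurableSet S) (hSℓ : ∀ x ∈ S, ℓ x = 0) (hg : Measurable g)
    (hgf : ∀ x ∈ S, g (f x) = x) (hf : ∀ x ∈ S, HasStrictFDerivAt f (f' x : E →L[ℝ] E) x)
    {J : E → ℝ} (hJ : ∀ x ∈ S, J x = |(f' x : E →L[ℝ] E).det| *
      ‖ℓ.comp ((f' x).symm : E →L[ℝ] E)‖ / ‖ℓ‖) (hJc : ContinuousOn J S) :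
    ((μHE[d] : Measure E).restrict (f '' S)).map g =
      ((μHE[d] : Measure E).restrict S).withDensity fun x => ENNReal.ofReal (J x) := by
  have hfc : ContinuousOn f S := fun x hx => (hf x hx).continuousAt.continuousWithinAt
  have hinj : InjOn f S := fun x hx y hy h => by rw [← hgf x hx, ← hgf y hy, h]
  have him : ∀ B, MeasurableSet B → B ⊆ S → MeasurableSet (f '' B) := fun B hB hBS =>
    hB.image_of_continuousOn_injOn (hfc.mono hBS) (hinj.mono hBS)
  set ν₁ := ((μHE[d] : Measure E).restrict (f '' S)).map g with hν₁
  set ν₂ := ((μHE[d] : Measure E).restrict S).withDensity fun x => ENNReal.ofReal (J x) with hν₂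
  have e₁ : ∀ B, MeasurableSet B → B ⊆ S → ν₁ B = μHE[d] (f '' B) := by
    intro B hB hBS
    rw [hν₁, Measure.map_apply hg hB, Measure.restrict_apply (hg hB)]
    congr 1
    ext y
    constructor
    · rintro ⟨hy, x, hx, rfl⟩
      rw [mem_preimage, hgf x hx] at hy
      exact ⟨x, hy, rfl⟩
    · rintro ⟨x, hx, rfl⟩
      exact ⟨by rw [mem_preimage, hgf x (hBS hx)]; exact hx, x, hBS hx, rfl⟩
  have e₂ : ∀ B, MeasurableSet B → B ⊆ S →
      ν₂ B = ∫⁻ x in B, ENNReal.ofReal (J x) ∂μHE[d] := by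
    intro B hB hBS
    rw [hν₂, withDensity_apply _ hB, Measure.restrict_restrict hB, inter_eq_left.2 hBS]
  have hJpos : ∀ x ∈ S, 0 < J x := by
    intro x hx
    rw [hJ x hx]
    have h1 : 0 < ‖ℓ.comp ((f' x).symm : E →L[ℝ] E)‖ := by
      rw [norm_pos_iff]
      intro h
      apply hℓ
      ext y
      have := congrArg (fun m : E →L[ℝ] ℝ => m (f' x y)) h
      simpa using this
    have h2 : (f' x : E →L[ℝ] E).det ≠ 0 := (f' x).toLinearEquiv.isUnit_det'.ne_zero
    have h3 : 0 < ‖ℓ‖ := norm_pos_iff.2 hℓ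
    have := abs_pos.2 h2
    positivity
  -- On a small piece f is compared with its derivative at x: the Lipschitz constant costs L^d in
  -- d-dimensional measure, and freezing J at x costs one more factor L.
  have hloc : ∀ L : NNReal, 1 < L → ∀ x ∈ S, ∃ N ∈ 𝓝 x, ∀ B, MeasurableSet B → B ⊆ N ∩ S →
      ν₁ B ≤ (L : ENNReal) ^ (d + 1) * ν₂ B ∧ ν₂ B ≤ (L : ENNReal) ^ (d + 1) * ν₁ B := by
    intro L hL x hx
    obtain ⟨N, hN, hl1, hl2⟩ := exists_nhds_lipschitz (hf x hx) hL
    have hL0 : (0 : ℝ) < L := zero_lt_one.trans hL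
    have hc1 : ∀ᶠ y in 𝓝[S] x, J y < L * J x :=
      (hJc x hx).eventually_lt_const (by nlinarith [hJpos x hx, show (1 : ℝ) < L from hL])
    have hc2 : ∀ᶠ y in 𝓝[S] x, J x / L < J y :=
      (hJc x hx).eventually_const_lt (by
        rw [div_lt_iff₀ hL0]; nlinarith [hJpos x hx, show (1 : ℝ) < L from hL])
    obtain ⟨N', hN', hN'S⟩ := mem_nhdsWithin_iff_exists_mem_nhds_inter.1 (hc1.and hc2)
    refine ⟨N ∩ N', inter_mem hN hN', fun B hB hBN => ?_⟩
    have hBS : B ⊆ S := fun y hy => (hBN hy).2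
    rw [e₁ B hB hBS, e₂ B hB hBS]
    have hlin := euclideanHausdorffMeasure_image_of_subset_ker hd hℓ (f' x) (A := B)
      fun y hy => hSℓ y (hBS hy)
    rw [← hJ x hx] at hlin
    have h1 : μHE[d] (f '' B) ≤ (L : ENNReal) ^ d * μHE[d] (f' x '' B) := by
      have := euclideanHausdorffMeasure_image_le_of_lipschitzOnWith
        (hl1.mono (image_mono fun y hy => (hBN hy).1.1 : f' x '' B ⊆ _)) d
      rw [image_image] at this
      simpa using this
    have h2 : μHE[d] (f' x '' B) ≤ (L : ENNReal) ^ d * μHE[d] (f '' B) := by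
      have : LipschitzOnWith L (f' x ∘ g) (f '' B) := by
        apply LipschitzOnWith.of_dist_le_mul
        rintro _ ⟨a, ha, rfl⟩ _ ⟨b, hb, rfl⟩
        simp only [Function.comp_apply, hgf a (hBS ha), hgf b (hBS hb), dist_eq_norm]
        exact hl2 a (hBN ha).1.1 b (hBN hb).1.1
      have := euclideanHausdorffMeasure_image_le_of_lipschitzOnWith this d
      rw [image_image] at this
      convert! this using 2
      exact image_congr fun a ha => by simp [hgf a (hBS ha)]
    have h3 : ENNReal.ofReal (J x) * μHE[d] B ≤
        L * ∫⁻ y in B, ENNReal.ofReal (J y) ∂μHE[d] := by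
      rw [← lintegral_const_mul' _ _ (by simp), ← setLIntegral_const]
      refine setLIntegral_mono' hB fun y hy => ?_
      have h4 : J x / L < J y := (hN'S ⟨(hBN hy).1.2, hBS hy⟩).2
      rw [div_lt_iff₀ hL0] at h4
      rw [← ENNReal.ofReal_coe_nnreal, ← ENNReal.ofReal_mul hL0.le]
      exact ENNReal.ofReal_le_ofReal (by linarith)
    have h4 : ∫⁻ y in B, ENNReal.ofReal (J y) ∂μHE[d] ≤
        L * (ENNReal.ofReal (J x) * μHE[d] B) := by
      rw [← mul_assoc, ← setLIntegral_const]
      refine setLIntegral_mono' hB fun y hy => ?_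
      have h4 : J y < L * J x := (hN'S ⟨(hBN hy).1.2, hBS hy⟩).1
      rw [← ENNReal.ofReal_coe_nnreal, ← ENNReal.ofReal_mul hL0.le]
      exact ENNReal.ofReal_le_ofReal (by linarith)
    constructor
    · refine h1.trans ?_
      rw [hlin, pow_succ, mul_assoc]
      gcongr
    · refine h4.trans ?_
      rw [← hlin, pow_succ, mul_comm _ (L : ENNReal), mul_assoc]
      gcongr
  -- The local comparison is exact only in the limit L ↓ 1, taken after it has been globalised.
  have hlim : ∀ a b : ENNReal, (∀ L : NNReal, 1 < L → a ≤ (L : ENNReal) ^ (d + 1) * b) →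
      a ≤ b := by
    intro a b h
    rcases eq_or_ne b ⊤ with rfl | hb
    · exact le_top
    have ht : Tendsto (fun L : NNReal => (L : ENNReal) ^ (d + 1) * b) (𝓝[>] 1) (𝓝 b) := by
      have h1 : Tendsto (fun L : NNReal => (L : ENNReal) ^ (d + 1)) (𝓝 1) (𝓝 1) := by
        have : Continuous fun L : NNReal => ((L ^ (d + 1) : NNReal) : ENNReal) := by fun_prop
        have := this.tendsto 1
        simpa using this
      have := ENNReal.Tendsto.mul_const (h1.mono_left nhdsWithin_le_nhds) (Or.inr hb)
        (a := 1) (b := b) (f := 𝓝[>] (1 : NNReal))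
      simpa using this
    exact ge_of_tendsto ht (eventually_nhdsWithin_of_forall fun L hL => h L hL)
  have hmain : ∀ B, MeasurableSet B → B ⊆ S → ν₁ B = ν₂ B := by
    intro B hB hBS
    apply le_antisymm
    · refine hlim _ _ fun L hL => ?_
      have := measure_le_of_locally_le (ν₁ := ν₁) (ν₂ := (L : ENNReal) ^ (d + 1) • ν₂) (S := S)
        (fun x hx => let ⟨N, hN, h⟩ := hloc L hL x hx; ⟨N, hN, fun B hB hBN => (h B hB hBN).1⟩)
        hB hBS
      simpa using this
    · refine hlim _ _ fun L hL => ?_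
      have := measure_le_of_locally_le (ν₁ := ν₂) (ν₂ := (L : ENNReal) ^ (d + 1) • ν₁) (S := S)
        (fun x hx => let ⟨N, hN, h⟩ := hloc L hL x hx; ⟨N, hN, fun B hB hBN => (h B hB hBN).2⟩)
        hB hBS
      simpa using this
  have hc₁ : ν₁ Sᶜ = 0 := by
    rw [hν₁, Measure.map_apply hg hS.compl, Measure.restrict_apply (hg hS.compl)]
    convert! measure_empty (μ := (μHE[d] : Measure E))
    ext y
    simp only [mem_inter_iff, mem_preimage, mem_compl_iff, mem_image, mem_empty_iff_false,
      iff_false, not_and, not_exists]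
    rintro hy x hx rfl
    rw [hgf x hx] at hy
    exact hy hx
  have hc₂ : ν₂ Sᶜ = 0 := by
    rw [hν₂, withDensity_apply _ hS.compl, Measure.restrict_restrict hS.compl]
    simp
  ext B hB
  rw [← measure_inter_add_sdiff B hS, ← measure_inter_add_sdiff B hS,
    measure_mono_null (sdiff_subset_compl _ _) hc₁, measure_mono_null (sdiff_subset_compl _ _) hc₂,
    hmain _ (hB.inter hS) inter_subset_right]

end Area

end

section

/-! ### Cut-off functions and extension by zero -/

section Cutoff

variable {E : Type*} [NormedAddCommGroup E] [NormedSpace ℝ E]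

/-- A function that is smooth on an open set and vanishes off a closed subset of it is smooth. -/
theorem contDiff_of_eq_zero_off {F : Type*} [NormedAddCommGroup F] [NormedSpace ℝ F] {f : E → F}
    {K T : Set E} (hT : IsOpen T) (hK : IsClosed K) (hKT : K ⊆ T) (hf : ContDiffOn ℝ ∞ f T)
    (h0 : ∀ x ∉ K, f x = 0) : ContDiff ℝ ∞ f := by
  rw [contDiff_iff_contDiffAt]
  intro x
  by_cases hx : x ∈ K
  · exact hf.contDiffAt (hT.mem_nhds (hKT hx))
  · refine (contDiffAt_const (c := (0 : F))).congr_of_eventuallyEq ?_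
    filter_upwards [hK.isOpen_compl.mem_nhds hx] with y hy using h0 y hy

theorem tsupport_subset_of_eq_zero_off {E : Type*} [TopologicalSpace E] {F : Type*} [Zero F]
    {f : E → F} {K : Set E} (hK : IsClosed K) (h0 : ∀ x ∉ K, f x = 0) : tsupport f ⊆ K :=
  closure_minimal (fun x hx => by_contra fun h => hx (h0 x h)) hK

open scoped Manifold in
-- The cut-off is 1 on a neighbourhood of K, not merely on K, so that multiplying by it does not
-- change derivatives on K.
theorem exists_contDiff_cutoff [FiniteDimensional ℝ E] {K T : Set E} (hK : IsCompact K)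
    (hT : IsOpen T) (hKT : K ⊆ T) :
    ∃ η : E → ℝ, ContDiff ℝ ∞ η ∧ HasCompactSupport η ∧ tsupport η ⊆ T ∧
      ∀ᶠ x in 𝓝ˢ K, η x = 1 := by
  have := FiniteDimensional.proper ℝ E
  obtain ⟨K', hK', hKK', hK'T⟩ := exists_compact_between hK hT hKT
  obtain ⟨f, h1, h0, -⟩ := exists_contMDiffMap_one_nhds_of_subset_interior (n := ⊤) 𝓘(ℝ, E)
    hK.isClosed hKK'
  have hs := tsupport_subset_of_eq_zero_off hK'.isClosed h0
  exact ⟨f, f.contMDiff.contDiff, HasCompactSupport.of_support_subset_isCompact hK'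
    ((subset_tsupport _).trans hs), hs.trans hK'T, h1⟩

theorem contDiff_det [FiniteDimensional ℝ E] :
    ContDiff ℝ ∞ (fun L : E →L[ℝ] E => L.det) := by
  let b := Module.finBasis ℝ E
  have h : (fun L : E →L[ℝ] E => L.det) = fun L =>
      ∑ σ : Equiv.Perm (Fin (Module.finrank ℝ E)), ((Equiv.Perm.sign σ : ℤ) : ℝ) *
        ∏ i, b.repr (L (b i)) (σ i) := by
    funext L
    rw [ContinuousLinearMap.det, ← LinearMap.det_toMatrix b, Matrix.det_apply]
    simp [LinearMap.toMatrix_apply, Units.smul_def, zsmul_eq_mul]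
  rw [h]
  refine ContDiff.sum fun σ _ => contDiff_const.mul (contDiff_prod fun i _ => ?_)
  let m : (E →L[ℝ] E) →ₗ[ℝ] ℝ :=
    { toFun := fun L => b.repr (L (b i)) (σ i)
      map_add' := by simp
      map_smul' := by simp }
  exact (LinearMap.toContinuousLinearMap m).contDiff

end Cutoff

/-! ### Fibrewise straightening -/

variable {n : ℕ}

/-- The partial derivative in the second variable. -/
def derivSnd (ψ : Cn n × Cn n → Cn n) (q : Cn n × Cn n) : Cn n →L[ℝ] Cn n :=
  (fderiv ℝ ψ q).comp (ContinuousLinearMap.inr ℝ (Cn n) (Cn n))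

/-- A diffeomorphism between open subsets of `X × X` that preserves the fibres of the first
projection, with positive Jacobian in the fibres. -/
structure Straightening (n : ℕ) where
  toFun : Cn n × Cn n → Cn n
  invFun : Cn n × Cn n → Cn n
  source : Set (Cn n × Cn n)
  target : Set (Cn n × Cn n)
  isOpen_source : IsOpen source
  isOpen_target : IsOpen target
  contDiff_toFun : ContDiff ℝ ∞ toFun
  contDiffOn_invFun : ContDiffOn ℝ ∞ invFun target
  map_source : ∀ q ∈ source, (q.1, toFun q) ∈ target
  left_inv : ∀ q ∈ source, invFun (q.1, toFun q) = q.2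
  map_target : ∀ q ∈ target, (q.1, invFun q) ∈ source
  right_inv : ∀ q ∈ target, toFun (q.1, invFun q) = q.2
  det_pos : ∀ q ∈ source, 0 < (derivSnd toFun q).det

/-- Inverse function theorem for (z, w) ↦ (z, ψ(z, w)): its derivative is block triangular with an
identity block, hence invertible exactly when the fibre derivative of ψ is. -/
theorem exists_straightening {p₀ : Cn n × Cn n} {W : Set (Cn n × Cn n)} (hW : IsOpen W)
    (hp : p₀ ∈ W) {ψ : Cn n × Cn n → Cn n} (hψ : ContDiff ℝ ∞ ψ)
    (hd : derivSnd ψ p₀ = ContinuousLinearMap.id ℝ (Cn n)) :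
    ∃ S : Straightening n, S.toFun = ψ ∧ p₀ ∈ S.source ∧ S.source ⊆ W := by
  set Ψ : Cn n × Cn n → Cn n × Cn n := fun q => (q.1, ψ q) with hΨ
  have hΨs : ContDiff ℝ ∞ Ψ := contDiff_fst.prodMk hψ
  have hder : ∀ q, ∀ h : (derivSnd ψ q).det ≠ 0, HasFDerivAt Ψ
      ((ContinuousLinearEquiv.refl ℝ (Cn n)).skewProd
        ((derivSnd ψ q).toContinuousLinearEquivOfDetNeZero h)
        ((fderiv ℝ ψ q).comp (ContinuousLinearMap.inl ℝ (Cn n) (Cn n))) :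
        (Cn n × Cn n) →L[ℝ] Cn n × Cn n) q := by
    intro q h
    have h1 : HasFDerivAt Ψ ((ContinuousLinearMap.fst ℝ (Cn n) (Cn n)).prod (fderiv ℝ ψ q)) q :=
      hasFDerivAt_fst.prodMk (hψ.differentiable (by simp) q).hasFDerivAt
    refine h1.congr_fderiv ?_
    refine ContinuousLinearMap.ext fun v => ?_
    have : v = (v.1, 0) + (0, v.2) := by simp
    have h2 : fderiv ℝ ψ q v = fderiv ℝ ψ q (v.1, 0) + fderiv ℝ ψ q (0, v.2) := by
      rw [← map_add, ← this]
    simp [derivSnd, h2, add_comm]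
  have hcont : Continuous fun q => (derivSnd ψ q).det :=
    contDiff_det.continuous.comp ((hψ.continuous_fderiv (by simp)).clm_comp continuous_const)
  have h1 : (derivSnd ψ p₀).det = 1 := by
    rw [hd]; exact LinearMap.det_id
  have hstrict := hΨs.contDiffAt.hasStrictFDerivAt' (hder p₀ (by rw [h1]; exact one_ne_zero))
    (by simp)
  set e := hstrict.toOpenPartialHomeomorph Ψ with he
  have hcoe : ∀ q, e q = Ψ q := fun q => by
    rw [he, hstrict.toOpenPartialHomeomorph_coe]
  -- The source is shrunk to where the fibre Jacobian is positive; this makes the local inverse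
  -- smooth at every target point and removes absolute values from changes of variables.
  set O := (e.source ∩ W) ∩ {q | 0 < (derivSnd ψ q).det} with hO
  have hOo : IsOpen O := (e.open_source.inter hW).inter (isOpen_lt continuous_const hcont)
  have hOs : O ⊆ e.source := fun q hq => hq.1.1
  refine ⟨{ toFun := ψ, invFun := fun q => (e.symm q).2, source := O, target := e '' O,
            isOpen_source := hOo
            isOpen_target := e.isOpen_image_of_subset_source hOo hOs
            contDiff_toFun := hψ
            contDiffOn_invFun := ?_, map_source := ?_, left_inv := ?_, map_target := ?_,
            right_inv := ?_, det_pos := fun q hq => hq.2 }, rfl, ?_, fun q hq => hq.1.2⟩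
  · rintro _ ⟨q, hq, rfl⟩
    apply ContDiffAt.contDiffWithinAt
    refine contDiff_snd.contDiffAt.comp _ ?_
    refine e.contDiffAt_symm (f₀' := (ContinuousLinearEquiv.refl ℝ (Cn n)).skewProd
        ((derivSnd ψ q).toContinuousLinearEquivOfDetNeZero (ne_of_gt hq.2))
        ((fderiv ℝ ψ q).comp (ContinuousLinearMap.inl ℝ (Cn n) (Cn n))))
        (e.map_source (hOs hq)) ?_ ?_
    · rw [e.left_inv (hOs hq)]
      have := hder q (ne_of_gt hq.2)
      exact this.congr_of_eventuallyEq (Eventually.of_forall hcoe)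
    · rw [e.left_inv (hOs hq)]
      exact hΨs.contDiffAt.congr_of_eventuallyEq (Eventually.of_forall hcoe)
  · intro q hq
    exact ⟨q, hq, hcoe q⟩
  · intro q hq
    have := e.left_inv (hOs hq)
    rw [hcoe] at this
    exact congrArg Prod.snd this
  · rintro _ ⟨q, hq, rfl⟩
    simp only [e.left_inv (hOs hq)]
    rw [hcoe]
    exact hq
  · rintro _ ⟨q, hq, rfl⟩
    simp only [e.left_inv (hOs hq)]
    rw [hcoe]
  · refine ⟨⟨hstrict.mem_toOpenPartialHomeomorph_source, hp⟩, ?_⟩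
    rw [mem_ofPred_eq, h1]; exact one_pos

/-- Linearly independent functionals have a dual family of vectors. -/
theorem exists_dual_family {E ι : Type*} [NormedAddCommGroup E] [NormedSpace ℝ E] [Fintype ι]
    [DecidableEq ι] {ℓ : ι → E →L[ℝ] ℝ} (h : LinearIndependent ℝ ℓ) :
    ∃ e : ι → E, ∀ i j, ℓ i (e j) = if i = j then 1 else 0 := by
  let m : E →ₗ[ℝ] ι → ℝ := LinearMap.pi fun i => (ℓ i).toLinearMap
  have hm : LinearMap.range m = ⊤ := by
    -- If x ↦ (ℓᵢ x) were not onto, a nonzero functional vanishing on its range would be a linear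
    -- relation between the ℓᵢ.
    by_contra hne
    obtain ⟨f, hf, hker⟩ := Submodule.exists_le_ker_of_lt_top _ (lt_top_iff_ne_top.2 hne)
    have hsum : ∑ i, f (Pi.single i 1) • ℓ i = 0 := by
      ext x
      have h1 : f (m x) = 0 := hker ⟨x, rfl⟩
      have h2 : m x = ∑ i, ℓ i x • Pi.single (M := fun _ => ℝ) i (1 : ℝ) := by
        ext j
        simp [m, Pi.single_apply]
      rw [h2, map_sum] at h1
      simpa [mul_comm] using h1
    have h0 := Fintype.linearIndependent_iff.1 h _ hsum
    apply hf
    refine LinearMap.pi_ext' fun i => LinearMap.ext_ring ?_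
    simpa using h0 i
  have hsurj := LinearMap.range_eq_top.1 hm
  choose e he using fun j => hsurj (Pi.single j 1)
  refine ⟨e, fun i j => ?_⟩
  have := congrFun (he j) i
  simpa [m, Pi.single_apply] using this

/-- With a dual family e, the map w + ∑ (ρᵢ(z, w) - ℓᵢ w) eᵢ, where ℓᵢ is the fibre derivative of ρᵢ
at p₀, has ℓᵢ-coordinate exactly ρᵢ. Its fibre derivative at p₀ is the identity because each ρᵢ - ℓᵢ
has vanishing fibre derivative there. Taking two functions at once straightens corners. -/
theorem exists_straightening_family {ι : Type*} [Fintype ι] [DecidableEq ι] {p₀ : Cn n × Cn n}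
    {W : Set (Cn n × Cn n)} (hW : IsOpen W) (hp : p₀ ∈ W) {ρ : ι → Cn n × Cn n → ℝ}
    (hρ : ∀ i, ContDiff ℝ ∞ (ρ i)) (hli : LinearIndependent ℝ fun i => fibreDeriv (ρ i) p₀) :
    ∃ S : Straightening n, p₀ ∈ S.source ∧ S.source ⊆ W ∧
      ∀ i q, fibreDeriv (ρ i) p₀ (S.toFun q) = ρ i q := by
  obtain ⟨e, he⟩ := exists_dual_family hli
  set ψ : Cn n × Cn n → Cn n := fun q => q.2 + ∑ i, (ρ i q - fibreDeriv (ρ i) p₀ q.2) • e i with hψ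
  have hs : ContDiff ℝ ∞ ψ := by
    refine contDiff_snd.add (ContDiff.sum fun i _ => ContDiff.fun_smul ?_ contDiff_const)
    exact (hρ i).sub ((fibreDeriv (ρ i) p₀).contDiff.comp contDiff_snd)
  have hd : derivSnd ψ p₀ = ContinuousLinearMap.id ℝ (Cn n) := by
    have h1 : HasFDerivAt ψ (ContinuousLinearMap.snd ℝ (Cn n) (Cn n) +
        ∑ i, (fderiv ℝ (ρ i) p₀ - (fibreDeriv (ρ i) p₀).comp
          (ContinuousLinearMap.snd ℝ (Cn n) (Cn n))).smulRight (e i)) p₀ := by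
      refine hasFDerivAt_snd.fun_add (HasFDerivAt.fun_sum fun i _ => ?_)
      exact ((((hρ i).differentiable (by simp)) p₀).hasFDerivAt.sub
        ((fibreDeriv (ρ i) p₀).hasFDerivAt.comp p₀ hasFDerivAt_snd)).smul_const (e i)
    rw [derivSnd, h1.fderiv]
    ext v : 1
    simp [fibreDeriv]
  obtain ⟨S, hS, h1, h2⟩ := exists_straightening hW hp hs hd
  refine ⟨S, h1, h2, fun i q => ?_⟩
  rw [hS]
  simp [hψ, he]

end

section

variable {n : ℕ}

/-! ### Change of variables in straightened coordinates -/

namespace Straightening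

variable (S : Straightening n) {Q : Set (Cn n)} {F m : Cn n × Cn n → ℂ}

theorem hasStrictFDerivAt_invFun {q : Cn n × Cn n} (hq : q ∈ S.target) :
    HasStrictFDerivAt (fun s => S.invFun (q.1, s)) (derivSnd S.invFun q) q.2 := by
  have h1 := (S.contDiffOn_invFun.contDiffAt (S.isOpen_target.mem_nhds hq)).hasStrictFDerivAt
    (by simp)
  exact HasStrictFDerivAt.comp (f := fun s => (q.1, s)) q.2 (by simpa using h1)
    ((by fun_prop : ContDiffAt ℝ ∞ (fun s : Cn n => (q.1, s)) q.2).hasStrictFDerivAt'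
      (hasFDerivAt_prodMk_right q.1 q.2) (by simp))

theorem derivSnd_comp {q : Cn n × Cn n} (hq : q ∈ S.target) :
    (derivSnd S.toFun (q.1, S.invFun q)).comp (derivSnd S.invFun q) =
      ContinuousLinearMap.id ℝ (Cn n) := by
  have h1 := (S.hasStrictFDerivAt_invFun hq).hasFDerivAt
  have h2 : HasFDerivAt (fun w => S.toFun (q.1, w)) (derivSnd S.toFun (q.1, S.invFun q))
      (S.invFun (q.1, q.2)) :=
    HasFDerivAt.comp (f := fun w => (q.1, w)) _
      (S.contDiff_toFun.differentiable (by simp) (q.1, S.invFun q)).hasFDerivAt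
      (hasFDerivAt_prodMk_right _ _)
  have h3 := HasFDerivAt.comp (f := fun s => S.invFun (q.1, s)) q.2 h2 h1
  refine h3.unique ((hasFDerivAt_id q.2).congr_of_eventuallyEq ?_)
  have : Tendsto (fun s => (q.1, s)) (𝓝 q.2) (𝓝 q) := by
    have : Continuous fun s : Cn n => (q.1, s) := by fun_prop
    exact this.tendsto q.2
  filter_upwards [this.eventually (S.isOpen_target.mem_nhds hq)] with s hs
  exact S.right_inv (q.1, s) hs

theorem det_invFun_pos {q : Cn n × Cn n} (hq : q ∈ S.target) :
    0 < (derivSnd S.invFun q).det := by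
  have h1 := congrArg ContinuousLinearMap.det (S.derivSnd_comp hq)
  have h2 : (derivSnd S.toFun (q.1, S.invFun q)).det * (derivSnd S.invFun q).det = 1 := by
    have := LinearMap.det_comp (derivSnd S.toFun (q.1, S.invFun q)).toLinearMap
      (derivSnd S.invFun q).toLinearMap
    refine this.symm.trans (h1.trans ?_)
    exact LinearMap.det_id
  have h3 := S.det_pos _ (S.map_target q hq)
  exact pos_of_mul_pos_right (h2 ▸ one_pos) h3.le

theorem contDiffOn_det : ContDiffOn ℝ ∞ (fun q => (derivSnd S.invFun q).det) S.target := by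
  refine contDiff_det.comp_contDiffOn (g := fun L : Cn n →L[ℝ] Cn n => L.det)
    (f := derivSnd S.invFun) ?_
  exact (S.contDiffOn_invFun.fderiv_of_isOpen S.isOpen_target (by simp)).clm_comp contDiffOn_const

theorem image_invFun (Q : Set (Cn n)) (z : Cn n) :
    (fun s => S.invFun (z, s)) '' {s | (z, s) ∈ S.target ∧ s ∈ Q} =
      {w | (z, w) ∈ S.source ∧ S.toFun (z, w) ∈ Q} := by
  ext w
  constructor
  · rintro ⟨s, ⟨hs, hsQ⟩, rfl⟩
    exact ⟨S.map_target _ hs, by simpa only [S.right_inv _ hs] using hsQ⟩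
  · rintro ⟨hw, hwQ⟩
    exact ⟨S.toFun (z, w), ⟨S.map_source _ hw, hwQ⟩, S.left_inv _ hw⟩

theorem measurableSet_target_inter (hQ : MeasurableSet Q) (z : Cn n) :
    MeasurableSet {s | (z, s) ∈ S.target ∧ s ∈ Q} :=
  ((S.isOpen_target.preimage (by fun_prop : Continuous fun s : Cn n => (z, s))).measurableSet).inter
    hQ

theorem integral_fibre (hQ : MeasurableSet Q) (h : Cn n → ℂ) (z : Cn n) :
    ∫ w in {w | (z, w) ∈ S.source ∧ S.toFun (z, w) ∈ Q}, h w =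
      ∫ s in {s | (z, s) ∈ S.target ∧ s ∈ Q},
        ((derivSnd S.invFun (z, s)).det : ℂ) * h (S.invFun (z, s)) := by
  have hm := S.measurableSet_target_inter hQ z
  rw [← S.image_invFun Q z, integral_image_eq_integral_abs_det_fderiv_smul volume hm
    (f' := fun s => derivSnd S.invFun (z, s))
    (fun s hs => (S.hasStrictFDerivAt_invFun hs.1).hasFDerivAt.hasFDerivWithinAt) ?_]
  · refine setIntegral_congr_fun hm fun s hs => ?_
    simp [abs_of_pos (S.det_invFun_pos hs.1)]
  · intro s hs s' hs' he
    have h1 := S.right_inv _ hs.1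
    have h2 := S.right_inv _ hs'.1
    have he' : S.invFun (z, s) = S.invFun (z, s') := he
    simp only at h1 h2
    rw [← h1, he', h2]

/-- The compact set over which the pull-back of a compactly supported function is supported. -/
theorem isCompact_image {F : Cn n × Cn n → ℂ} (hc : HasCompactSupport F) :
    IsCompact ((fun q : Cn n × Cn n => (q.1, S.toFun q)) '' tsupport F) :=
  hc.isCompact.image (continuous_fst.prodMk S.contDiff_toFun.continuous)

/-- The transport of `F m` to the straightened coordinates, with `m` already given there. -/
def pullback (F m : Cn n × Cn n → ℂ) : Cn n × Cn n → ℂ :=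
  S.target.indicator fun q => F (q.1, S.invFun q) * m q

theorem pullback_eq_zero {q : Cn n × Cn n}
    (hq : q ∉ (fun q : Cn n × Cn n => (q.1, S.toFun q)) '' tsupport F) : S.pullback F m q = 0 := by
  by_cases hqT : q ∈ S.target
  · rw [pullback, indicator_of_mem hqT, image_eq_zero_of_notMem_tsupport (f := F), zero_mul]
    intro h
    exact hq ⟨_, h, by simp [S.right_inv q hqT]⟩
  · rw [pullback, indicator_of_notMem hqT]

theorem image_subset_target (hFS : tsupport F ⊆ S.source) :
    (fun q : Cn n × Cn n => (q.1, S.toFun q)) '' tsupport F ⊆ S.target := by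
  rintro _ ⟨q, hq, rfl⟩
  exact S.map_source q (hFS hq)

theorem contDiff_pullback (hF : ContDiff ℝ ∞ F) (hc : HasCompactSupport F)
    (hFS : tsupport F ⊆ S.source) (hm : ContDiffOn ℝ ∞ m S.target) :
    ContDiff ℝ ∞ (S.pullback F m) := by
  refine contDiff_of_eq_zero_off S.isOpen_target (S.isCompact_image hc).isClosed
    (S.image_subset_target hFS) ?_ fun q => S.pullback_eq_zero
  have h1 : ContDiffOn ℝ ∞ (fun q => F (q.1, S.invFun q) * m q) S.target :=
    (hF.comp_contDiffOn (contDiff_fst.contDiffOn.prodMk S.contDiffOn_invFun)).mul hm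
  exact h1.congr fun q hq => by rw [pullback, indicator_of_mem hq]

theorem hasCompactSupport_pullback (hc : HasCompactSupport F) :
    HasCompactSupport (S.pullback F m) :=
  HasCompactSupport.of_support_subset_isCompact (S.isCompact_image hc)
    ((subset_tsupport _).trans (tsupport_subset_of_eq_zero_off (S.isCompact_image hc).isClosed
      fun _ => S.pullback_eq_zero))

/-- After straightening, neither the measure nor the piece of domain it carries depends on z; all
dependence on z sits in the amplitude and the exponent, as `IsOsc` demands. -/
theorem isOsc_pullback {μ : Measure (Cn n)} [IsLocallyFiniteMeasure μ]
    (hF : ContDiff ℝ ∞ F) (hc : HasCompactSupport F) (hFS : tsupport F ⊆ S.source)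
    (hm : ContDiffOn ℝ ∞ m S.target) {ζ₀ : Cn n} {a : ℝ}
    (hle : ∀ q ∈ tsupport F, (pairing (q.2 - q.1) ζ₀).re ≤ a) :
    IsOsc ζ₀ a (fun p => ∫ s in {s | (p.1, s) ∈ S.target}, F (p.1, S.invFun (p.1, s)) * m (p.1, s) *
      Complex.exp (pairing (S.invFun (p.1, s) - p.1) p.2) ∂μ) := by
  classical
  set K := (fun q : Cn n × Cn n => (q.1, S.toFun q)) '' tsupport F
  have hK : IsCompact K := S.isCompact_image hc
  have hKT : K ⊆ S.target := S.image_subset_target hFS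
  set A : Cn n × Cn n → ℂ := S.pullback F m with hA
  have hA0 : ∀ q ∉ K, A q = 0 := fun q => S.pullback_eq_zero
  have hAs : ContDiff ℝ ∞ A := S.contDiff_pullback hF hc hFS hm
  have hAt : tsupport A ⊆ K := tsupport_subset_of_eq_zero_off hK.isClosed hA0
  have hAc : HasCompactSupport A := S.hasCompactSupport_pullback hc
  obtain ⟨η, hη, -, hηT, hη1⟩ := exists_contDiff_cutoff hK S.isOpen_target hKT
  -- The inverse is smooth only on the target, while `IsOsc` asks for a globally smooth exponent.
  -- The cut-off η is 1 on the support of the amplitude, so the integral is unaffected.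
  set Φ : Cn n × Cn n → Cn n := fun q => η q • S.invFun q - q.1 with hΦ
  have hΦs : ContDiff ℝ ∞ Φ := by
    refine ContDiff.sub ?_ contDiff_fst
    refine contDiff_of_eq_zero_off S.isOpen_target (isClosed_tsupport η) hηT ?_ ?_
    · exact hη.contDiffOn.fun_smul S.contDiffOn_invFun
    · intro q hq
      rw [image_eq_zero_of_notMem_tsupport hq, zero_smul]
  have hη1' : ∀ q ∈ K, η q = 1 := fun q hq => hη1.self_of_nhdsSet q hq
  have hosc : IsOsc ζ₀ a (oscInt μ A Φ) := by
    refine .osc μ inferInstance A Φ hAs hAc hΦs fun q hq => ?_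
    obtain ⟨q', hq', rfl⟩ := hAt hq
    simp only [hΦ, hη1' _ (hAt hq), one_smul, S.left_inv q' (hFS hq')]
    exact hle q' hq'
  convert! hosc using 2 with p
  have hmeas : MeasurableSet {s | (p.1, s) ∈ S.target} :=
    (S.isOpen_target.preimage (by fun_prop : Continuous fun s : Cn n => (p.1, s))).measurableSet
  rw [← integral_indicator hmeas, oscInt]
  congr 1
  funext s
  by_cases hs : (p.1, s) ∈ S.target
  · rw [indicator_of_mem (show s ∈ {s | (p.1, s) ∈ S.target} from hs)]
    by_cases hsK : (p.1, s) ∈ K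
    · simp [hA, pullback, hΦ, indicator_of_mem hs, hη1' _ hsK]
    · have h0 := hA0 _ hsK
      rw [h0, zero_mul]
      rw [hA, pullback, indicator_of_mem hs] at h0
      simp only at h0
      rw [h0, zero_mul]
  · rw [indicator_of_notMem (show s ∉ {s | (p.1, s) ∈ S.target} from hs), hA,
      pullback, indicator_of_notMem hs, zero_mul]

/-- The derivative of the inverse in a fibre, as an isomorphism. -/
def derivEquiv (q : Cn n × Cn n) (hq : q ∈ S.target) : Cn n ≃L[ℝ] Cn n :=
  ((derivSnd S.toFun (q.1, S.invFun q)).toContinuousLinearEquivOfDetNeZero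
    (S.det_pos _ (S.map_target q hq)).ne').symm

theorem coe_derivEquiv (q : Cn n × Cn n) (hq : q ∈ S.target) :
    (S.derivEquiv q hq : Cn n →L[ℝ] Cn n) = derivSnd S.invFun q := by
  ext v : 1
  have h := congrArg (fun L : Cn n →L[ℝ] Cn n => L v) (S.derivSnd_comp hq)
  simp only [ContinuousLinearMap.comp_apply, ContinuousLinearMap.id_apply] at h
  rw [derivEquiv, ContinuousLinearEquiv.coe_coe, ContinuousLinearEquiv.symm_apply_eq,
    ContinuousLinearMap.toContinuousLinearEquivOfDetNeZero_apply, h]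

theorem coe_derivEquiv_symm (q : Cn n × Cn n) (hq : q ∈ S.target) :
    ((S.derivEquiv q hq).symm : Cn n →L[ℝ] Cn n) = derivSnd S.toFun (q.1, S.invFun q) := by
  rw [derivEquiv, ContinuousLinearEquiv.symm_symm,
    ContinuousLinearMap.coe_toContinuousLinearEquivOfDetNeZero]

theorem comp_derivSnd {ℓ : Cn n →L[ℝ] ℝ} {ρ : Cn n × Cn n → ℝ}
    (hℓρ : ∀ q, ℓ (S.toFun q) = ρ q) (q : Cn n × Cn n) :
    ℓ.comp (derivSnd S.toFun q) = fibreDeriv ρ q := by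
  have h1 : HasFDerivAt ρ (ℓ.comp (fderiv ℝ S.toFun q)) q := by
    have := ℓ.hasFDerivAt.comp q (S.contDiff_toFun.differentiable (by simp) q).hasFDerivAt
    exact this.congr_of_eventuallyEq (Eventually.of_forall fun q => (hℓρ q).symm)
  rw [fibreDeriv, h1.fderiv]
  rfl

/-- Surface measure on the part of a level set that is mapped to a piece of a hyperplane. -/
theorem map_restrict_fibre {d : ℕ} (hd : Module.finrank ℝ (Cn n) = d + 1) {ℓ : Cn n →L[ℝ] ℝ}
    (hℓ : ℓ ≠ 0) {ρ : Cn n × Cn n → ℝ} (hρ : ContDiff ℝ ∞ ρ) (hℓρ : ∀ q, ℓ (S.toFun q) = ρ q)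
    (hQ : MeasurableSet Q) (hQℓ : ∀ s ∈ Q, ℓ s = 0) (z : Cn n) :
    ((μHE[d] : Measure (Cn n)).restrict {w | (z, w) ∈ S.source ∧ S.toFun (z, w) ∈ Q}).map
        (fun w => S.toFun (z, w)) =
      ((μHE[d] : Measure (Cn n)).restrict {s | (z, s) ∈ S.target ∧ s ∈ Q}).withDensity fun s =>
        ENNReal.ofReal ((derivSnd S.invFun (z, s)).det *
          ‖fibreDeriv ρ (z, S.invFun (z, s))‖ / ‖ℓ‖) := by
  classical
  rw [← S.image_invFun Q z]
  refine map_restrict_image_eq_withDensity hd hℓ (S.measurableSet_target_inter hQ z)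
    (f' := fun s => if hs : (z, s) ∈ S.target then S.derivEquiv (z, s) hs
      else ContinuousLinearEquiv.refl ℝ _)
    (fun s hs => hQℓ s hs.2) ?_ (fun s hs => S.right_inv _ hs.1) ?_ ?_ ?_
  · exact (S.contDiff_toFun.continuous.comp
      (by fun_prop : Continuous fun w : Cn n => (z, w))).measurable
  · rintro s ⟨hs, -⟩
    simp only [hs, dif_pos]
    rw [S.coe_derivEquiv]
    exact S.hasStrictFDerivAt_invFun hs
  · rintro s ⟨hs, -⟩
    simp only [hs, dif_pos]
    rw [S.coe_derivEquiv, S.coe_derivEquiv_symm, abs_of_pos (S.det_invFun_pos hs),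
      S.comp_derivSnd hℓρ]
  · have h1 : ContinuousOn (fun q => (derivSnd S.invFun q).det *
        ‖fibreDeriv ρ (q.1, S.invFun q)‖ / ‖ℓ‖) S.target := by
      refine (S.contDiffOn_det.continuousOn.mul (ContinuousOn.norm ?_)).div_const _
      have h2 : Continuous (fibreDeriv ρ) :=
        (hρ.continuous_fderiv (by simp)).clm_comp continuous_const
      exact h2.comp_continuousOn (continuousOn_fst.prodMk S.contDiffOn_invFun.continuousOn)
    exact h1.comp (by fun_prop : Continuous fun s : Cn n => (z, s)).continuousOn fun s hs => hs.1

end Straightening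

end

section

/-! ### Integration by parts in a half-space -/

section HalfSpace

open Module

variable {E : Type*} [NormedAddCommGroup E] [InnerProductSpace ℝ E] [FiniteDimensional ℝ E]
  [MeasurableSpace E] [BorelSpace E]

/-- The kernel of ℓ is isometric to a d-dimensional Euclidean space, where μHE[d] is finite on
bounded sets. This is what permits hyperplane measures in `IsOsc`. -/
theorem isLocallyFiniteMeasure_restrict_ker {d : ℕ} (hd : finrank ℝ E = d + 1) {ℓ : E →L[ℝ] ℝ}
    (hℓ : ℓ ≠ 0) {Q : Set E} (hQ : ∀ x ∈ Q, ℓ x = 0) :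
    IsLocallyFiniteMeasure ((μHE[d] : Measure E).restrict Q) := by
  set H := LinearMap.ker ℓ.toLinearMap
  have hdH : finrank ℝ H = d := finrank_ker_of_ne_zero hd hℓ
  have hmap := (isometry_subtype_coe (s := (H : Set E))).map_euclideanHausdorffMeasure (d := d)
  have hle : (μHE[d] : Measure E).restrict Q ≤ (μHE[d] : Measure E).restrict H :=
    Measure.restrict_mono_set _ fun x hx => hQ x hx
  have hfin : IsLocallyFiniteMeasure ((μHE[d] : Measure E).restrict H) := by
    refine ⟨fun x => ⟨Metric.ball x 1, Metric.ball_mem_nhds x one_pos, ?_⟩⟩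
    rw [Subtype.range_coe] at hmap
    rw [← hmap, Measure.map_apply measurable_subtype_coe measurableSet_ball]
    subst hdH
    refine Bornology.IsBounded.measure_lt_top (μ := (μHE[finrank ℝ H] : Measure H)) ?_
    refine (isometry_subtype_coe (s := (H : Set E))).antilipschitz.isBounded_preimage ?_
    exact Metric.isBounded_ball
  exact Measure.isLocallyFiniteMeasure_of_le hle

/-- Fubini's theorem for the hyperplanes orthogonal to a unit vector. -/
theorem integral_eq_integral_orthogonal {u : E} (hu : ‖u‖ = 1) {f : E → ℂ} (hf : Integrable f) :
    ∫ x, f x = ∫ y : (ℝ ∙ u)ᗮ, ∫ t : ℝ, f (t • u + y) := by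
  set s := ℝ ∙ u
  set e : ℝ ≃ₗᵢ[ℝ] s := LinearIsometryEquiv.toSpanUnitSingleton u hu
  have h1 : MeasurePreserving (fun q : ℝ × sᗮ => (e q.1, q.2)) volume volume :=
    e.measurePreserving.prod (MeasurePreserving.id _)
  have h2 := (s.measurePreserving_measurableEquivProd (0 : E)).symm
  rw [InnerProductSpace.euclideanHausdorffMeasure_eq_volume] at h2
  have h3 : MeasurePreserving (fun q : ℝ × sᗮ => q.1 • u + (q.2 : E)) volume volume := by
    convert! h2.comp h1 using 1
    funext q
    simp only [Function.comp_apply, Submodule.measurableEquivProd_symm_apply]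
    simp [e]
    rfl
  have hemb : MeasurableEmbedding (fun q : ℝ × sᗮ => q.1 • u + (q.2 : E)) := by
    have := (s.measurableEquivProd (0 : E)).symm.measurableEmbedding.comp
      (e.toHomeomorph.measurableEmbedding.prodMap (MeasurableEmbedding.id (α := sᗮ)))
    convert! this using 1
    funext q
    simp only [Function.comp_apply, Submodule.measurableEquivProd_symm_apply]
    simp [e]
    rfl
  rw [← h3.integral_comp hemb, Measure.volume_eq_prod, integral_prod_symm]
  exact (h3.integrable_comp_emb hemb).2 hf

/-- Fubini along the unit normal of the hyperplane, followed by the fundamental theorem of calculus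
on each half-line. -/
theorem integral_halfSpace_fderiv {d : ℕ} (hd : finrank ℝ E = d + 1) {ℓ : E →L[ℝ] ℝ} (hℓ : ℓ ≠ 0)
    {M : E → ℂ} (hM : ContDiff ℝ 1 M) (hMc : HasCompactSupport M) :
    ∫ x in {x | ℓ x < 0}, fderiv ℝ M x (‖ℓ‖⁻¹ • (InnerProductSpace.toDual ℝ E).symm ℓ) =
      ∫ x in {x | ℓ x = 0}, M x ∂μHE[d] := by
  set u : E := ‖ℓ‖⁻¹ • (InnerProductSpace.toDual ℝ E).symm ℓ with hu
  have p1 : 0 < ‖ℓ‖ := norm_pos_iff.2 hℓ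
  have hu1 : ‖u‖ = 1 := by
    rw [hu, norm_smul, LinearIsometryEquiv.norm_map]
    simp [p1.ne']
  have e1 : ∀ x, ℓ x = ‖ℓ‖ * inner ℝ u x := by
    intro x
    rw [hu, inner_smul_left, InnerProductSpace.toDual_symm_apply]
    simp [p1.ne']
  set H := (ℝ ∙ u)ᗮ
  have hH : (H : Set E) = {x | ℓ x = 0} := by
    ext x
    simp only [SetLike.mem_coe, H, Submodule.mem_orthogonal_singleton_iff_inner_right]
    rw [mem_ofPred_eq, e1]
    simp [p1.ne']
  have hℓu : ∀ t : ℝ, ∀ y : H, ℓ (t • u + y) = ‖ℓ‖ * t := by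
    intro t y
    have h1 : ℓ y = 0 := by
      have : (y : E) ∈ (H : Set E) := y.2
      rwa [hH] at this
    rw [map_add, h1, map_smul, e1 u, real_inner_self_eq_norm_sq, hu1]
    simp [mul_comm]
  have hdH : finrank ℝ H = d := by
    have h1 := finrank_ker_of_ne_zero hd hℓ
    have h2 : H = LinearMap.ker ℓ.toLinearMap := SetLike.coe_injective (by rw [hH]; rfl)
    rw [h2, h1]
  have hcont : Continuous fun x => fderiv ℝ M x u :=
    (hM.continuous_fderiv one_ne_zero).clm_apply continuous_const
  have hint : Integrable fun x => fderiv ℝ M x u :=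
    hcont.integrable_of_hasCompactSupport (hMc.fderiv_apply (𝕜 := ℝ) u)
  have hms : MeasurableSet {x : E | ℓ x < 0} :=
    (isOpen_lt ℓ.continuous continuous_const).measurableSet
  rw [← integral_indicator hms, integral_eq_integral_orthogonal hu1 (hint.indicator hms)]
  have inner_eq : ∀ y : H, ∫ t : ℝ, {x : E | ℓ x < 0}.indicator (fun x => fderiv ℝ M x u)
      (t • u + y) = M y := by
    intro y
    set m : ℝ → ℂ := fun t => M (t • u + y)
    have hm : ContDiff ℝ 1 m := hM.comp (by fun_prop)
    have hmc : HasCompactSupport m := by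
      refine hMc.comp_isClosedEmbedding ?_
      have h1 : Isometry fun t : ℝ => t • u + (y : E) := by
        refine Isometry.of_dist_eq fun a b => ?_
        rw [dist_add_right, dist_eq_norm, ← sub_smul, norm_smul, hu1, mul_one, dist_eq_norm]
      exact h1.isClosedEmbedding
    have hder : ∀ t, deriv m t = fderiv ℝ M (t • u + y) u := by
      intro t
      have h1 : HasDerivAt (fun t : ℝ => t • u + (y : E)) u t := by
        simpa using ((hasDerivAt_id t).smul_const u).add_const (y : E)
      exact ((hM.differentiable one_ne_zero _).hasFDerivAt.comp_hasDerivAt t h1).deriv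
    have h2 := hmc.integral_Iic_deriv_eq hm 0
    rw [integral_Iic_eq_integral_Iio, ← integral_indicator measurableSet_Iio] at h2
    have h3 : m 0 = M y := by simp [m]
    rw [← h3, ← h2]
    congr 1
    funext t
    have : (t • u + (y : E)) ∈ {x : E | ℓ x < 0} ↔ t ∈ Iio (0 : ℝ) := by
      rw [mem_ofPred_eq, hℓu, mem_Iio]
      constructor
      · intro h; by_contra h'; push Not at h'; nlinarith
      · intro h; nlinarith
    by_cases ht : t ∈ Iio (0 : ℝ)
    · rw [indicator_of_mem ht, indicator_of_mem (this.2 ht), hder]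
    · rw [indicator_of_notMem ht, indicator_of_notMem (fun h => ht (this.1 h))]
  simp_rw [inner_eq]
  have hmap := (isometry_subtype_coe (s := (H : Set E))).map_euclideanHausdorffMeasure (d := d)
  rw [Subtype.range_coe] at hmap
  rw [← hH, ← hmap, MeasurableEmbedding.integral_map]
  · subst hdH
    exact congrArg (fun μ : Measure H => ∫ y, M y ∂μ)
      InnerProductSpace.euclideanHausdorffMeasure_eq_volume.symm
  · exact MeasurableEmbedding.subtype_coe (by
      rw [hH]; exact (isClosed_eq ℓ.continuous continuous_const).measurableSet)

theorem tendsto_smoothTransition_neg (t : ℝ) :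
    Tendsto (fun j : ℕ => Real.smoothTransition (-(j : ℝ) * t)) atTop
      (𝓝 (if t < 0 then 1 else 0)) := by
  split_ifs with ht
  · refine tendsto_const_nhds.congr' ?_
    obtain ⟨N, hN⟩ := exists_nat_gt (1 / -t)
    filter_upwards [eventually_ge_atTop N] with j hj
    refine (Real.smoothTransition.one_of_one_le ?_).symm
    have h1 : 0 < -t := by linarith
    rw [div_lt_iff₀ h1] at hN
    have : (N : ℝ) ≤ j := by exact_mod_cast hj
    nlinarith
  · refine tendsto_const_nhds.congr fun j => ?_
    refine (Real.smoothTransition.zero_of_nonpos ?_).symm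
    push Not at ht
    have : (0 : ℝ) ≤ j := by positivity
    nlinarith

/-- If `N` is the weak derivative of `M` along `ℓ`, the integral of `N` over `ℓ < 0` is the
integral of `M` over the hyperplane `ℓ = 0`. -/
theorem integral_halfSpace_of_weak {d : ℕ} (hd : finrank ℝ E = d + 1) {ℓ : E →L[ℝ] ℝ} (hℓ : ℓ ≠ 0)
    {M N : E → ℂ} (hM : ContDiff ℝ 1 M) (hMc : HasCompactSupport M) (hN : Continuous N)
    (hNc : HasCompactSupport N)
    (h : ∀ χ : ℝ → ℝ, ContDiff ℝ ∞ χ → ∫ x, (χ (ℓ x) : ℂ) * N x =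
      - ∫ x, ((deriv χ (ℓ x) : ℝ) : ℂ) * M x) :
    ∫ x in {x | ℓ x < 0}, N x = (‖ℓ‖ : ℂ)⁻¹ * ∫ x in {x | ℓ x = 0}, M x ∂μHE[d] := by
  rw [← integral_halfSpace_fderiv hd hℓ hM hMc]
  set u : E := ‖ℓ‖⁻¹ • (InnerProductSpace.toDual ℝ E).symm ℓ with hu
  have p1 : 0 < ‖ℓ‖ := norm_pos_iff.2 hℓ
  have hℓu : ℓ u = ‖ℓ‖ := by
    have : ℓ u = inner ℝ ((InnerProductSpace.toDual ℝ E).symm ℓ) u := by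
      rw [InnerProductSpace.toDual_symm_apply]
    rw [this, hu, inner_smul_right, real_inner_self_eq_norm_sq, LinearIsometryEquiv.norm_map]
    field_simp
  have hcont : Continuous fun x => fderiv ℝ M x u :=
    (hM.continuous_fderiv one_ne_zero).clm_apply continuous_const
  have hMcu : HasCompactSupport fun x => fderiv ℝ M x u := hMc.fderiv_apply (𝕜 := ℝ) u
  -- P is the difference between N and the classical derivative that it should equal in the mean.
  -- Integration by parts shows that P is orthogonal to every smooth function of ℓ.
  set P : E → ℂ := fun x => N x - (‖ℓ‖ : ℂ)⁻¹ * fderiv ℝ M x u with hP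
  have hPc : Continuous P := hN.sub (continuous_const.mul hcont)
  have hPs : HasCompactSupport P := hNc.sub hMcu.mul_left
  have hPi : Integrable P := hPc.integrable_of_hasCompactSupport hPs
  have hzero : ∀ χ : ℝ → ℝ, ContDiff ℝ ∞ χ → ∫ x, (χ (ℓ x) : ℂ) * P x = 0 := by
    intro χ hχ
    have hχc : Continuous fun x => (χ (ℓ x) : ℂ) := by
      have := hχ.continuous; fun_prop
    have hχd : ContDiff ℝ ∞ fun x => (χ (ℓ x) : ℂ) :=
      Complex.ofRealCLM.contDiff.comp (hχ.comp ℓ.contDiff)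
    have hfd : ∀ x, fderiv ℝ (fun x => (χ (ℓ x) : ℂ)) x u = ((deriv χ (ℓ x) : ℝ) : ℂ) * ‖ℓ‖ := by
      intro x
      have h1 : HasFDerivAt (fun x => χ (ℓ x)) (deriv χ (ℓ x) • ℓ) x :=
        (hχ.differentiable (by simp) (ℓ x)).hasDerivAt.comp_hasFDerivAt x ℓ.hasFDerivAt
      have h2 := Complex.ofRealCLM.hasFDerivAt.comp x h1
      rw [show (fun x => (χ (ℓ x) : ℂ)) = Complex.ofRealCLM ∘ fun x => χ (ℓ x) from rfl, h2.fderiv]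
      simp [hℓu]
    have hχd' : Continuous fun x => ((deriv χ (ℓ x) : ℝ) : ℂ) := by
      have := hχ.continuous_deriv (by simp); fun_prop
    have i1 : Integrable fun x => (χ (ℓ x) : ℂ) * N x :=
      (hχc.mul hN).integrable_of_hasCompactSupport hNc.mul_left
    have i2 : Integrable fun x => (χ (ℓ x) : ℂ) * fderiv ℝ M x u :=
      (hχc.mul hcont).integrable_of_hasCompactSupport hMcu.mul_left
    have i3 : Integrable fun x => fderiv ℝ (fun x => (χ (ℓ x) : ℂ)) x u * M x := by
      simp_rw [hfd]
      exact ((hχd'.mul continuous_const).mul hM.continuous).integrable_of_hasCompactSupport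
        hMc.mul_left
    have i4 : Integrable fun x => (χ (ℓ x) : ℂ) * M x :=
      (hχc.mul hM.continuous).integrable_of_hasCompactSupport hMc.mul_left
    have hibp := integral_mul_fderiv_eq_neg_fderiv_mul_of_integrable (𝕜 := ℂ)
      (f := fun x => (χ (ℓ x) : ℂ)) (g := M) i3 i2 i4
      (fun x _ => hχd.differentiable (by simp) x) (fun x _ => hM.differentiable one_ne_zero x)
    simp_rw [hfd] at hibp
    have h5 : ∀ x, (χ (ℓ x) : ℂ) * P x = (χ (ℓ x) : ℂ) * N x -
        (‖ℓ‖ : ℂ)⁻¹ * ((χ (ℓ x) : ℂ) * fderiv ℝ M x u) := fun x => by rw [hP]; ring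
    simp_rw [h5]
    rw [integral_sub i1 (i2.const_mul _), integral_const_mul, hibp, h χ hχ]
    have h6 : ∫ x, ((deriv χ (ℓ x) : ℝ) : ℂ) * ‖ℓ‖ * M x = ‖ℓ‖ * ∫ x, ((deriv χ (ℓ x) : ℝ) : ℂ) * M x := by
      rw [← integral_const_mul]
      congr 1
      funext x
      ring
    rw [h6]
    have : (‖ℓ‖ : ℂ) ≠ 0 := by exact_mod_cast p1.ne'
    field_simp
    ring
  have hms : MeasurableSet {x : E | ℓ x < 0} :=
    (isOpen_lt ℓ.continuous continuous_const).measurableSet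
  -- The smooth functions of ℓ used here converge boundedly to the indicator of ℓ < 0, so P also has
  -- integral zero over the half-space.
  have hlim : Tendsto (fun j : ℕ => ∫ x, (Real.smoothTransition (-(j : ℝ) * ℓ x) : ℂ) * P x) atTop
      (𝓝 (∫ x, {x | ℓ x < 0}.indicator P x)) := by
    refine tendsto_integral_of_dominated_convergence (fun x => ‖P x‖) ?_ hPi.norm ?_ ?_
    · intro j
      have : Continuous fun x => (Real.smoothTransition (-(j : ℝ) * ℓ x) : ℂ) := by
        have := Real.smoothTransition.continuous; fun_prop
      exact (this.mul hPc).aestronglyMeasurable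
    · refine fun j => Eventually.of_forall fun x => ?_
      rw [norm_mul, Complex.norm_real, Real.norm_of_nonneg (Real.smoothTransition.nonneg _)]
      exact mul_le_of_le_one_left (norm_nonneg _) (Real.smoothTransition.le_one _)
    · refine Eventually.of_forall fun x => ?_
      have h1 := (Complex.continuous_ofReal.tendsto _).comp (tendsto_smoothTransition_neg (ℓ x))
      have h2 := h1.mul_const (P x)
      convert! h2 using 2
      by_cases hx : ℓ x < 0
      · rw [indicator_of_mem (show x ∈ {x | ℓ x < 0} from hx)]; simp [hx]
      · rw [indicator_of_notMem (show x ∉ {x | ℓ x < 0} from hx)]; simp [hx]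
  have hz : ∀ j : ℕ, ∫ x, (Real.smoothTransition (-(j : ℝ) * ℓ x) : ℂ) * P x = 0 := fun j =>
    hzero (fun t => Real.smoothTransition (-(j : ℝ) * t))
      (Real.smoothTransition.contDiff.comp (by fun_prop))
  simp_rw [hz] at hlim
  have h0 := tendsto_nhds_unique hlim tendsto_const_nhds
  rw [integral_indicator hms] at h0
  have hNi : Integrable N := hN.integrable_of_hasCompactSupport hNc
  have hMi : Integrable fun x => fderiv ℝ M x u := hcont.integrable_of_hasCompactSupport hMcu
  rw [hP, integral_sub hNi.integrableOn (hMi.const_mul _).integrableOn, integral_const_mul,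
    sub_eq_zero] at h0
  exact h0

end HalfSpace

end

section

variable {n : ℕ}

/-! ### The outer unit normal -/

theorem eventually_neg_of_hasFDerivAt {r : Cn n → ℝ} {L : Cn n →L[ℝ] ℝ} {x v : Cn n}
    (hr : HasFDerivAt r L x) (hx : r x = 0) (hv : L v < 0) :
    ∀ᶠ t : ℝ in 𝓝[>] 0, r (x + t • v) < 0 := by
  have h1 : HasDerivAt (fun t : ℝ => x + t • v) v 0 := by
    simpa using ((hasDerivAt_id (0 : ℝ)).smul_const v).const_add x
  have h2 : HasDerivAt (fun t : ℝ => r (x + t • v)) (L v) 0 := by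
    have hr' : HasFDerivAt r L (x + (0 : ℝ) • v) := by simpa using hr
    exact hr'.comp_hasDerivAt 0 h1
  have h3 := (hasDerivAt_iff_tendsto_slope.1 h2).mono_left
    (nhdsWithin_mono (0 : ℝ) (fun t (ht : t ∈ Ioi (0 : ℝ)) => (ne_of_gt ht : t ≠ 0)))
  filter_upwards [h3.eventually (gt_mem_nhds hv), self_mem_nhdsWithin] with t ht ht0
  have ht0' : 0 < t := ht0
  rw [slope_def_field] at ht
  simp only [zero_smul, add_zero, hx, sub_zero] at ht
  by_contra h
  push Not at h
  exact absurd ht (not_lt.2 (div_nonneg h ht0'.le))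

theorem tendsto_add_smul_nhdsGT (x v : Cn n) :
    Tendsto (fun t : ℝ => x + t • v) (𝓝[>] 0) (𝓝 x) := by
  have : Continuous fun t : ℝ => x + t • v := by fun_prop
  have h := this.tendsto 0
  simp only [zero_smul, add_zero] at h
  exact h.mono_left nhdsWithin_le_nhds

/-- The normalised gradient of a defining function satisfies the definition by a first order
expansion; since `outerNormal` is an arbitrary choice, uniqueness has to be proved as well. -/
theorem outerNormal_eq {A : Set (Cn n)} {x : Cn n} {r : Cn n → ℝ} {L : Cn n →L[ℝ] ℝ} (hL : L ≠ 0)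
    (hr : HasFDerivAt r L x) (hx : r x = 0) (hA : ∀ᶠ y in 𝓝 x, y ∈ A ↔ r y < 0) :
    outerNormal A x = ‖L‖⁻¹ • (InnerProductSpace.toDual ℝ (Cn n)).symm L := by
  set ν := ‖L‖⁻¹ • (InnerProductSpace.toDual ℝ (Cn n)).symm L with hν
  have p1 : 0 < ‖L‖ := norm_pos_iff.2 hL
  have hin : ∀ v, inner ℝ v ν = ‖L‖⁻¹ * L v := by
    intro v
    rw [hν, real_inner_comm, inner_smul_left, InnerProductSpace.toDual_symm_apply]
    simp
  have hν1 : ‖ν‖ = 1 := by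
    rw [hν, norm_smul, LinearIsometryEquiv.norm_map]
    simp [p1.ne']
  have hnormal : IsOuterUnitNormal A x ν := by
    refine ⟨hν1, fun v => ⟨fun hv => ?_, fun hv => ?_⟩⟩
    · rw [hin] at hv
      have hLv : L v < 0 := by
        by_contra h
        push Not at h
        exact absurd hv (not_lt.2 (by positivity))
      filter_upwards [eventually_neg_of_hasFDerivAt hr hx hLv,
        (tendsto_add_smul_nhdsGT x v).eventually hA] with t h1 h2
      exact h2.2 h1
    · rw [hin] at hv
      have hLv : (-L) v < 0 := by
        rw [neg_apply, neg_lt_zero]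
        exact pos_of_mul_pos_right hv (by positivity)
      filter_upwards [eventually_neg_of_hasFDerivAt (r := fun y => -r y) hr.neg (by simp [hx]) hLv,
        (tendsto_add_smul_nhdsGT x v).eventually hA] with t h1 h2
      rw [h2]
      linarith
  have hex : ∃ ν, IsOuterUnitNormal A x ν := ⟨ν, hnormal⟩
  rw [outerNormal, dif_pos hex]
  have hc := hex.choose_spec
  set ν' := hex.choose
  by_contra hne
  have hlt : inner ℝ ν' ν < 1 := by
    refine lt_of_le_of_ne ?_ fun h => hne ?_
    · have := real_inner_le_norm ν' ν
      rwa [hc.1, hν1, one_mul] at this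
    · exact (inner_eq_one_iff_of_norm_eq_one hc.1 hν1).1 h
  -- For two different unit normals the direction ν' - ν points inwards according to ν and outwards
  -- according to ν'.
  have h1 : inner ℝ (ν' - ν) ν < 0 := by
    rw [inner_sub_left, real_inner_self_eq_norm_sq, hν1]; linarith
  have h2 : 0 < inner ℝ (ν' - ν) ν' := by
    rw [inner_sub_left, real_inner_self_eq_norm_sq, hc.1, real_inner_comm]; linarith
  obtain ⟨t, ht1, ht2⟩ := (((hnormal.2 _).1 h1).and ((hc.2 _).2 h2)).exists
  exact ht2 ht1

/-- The `k`-th complex coordinate of the gradient. -/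
def gradC (L : Cn n →L[ℝ] ℝ) (k : Fin n) : ℂ :=
  L (EuclideanSpace.single k (1 : ℂ)) +
    Complex.I * L (Complex.I • EuclideanSpace.single k (1 : ℂ))

theorem toDual_symm_apply_eq_gradC (L : Cn n →L[ℝ] ℝ) (k : Fin n) :
    (InnerProductSpace.toDual ℝ (Cn n)).symm L k = gradC L k := by
  set x := (InnerProductSpace.toDual ℝ (Cn n)).symm L
  have h : ∀ v, L v = inner ℝ x v := fun v => (InnerProductSpace.toDual_symm_apply).symm
  have h1 : L (EuclideanSpace.single k (1 : ℂ)) = (x k).re := by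
    rw [h, PiLp.inner_apply, Finset.sum_eq_single k]
    · simp [Complex.inner]
    · intro j _ hj; simp [hj]
    · simp
  have h2 : L (Complex.I • EuclideanSpace.single k (1 : ℂ)) = (x k).im := by
    rw [h, PiLp.inner_apply, Finset.sum_eq_single k]
    · simp [Complex.inner]
    · intro j _ hj; simp [hj]
    · simp
  rw [gradC, h1, h2, mul_comm]
  exact (Complex.re_add_im _).symm

theorem outerNormal_apply {A : Set (Cn n)} {x : Cn n} {r : Cn n → ℝ} {L : Cn n →L[ℝ] ℝ}
    (hL : L ≠ 0) (hr : HasFDerivAt r L x) (hx : r x = 0) (hA : ∀ᶠ y in 𝓝 x, y ∈ A ↔ r y < 0)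
    (k : Fin n) : outerNormal A x k = (‖L‖ : ℂ)⁻¹ * gradC L k := by
  rw [outerNormal_eq hL hr hx hA, PiLp.smul_apply, toDual_symm_apply_eq_gradC]
  simp

theorem contDiff_gradC (k : Fin n) : ContDiff ℝ ∞ fun L : Cn n →L[ℝ] ℝ => gradC L k := by
  unfold gradC
  have h : ∀ v : Cn n, ContDiff ℝ ∞ fun L : Cn n →L[ℝ] ℝ => ((L v : ℝ) : ℂ) := fun v =>
    Complex.ofRealCLM.contDiff.comp (ContinuousLinearMap.apply ℝ ℝ v).contDiff
  exact (h _).add (contDiff_const.mul (h _))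

theorem contDiff_fibreDeriv {ρ : Cn n × Cn n → ℝ} (hρ : ContDiff ℝ ∞ ρ) :
    ContDiff ℝ ∞ (fibreDeriv ρ) :=
  (hρ.fderiv_right (m := ∞) (by simp)).clm_comp contDiff_const

theorem hasFDerivAt_fibre {F : Type*} [NormedAddCommGroup F] [NormedSpace ℝ F]
    {f : Cn n × Cn n → F} (hf : ContDiff ℝ ∞ f) (z w : Cn n) :
    HasFDerivAt (fun w => f (z, w)) ((fderiv ℝ f (z, w)).comp
      (ContinuousLinearMap.inr ℝ (Cn n) (Cn n))) w :=
  HasFDerivAt.comp (f := fun w => (z, w)) w (hf.differentiable (by simp) (z, w)).hasFDerivAt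
    (hasFDerivAt_prodMk_right z w)

theorem hasCompactSupport_slice {f : Cn n × Cn n → ℂ} (hf : HasCompactSupport f) (z : Cn n) :
    HasCompactSupport fun w => f (z, w) := by
  refine hf.comp_isClosedEmbedding (g := fun w : Cn n => (z, w)) ?_
  have : Isometry fun w : Cn n => (z, w) := Isometry.of_dist_eq fun a b => by
    simp [Prod.dist_eq]
  exact this.isClosedEmbedding

/-! ### Surface integrals in straightened coordinates -/

namespace Straightening

variable (S : Straightening n) {F m : Cn n × Cn n → ℂ}

theorem isOpen_slice_target (z : Cn n) : IsOpen {s | (z, s) ∈ S.target} :=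
  S.isOpen_target.preimage (by fun_prop : Continuous fun s : Cn n => (z, s))

theorem setIntegral_eq_integral_pullback (μ : Measure (Cn n)) (z : Cn n) :
    ∫ s in {s | (z, s) ∈ S.target}, F (z, S.invFun (z, s)) * m (z, s) ∂μ =
      ∫ s, S.pullback F m (z, s) ∂μ := by
  rw [← integral_indicator (S.isOpen_slice_target z).measurableSet]
  rfl

theorem fibreDeriv_ne_zero {ℓ : Cn n →L[ℝ] ℝ} {ρ : Cn n × Cn n → ℝ} (hℓ : ℓ ≠ 0)
    (hℓρ : ∀ q, ℓ (S.toFun q) = ρ q) {q : Cn n × Cn n} (hq : q ∈ S.source) :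
    fibreDeriv ρ q ≠ 0 := by
  rw [← S.comp_derivSnd hℓρ q]
  intro h
  apply hℓ
  ext v
  obtain ⟨v', rfl⟩ := ((derivSnd S.toFun q).toContinuousLinearEquivOfDetNeZero
    (S.det_pos q hq).ne').surjective v
  exact congrArg (fun L : Cn n →L[ℝ] ℝ => L v') h

/-- The density that occurs when a surface integral of a component of the normal is transported to
a hyperplane. -/
def normalDensity (ρ : Cn n × Cn n → ℝ) (ℓ : Cn n →L[ℝ] ℝ) (k : Fin n) (q : Cn n × Cn n) : ℂ :=
  ((derivSnd S.invFun q).det : ℂ) * gradC (fibreDeriv ρ (q.1, S.invFun q)) k * (‖ℓ‖ : ℂ)⁻¹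

theorem contDiffOn_ofReal_det :
    ContDiffOn ℝ ∞ (fun q => ((derivSnd S.invFun q).det : ℂ)) S.target :=
  Complex.ofRealCLM.contDiff.comp_contDiffOn S.contDiffOn_det

theorem contDiffOn_fibreDeriv {ρ : Cn n × Cn n → ℝ} (hρ : ContDiff ℝ ∞ ρ) :
    ContDiffOn ℝ ∞ (fun q => fibreDeriv ρ (q.1, S.invFun q)) S.target :=
  (contDiff_fibreDeriv hρ).comp_contDiffOn (contDiff_fst.contDiffOn.prodMk S.contDiffOn_invFun)

theorem contDiffOn_normalDensity {ρ : Cn n × Cn n → ℝ} (hρ : ContDiff ℝ ∞ ρ) (ℓ : Cn n →L[ℝ] ℝ)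
    (k : Fin n) : ContDiffOn ℝ ∞ (S.normalDensity ρ ℓ k) S.target :=
  (S.contDiffOn_ofReal_det.mul
    ((contDiff_gradC k).comp_contDiffOn (S.contDiffOn_fibreDeriv hρ))).mul contDiffOn_const

/-- Surface integrals of the components of the outer normal in straightened coordinates. -/
theorem integrableOn_and_integral_surface {d : ℕ} (hd : Module.finrank ℝ (Cn n) = d + 1)
    {ℓ : Cn n →L[ℝ] ℝ} (hℓ : ℓ ≠ 0) {ρ : Cn n × Cn n → ℝ} (hρ : ContDiff ℝ ∞ ρ)
    (hℓρ : ∀ q, ℓ (S.toFun q) = ρ q) {D E : Set (Cn n × Cn n)}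
    (hD : ∀ q ∈ S.source, q ∈ D ↔ ρ q < 0) {Q : Set (Cn n)} (hQ : MeasurableSet Q)
    (hQℓ : ∀ s ∈ Q, ℓ s = 0) (hEm : MeasurableSet E) (hE : ∀ q ∈ S.source, q ∈ E ↔ S.toFun q ∈ Q)
    (hF : ContDiff ℝ ∞ F) (hc : HasCompactSupport F) (hFS : tsupport F ⊆ S.source) (k : Fin n)
    (z : Cn n) :
    IntegrableOn (fun w => F (z, w) * outerNormal (fibre D z) w k) (fibre E z) μHE[d] ∧
    ∫ w in fibre E z, F (z, w) * outerNormal (fibre D z) w k ∂μHE[d] =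
      ∫ s, S.pullback F (S.normalDensity ρ ℓ k) (z, s) ∂((μHE[d] : Measure (Cn n)).restrict Q) := by
  set A := {w | (z, w) ∈ S.source ∧ S.toFun (z, w) ∈ Q}
  set T := {s | (z, s) ∈ S.target ∧ s ∈ Q}
  have hlf := isLocallyFiniteMeasure_restrict_ker hd hℓ hQℓ
  have p1 : 0 < ‖ℓ‖ := norm_pos_iff.2 hℓ
  have hAE : A ⊆ fibre E z := fun w hw => (hE _ hw.1).2 hw.2
  have hpair : Measurable fun w : Cn n => (z, w) := by fun_prop
  have hEz : MeasurableSet (fibre E z) := hpair hEm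
  have hTm : MeasurableSet T := S.measurableSet_target_inter hQ z
  have htoFun : Continuous fun w => S.toFun (z, w) :=
    S.contDiff_toFun.continuous.comp (by fun_prop)
  have hAm : MeasurableSet A :=
    ((S.isOpen_source.preimage (by fun_prop : Continuous fun w : Cn n => (z, w))).measurableSet).inter
      (htoFun.measurable hQ)
  -- F vanishes off the source, so the surface can be replaced by its part inside the source, where
  -- the straightening applies.
  have h0 : ∀ w ∈ fibre E z \ A, F (z, w) * outerNormal (fibre D z) w k = 0 := by
    intro w hw
    rw [image_eq_zero_of_notMem_tsupport (f := F), zero_mul]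
    intro h
    exact hw.2 ⟨hFS h, (hE _ (hFS h)).1 hw.1⟩
  set H : Cn n → ℂ := fun s => F (z, S.invFun (z, s)) *
    ((‖fibreDeriv ρ (z, S.invFun (z, s))‖ : ℂ)⁻¹ * gradC (fibreDeriv ρ (z, S.invFun (z, s))) k)
  have hAH : ∀ w ∈ A, F (z, w) * outerNormal (fibre D z) w k = H (S.toFun (z, w)) := by
    rintro w ⟨hw, hwQ⟩
    have h1 : S.invFun (z, S.toFun (z, w)) = w := S.left_inv _ hw
    simp only [H, h1]
    rw [outerNormal_apply (S.fibreDeriv_ne_zero hℓ hℓρ hw) (hasFDerivAt_fibre hρ z w)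
      (by rw [← hℓρ]; exact hQℓ _ hwQ)]
    · have := (by fun_prop : Continuous fun w : Cn n => (z, w)).continuousAt.eventually
        (S.isOpen_source.mem_nhds hw)
      filter_upwards [this] with y hy
      exact hD _ hy
  have hmap := S.map_restrict_fibre hd hℓ hρ hℓρ hQ hQℓ z
  set δ : Cn n → ℝ := fun s => (derivSnd S.invFun (z, s)).det *
    ‖fibreDeriv ρ (z, S.invFun (z, s))‖ / ‖ℓ‖
  have hpc : ContinuousOn (fun s : Cn n => (z, s)) T := by fun_prop
  have hfd : ContinuousOn (fun s => fibreDeriv ρ (z, S.invFun (z, s))) T :=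
    (S.contDiffOn_fibreDeriv hρ).continuousOn.comp hpc fun s hs => hs.1
  have hδ : ContinuousOn δ T :=
    ((S.contDiffOn_det.continuousOn.comp hpc fun s hs => hs.1).mul hfd.norm).div_const _
  have hH : ContinuousOn H T := by
    refine ContinuousOn.mul ?_ (ContinuousOn.mul (ContinuousOn.inv₀ ?_ ?_) ?_)
    · refine hF.continuous.comp_continuousOn (continuousOn_const.prodMk ?_)
      exact S.contDiffOn_invFun.continuousOn.comp hpc fun s hs => hs.1
    · exact Complex.continuous_ofReal.comp_continuousOn hfd.norm
    · intro s hs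
      have := S.fibreDeriv_ne_zero hℓ hℓρ (S.map_target _ hs.1)
      simpa using this
    · exact (contDiff_gradC k).continuous.comp_continuousOn hfd
  have hHm : AEStronglyMeasurable H
      (((μHE[d] : Measure (Cn n)).restrict T).withDensity fun s => ENNReal.ofReal (δ s)) :=
    (hH.aestronglyMeasurable hTm).mono_ac (withDensity_absolutelyContinuous _ _)
  have hδm : AEMeasurable (fun s => (δ s).toNNReal) ((μHE[d] : Measure (Cn n)).restrict T) :=
    (hδ.aemeasurable hTm).real_toNNReal
  -- The norm of the gradient in the area density cancels the one normalising the unit normal. What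
  -- remains is polynomial in the gradient, hence smooth.
  have hpull : ∀ s ∈ T, (δ s).toNNReal • H s = S.pullback F (S.normalDensity ρ ℓ k) (z, s) := by
    intro s hs
    have hd0 := S.det_invFun_pos hs.1
    have hn0 : (‖fibreDeriv ρ (z, S.invFun (z, s))‖ : ℂ) ≠ 0 := by
      have := S.fibreDeriv_ne_zero hℓ hℓρ (S.map_target _ hs.1)
      simpa using this
    have hδ0 : 0 ≤ δ s := by positivity
    rw [NNReal.smul_def, Real.coe_toNNReal _ hδ0, pullback, indicator_of_mem hs.1]
    simp only [H, δ, normalDensity, Complex.real_smul]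
    push_cast
    field_simp
  have hcont : Continuous fun s => S.pullback F (S.normalDensity ρ ℓ k) (z, s) :=
    (S.contDiff_pullback hF hc hFS (S.contDiffOn_normalDensity hρ ℓ k)).continuous.comp
      (by fun_prop)
  have hTQ : T ⊆ Q := fun s hs => hs.2
  have hTrest : (μHE[d] : Measure (Cn n)).restrict T = ((μHE[d] : Measure (Cn n)).restrict Q).restrict T := by
    rw [Measure.restrict_restrict hTm, inter_eq_left.2 hTQ]
  have hint0 : Integrable (fun s => S.pullback F (S.normalDensity ρ ℓ k) (z, s))
      ((μHE[d] : Measure (Cn n)).restrict Q) :=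
    hcont.integrable_of_hasCompactSupport
      (hasCompactSupport_slice (S.hasCompactSupport_pullback hc) z)
  have hint1 : Integrable (fun s => (δ s).toNNReal • H s) ((μHE[d] : Measure (Cn n)).restrict T) := by
    have : IntegrableOn (fun s => S.pullback F (S.normalDensity ρ ℓ k) (z, s)) T
      ((μHE[d] : Measure (Cn n)).restrict Q) := hint0.integrableOn
    rw [IntegrableOn, ← hTrest] at this
    exact this.congr ((ae_restrict_iff' hTm).2 (Eventually.of_forall fun s hs => (hpull s hs).symm))
  have hint2 : Integrable H
      (((μHE[d] : Measure (Cn n)).restrict T).withDensity fun s => ENNReal.ofReal (δ s)) :=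
    (integrable_withDensity_iff_integrable_smul₀ hδm).2 hint1
  rw [← hmap] at hint2 hHm
  have hint3 : IntegrableOn (fun w => F (z, w) * outerNormal (fibre D z) w k) A μHE[d] := by
    have := (integrable_map_measure hHm htoFun.aemeasurable).1 hint2
    exact this.congr ((ae_restrict_iff' hAm).2 (Eventually.of_forall fun w hw => (hAH w hw).symm))
  refine ⟨hint3.of_forall_sdiff_eq_zero hEz h0, ?_⟩
  rw [setIntegral_eq_of_subset_of_forall_sdiff_eq_zero hEz hAE h0,
    setIntegral_congr_fun hAm hAH, ← integral_map htoFun.aemeasurable hHm, hmap]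
  have := integral_withDensity_eq_integral_smul₀ hδm H
  refine this.trans ?_
  rw [setIntegral_congr_fun hTm hpull, hTrest]
  refine setIntegral_eq_integral_of_ae_compl_eq_zero ?_
  refine (ae_restrict_iff' hQ).2 (Eventually.of_forall fun s hsQ hsT => ?_)
  rw [pullback, indicator_of_notMem]
  exact fun h => hsT ⟨h, hsQ⟩

end Straightening

end

section

variable {n : ℕ}

/-! ### Local integration formulas -/

theorem dbarDir_dir_inr (F : Cn n × Cn n → ℂ) (k : Fin n) (q : Cn n × Cn n) :
    dbarDir (dir (toLex (Sum.inr k))) F q =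
      (1 / 2) * (fderiv ℝ F q (0, EuclideanSpace.single k 1) +
        Complex.I * fderiv ℝ F q (0, Complex.I • EuclideanSpace.single k 1)) := by
  simp [dbarDir, dir]

theorem integral_fderiv_mul_fibre {f g : Cn n × Cn n → ℂ} (hf : ContDiff ℝ ∞ f)
    (hg : ContDiff ℝ ∞ g) (hc : HasCompactSupport g) (v z : Cn n) :
    ∫ w, f (z, w) * fderiv ℝ g (z, w) (0, v) = -∫ w, fderiv ℝ f (z, w) (0, v) * g (z, w) := by
  have hpair : Continuous fun w : Cn n => (z, w) := by fun_prop
  have hf' : Continuous fun w => fderiv ℝ f (z, w) (0, v) :=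
    ((hf.continuous_fderiv (by simp)).comp hpair).clm_apply continuous_const
  have hg' : Continuous fun w => fderiv ℝ g (z, w) (0, v) :=
    ((hg.continuous_fderiv (by simp)).comp hpair).clm_apply continuous_const
  have hgc := hasCompactSupport_slice hc z
  have hgc' : HasCompactSupport fun w => fderiv ℝ g (z, w) (0, v) :=
    hasCompactSupport_slice (f := fun q => fderiv ℝ g q (0, v)) (hc.fderiv_apply (𝕜 := ℝ) _) z
  have ef : ∀ w, fderiv ℝ (fun w => f (z, w)) w v = fderiv ℝ f (z, w) (0, v) := fun w => by
    rw [(hasFDerivAt_fibre hf z w).fderiv]; simp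
  have eg : ∀ w, fderiv ℝ (fun w => g (z, w)) w v = fderiv ℝ g (z, w) (0, v) := fun w => by
    rw [(hasFDerivAt_fibre hg z w).fderiv]; simp
  have hfs := hf.continuous.comp hpair
  have hgs := hg.continuous.comp hpair
  have := integral_mul_fderiv_eq_neg_fderiv_mul_of_integrable (𝕜 := ℂ) (μ := (volume : Measure (Cn n)))
    (f := fun w => f (z, w)) (g := fun w => g (z, w)) (v := v)
    (by simp_rw [ef]; exact (hf'.mul hgs).integrable_of_hasCompactSupport hgc.mul_left)
    (by simp_rw [eg]; exact (hfs.mul hg').integrable_of_hasCompactSupport hgc'.mul_left)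
    ((hfs.mul hgs).integrable_of_hasCompactSupport hgc.mul_left)
    (fun w _ => (hasFDerivAt_fibre hf z w).differentiableAt)
    (fun w _ => (hasFDerivAt_fibre hg z w).differentiableAt)
  simpa only [ef, eg] using this

namespace Straightening

variable (S : Straightening n) {F : Cn n × Cn n → ℂ}

theorem pullback_apply_zero {m : Cn n × Cn n → ℂ} {q : Cn n × Cn n} (hq : q ∉ S.target) :
    S.pullback F m q = 0 := indicator_of_notMem hq _

/-- Volume integrals over a fibre in straightened coordinates. -/
theorem integral_eq_pullback {D : Set (Cn n × Cn n)} (hDm : MeasurableSet D) {Q : Set (Cn n)}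
    (hQ : MeasurableSet Q) (hD : ∀ q ∈ S.source, q ∈ D ↔ S.toFun q ∈ Q)
    (hFS : tsupport F ⊆ S.source) (z : Cn n) :
    ∫ w in fibre D z, F (z, w) =
      ∫ s in Q, S.pullback F (fun q => ((derivSnd S.invFun q).det : ℂ)) (z, s) := by
  have hpair : Measurable fun w : Cn n => (z, w) := by fun_prop
  have hDz : MeasurableSet (fibre D z) := hpair hDm
  rw [setIntegral_eq_of_subset_of_forall_sdiff_eq_zero hDz
    (s := {w | (z, w) ∈ S.source ∧ S.toFun (z, w) ∈ Q}) (fun w hw => (hD _ hw.1).2 hw.2),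
    S.integral_fibre hQ]
  · have hTm := S.measurableSet_target_inter hQ z
    rw [setIntegral_eq_of_subset_of_forall_sdiff_eq_zero hQ
      (s := {s | (z, s) ∈ S.target ∧ s ∈ Q}) (fun s hs => hs.2)]
    · refine setIntegral_congr_fun hTm fun s hs => ?_
      rw [pullback, indicator_of_mem hs.1, mul_comm]
    · intro s hs
      exact S.pullback_apply_zero fun h => hs.2 ⟨h, hs.1⟩
  · intro w hw
    refine image_eq_zero_of_notMem_tsupport fun h => hw.2 ⟨hFS h, (hD _ (hFS h)).1 hw.1⟩

theorem tsupport_fderiv_apply_subset (v : Cn n × Cn n) :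
    tsupport (fun q => fderiv ℝ F q v) ⊆ tsupport F :=
  closure_minimal ((Function.support_subset_iff'.2 fun q hq => by
    rw [fderiv_of_notMem_tsupport ℝ hq]; rfl)) (isClosed_tsupport F)

/-- The divergence theorem for one real direction, in straightened coordinates. -/
theorem integral_fderiv_eq_surface {d : ℕ} (hd : Module.finrank ℝ (Cn n) = d + 1)
    {ℓ : Cn n →L[ℝ] ℝ} (hℓ : ℓ ≠ 0) {ρ : Cn n × Cn n → ℝ} (hρ : ContDiff ℝ ∞ ρ)
    (hℓρ : ∀ q, ℓ (S.toFun q) = ρ q) {D : Set (Cn n × Cn n)} (hDm : MeasurableSet D)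
    (hD : ∀ q ∈ S.source, q ∈ D ↔ ρ q < 0) (hF : ContDiff ℝ ∞ F) (hc : HasCompactSupport F)
    (hFS : tsupport F ⊆ S.source) (v z : Cn n) :
    ∫ w in fibre D z, fderiv ℝ F (z, w) (0, v) =
      (‖ℓ‖ : ℂ)⁻¹ * ∫ s in {s | ℓ s = 0}, S.pullback F (fun q => ((derivSnd S.invFun q).det : ℂ) *
        (fibreDeriv ρ (q.1, S.invFun q) v : ℂ)) (z, s) ∂μHE[d] := by
  set F' : Cn n × Cn n → ℂ := fun q => fderiv ℝ F q (0, v)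
  have hF' : ContDiff ℝ ∞ F' := (hF.fderiv_right (m := ∞) (by simp)).clm_apply contDiff_const
  have hc' : HasCompactSupport F' := hc.fderiv_apply (𝕜 := ℝ) _
  have hFS' : tsupport F' ⊆ S.source := (tsupport_fderiv_apply_subset _).trans hFS
  have hsl : ContDiff ℝ ∞ fun s : Cn n => (z, s) := contDiff_const.prodMk contDiff_id
  have hmd : ContDiffOn ℝ ∞ (fun q => (fibreDeriv ρ (q.1, S.invFun q) v : ℂ)) S.target :=
    Complex.ofRealCLM.contDiff.comp_contDiffOn
      ((S.contDiffOn_fibreDeriv hρ).clm_apply contDiffOn_const)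
  have hopen : MeasurableSet {s : Cn n | ℓ s < 0} :=
    (isOpen_lt ℓ.continuous continuous_const).measurableSet
  rw [S.integral_eq_pullback (F := F') hDm hopen
    (fun q hq => by rw [hD q hq, mem_ofPred_eq, hℓρ]) hFS' z]
  -- The weak form is used so that the Jacobian of the inverse need not be differentiated: the
  -- identity tested against χ(ℓ) is the transport of an integration by parts against χ(ρ) in the
  -- original fibre.
  refine integral_halfSpace_of_weak hd hℓ
    (M := fun s => S.pullback F (fun q => ((derivSnd S.invFun q).det : ℂ) *
        (fibreDeriv ρ (q.1, S.invFun q) v : ℂ)) (z, s))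
    (N := fun s => S.pullback F' (fun q => ((derivSnd S.invFun q).det : ℂ)) (z, s))
    (((S.contDiff_pullback hF hc hFS (S.contDiffOn_ofReal_det.mul hmd)).comp hsl).of_le
      (by exact_mod_cast le_top)) (hasCompactSupport_slice (S.hasCompactSupport_pullback hc) z)
    ((S.contDiff_pullback hF' hc' hFS' S.contDiffOn_ofReal_det).continuous.comp hsl.continuous)
    (hasCompactSupport_slice (S.hasCompactSupport_pullback hc') z) fun χ hχ => ?_
  have hχρ : ContDiff ℝ ∞ fun q => ((χ (ρ q) : ℝ) : ℂ) :=
    Complex.ofRealCLM.contDiff.comp (hχ.comp hρ)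
  have hder : ∀ w, fderiv ℝ (fun q => ((χ (ρ q) : ℝ) : ℂ)) (z, w) (0, v) =
      ((deriv χ (ρ (z, w)) : ℝ) : ℂ) * (fibreDeriv ρ (z, w) v : ℂ) := by
    intro w
    have h1 : HasFDerivAt (fun q => χ (ρ q)) (deriv χ (ρ (z, w)) • fderiv ℝ ρ (z, w)) (z, w) :=
      (hχ.differentiable (by simp) (ρ (z, w))).hasDerivAt.comp_hasFDerivAt (z, w)
        (hρ.differentiable (by simp) _).hasFDerivAt
    have h2 := Complex.ofRealCLM.hasFDerivAt.comp (z, w) h1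
    rw [show (fun q => ((χ (ρ q) : ℝ) : ℂ)) = Complex.ofRealCLM ∘ fun q => χ (ρ q) from rfl,
      h2.fderiv]
    simp [fibreDeriv]
  have key := integral_fderiv_mul_fibre hχρ hF hc v z
  simp_rw [hder] at key
  have e1 := S.integral_eq_pullback (F := fun q => ((χ (ρ q) : ℝ) : ℂ) * F' q)
    MeasurableSet.univ MeasurableSet.univ (by simp)
    ((tsupport_mul_subset_right (f := fun q => ((χ (ρ q) : ℝ) : ℂ)) (g := F')).trans hFS') z
  have e2 := S.integral_eq_pullback
    (F := fun q => ((deriv χ (ρ q) : ℝ) : ℂ) * (fibreDeriv ρ q v : ℂ) * F q)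
    MeasurableSet.univ MeasurableSet.univ (by simp)
    ((tsupport_mul_subset_right
      (f := fun q => ((deriv χ (ρ q) : ℝ) : ℂ) * (fibreDeriv ρ q v : ℂ)) (g := F)).trans hFS) z
  have hu : fibre (univ : Set (Cn n × Cn n)) z = univ := by ext; simp [fibre]
  rw [hu, setIntegral_univ, setIntegral_univ] at e1 e2
  refine Eq.trans ?_ ((e1.symm.trans key).trans ((congrArg Neg.neg e2).trans ?_))
  · congr 1
    funext s
    by_cases hs : (z, s) ∈ S.target
    · simp only [pullback, indicator_of_mem hs]
      rw [← hℓρ, S.right_inv _ hs]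
      ring
    · simp only [S.pullback_apply_zero hs, mul_zero]
  · congr 2
    funext s
    by_cases hs : (z, s) ∈ S.target
    · simp only [pullback, indicator_of_mem hs]
      rw [← hℓρ, S.right_inv _ hs]
      ring
    · simp only [S.pullback_apply_zero hs, mul_zero]

/-- The divergence theorem for `∂/∂w̄ₖ` near a boundary point. -/
theorem integral_dbarDir_eq_surface {d : ℕ} (hd : Module.finrank ℝ (Cn n) = d + 1)
    {ℓ : Cn n →L[ℝ] ℝ} (hℓ : ℓ ≠ 0) {ρ : Cn n × Cn n → ℝ} (hρ : ContDiff ℝ ∞ ρ)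
    (hℓρ : ∀ q, ℓ (S.toFun q) = ρ q) {D E : Set (Cn n × Cn n)} (hDm : MeasurableSet D)
    (hEm : MeasurableSet E) (hD : ∀ q ∈ S.source, q ∈ D ↔ ρ q < 0)
    (hE : ∀ q ∈ S.source, q ∈ E ↔ ρ q = 0) (hF : ContDiff ℝ ∞ F) (hc : HasCompactSupport F)
    (hFS : tsupport F ⊆ S.source) (k : Fin n) (z : Cn n) :
    ∫ w in fibre D z, dbarDir (dir (toLex (Sum.inr k))) F (z, w) =
      (1 / 2) * ∫ w in fibre E z, F (z, w) * outerNormal (fibre D z) w k ∂μHE[d] := by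
  have hQ : MeasurableSet {s : Cn n | ℓ s = 0} :=
    (isClosed_eq ℓ.continuous continuous_const).measurableSet
  rw [(S.integrableOn_and_integral_surface hd hℓ hρ hℓρ hD hQ (fun s hs => hs) hEm
    (fun q hq => by rw [hE q hq, mem_ofPred_eq, hℓρ]) hF hc hFS k z).2]
  have hlf := isLocallyFiniteMeasure_restrict_ker hd hℓ (Q := {s : Cn n | ℓ s = 0}) fun s hs => hs
  have hpair : Continuous fun w : Cn n => (z, w) := by fun_prop
  have hi : ∀ v, IntegrableOn (fun w => fderiv ℝ F (z, w) (0, v)) (fibre D z) := fun v =>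
    ((((hF.continuous_fderiv (by simp)).comp hpair).clm_apply
      continuous_const).integrable_of_hasCompactSupport
      (hasCompactSupport_slice (f := fun q => fderiv ℝ F q (0, v))
        (hc.fderiv_apply (𝕜 := ℝ) _) z)).integrableOn
  simp_rw [dbarDir_dir_inr]
  rw [integral_const_mul, integral_add (hi _) ((hi _).const_mul _), integral_const_mul,
    S.integral_fderiv_eq_surface hd hℓ hρ hℓρ hDm hD hF hc hFS,
    S.integral_fderiv_eq_surface hd hℓ hρ hℓρ hDm hD hF hc hFS]
  congr 1
  have hmd : ∀ v, ContDiffOn ℝ ∞ (fun q => ((derivSnd S.invFun q).det : ℂ) *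
      (fibreDeriv ρ (q.1, S.invFun q) v : ℂ)) S.target := fun v =>
    S.contDiffOn_ofReal_det.mul (Complex.ofRealCLM.contDiff.comp_contDiffOn
      ((S.contDiffOn_fibreDeriv hρ).clm_apply contDiffOn_const))
  have hj : ∀ v, IntegrableOn (fun s => S.pullback F (fun q => ((derivSnd S.invFun q).det : ℂ) *
      (fibreDeriv ρ (q.1, S.invFun q) v : ℂ)) (z, s)) {s | ℓ s = 0} μHE[d] := fun v =>
    ((S.contDiff_pullback hF hc hFS (hmd v)).continuous.comp
      hpair).integrable_of_hasCompactSupport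
      (hasCompactSupport_slice (S.hasCompactSupport_pullback hc) z)
  -- The two real directions combine with weights 1 and i into `gradC`, that is, into the k-th
  -- component of the normal up to its length.
  rw [mul_left_comm, ← mul_add, ← integral_const_mul, ← integral_add (hj _) ((hj _).const_mul _),
    ← integral_const_mul]
  congr 1
  funext s
  by_cases hs : (z, s) ∈ S.target
  · simp only [pullback, indicator_of_mem hs, normalDensity, gradC]
    ring
  · simp only [S.pullback_apply_zero hs, mul_zero, add_zero]

end Straightening

end

section

variable {n : ℕ}

/-! ### Integration charts -/

/-- `F` times the exponential kernel. -/
def kernelMul (F : Cn n × Cn n → ℂ) (ζ : Cn n) : Cn n × Cn n → ℂ :=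
  fun q => F q * Complex.exp (pairing (q.2 - q.1) ζ)

theorem contDiff_kernel (ζ : Cn n) :
    ContDiff ℝ ∞ fun q : Cn n × Cn n => Complex.exp (pairing (q.2 - q.1) ζ) :=
  (contDiff_pairing (contDiff_snd.sub contDiff_fst) contDiff_const).cexp

theorem contDiff_kernelMul {F : Cn n × Cn n → ℂ} (hF : ContDiff ℝ ∞ F) (ζ : Cn n) :
    ContDiff ℝ ∞ (kernelMul F ζ) := hF.mul (contDiff_kernel ζ)

theorem hasCompactSupport_kernelMul {F : Cn n × Cn n → ℂ} (hc : HasCompactSupport F) (ζ : Cn n) :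
    HasCompactSupport (kernelMul F ζ) := hc.mul_right

theorem tsupport_kernelMul_subset (F : Cn n × Cn n → ℂ) (ζ : Cn n) :
    tsupport (kernelMul F ζ) ⊆ tsupport F := tsupport_mul_subset_left

/-- An open set on which integration over the fibres of `D₁ ∖ D₂` and of `∂D₁ ∖ D₂` is well
behaved. -/
structure IsIntegrationChart (D₁ D₂ O : Set (Cn n × Cn n)) : Prop where
  isOpen : IsOpen O
  volume_osc : ∀ F : Cn n × Cn n → ℂ, ContDiff ℝ ∞ F → HasCompactSupport F → tsupport F ⊆ O →
    ∀ ζ₀ a, (∀ q ∈ tsupport F, (pairing (q.2 - q.1) ζ₀).re ≤ a) →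
      IsOsc ζ₀ a (fun p => ∫ w in fibre (D₁ \ D₂) p.1, kernelMul F p.2 (p.1, w))
  surface_integrable : ∀ F : Cn n × Cn n → ℂ, ContDiff ℝ ∞ F → HasCompactSupport F →
    tsupport F ⊆ O → ∀ k z, IntegrableOn (fun w => F (z, w) * outerNormal (fibre D₁ z) w k)
      (fibre (frontier D₁ \ D₂) z) μHE[2 * n - 1]
  surface_osc : ∀ F : Cn n × Cn n → ℂ, ContDiff ℝ ∞ F → HasCompactSupport F → tsupport F ⊆ O →
    ∀ k ζ₀ a, (∀ q ∈ tsupport F, (pairing (q.2 - q.1) ζ₀).re ≤ a) →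
      IsOsc ζ₀ a (fun p => ∫ w in fibre (frontier D₁ \ D₂) p.1,
        kernelMul F p.2 (p.1, w) * outerNormal (fibre D₁ p.1) w k ∂μHE[2 * n - 1])
  stokes : Disjoint O (closure D₂) → ∀ F : Cn n × Cn n → ℂ, ContDiff ℝ ∞ F →
    HasCompactSupport F → tsupport F ⊆ O → ∀ k z,
      ∫ w in fibre (D₁ \ D₂) z, dbarDir (dir (toLex (Sum.inr k))) F (z, w) =
        (1 / 2) * ∫ w in fibre (frontier D₁ \ D₂) z,
          F (z, w) * outerNormal (fibre D₁ z) w k ∂μHE[2 * n - 1]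

theorem measurableSet_fibre {A : Set (Cn n × Cn n)} (hA : MeasurableSet A) (z : Cn n) :
    MeasurableSet (fibre A z) :=
  (by fun_prop : Measurable fun w : Cn n => (z, w)) hA

theorem integrable_slice {F : Cn n × Cn n → ℂ} (hF : Continuous F) (hc : HasCompactSupport F)
    (z : Cn n) : Integrable fun w => F (z, w) :=
  (hF.comp (by fun_prop : Continuous fun w : Cn n => (z, w))).integrable_of_hasCompactSupport
    (hasCompactSupport_slice hc z)

theorem continuous_dbarDir {F : Cn n × Cn n → ℂ} (hF : ContDiff ℝ ∞ F) (v : Cn n × Cn n) :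
    Continuous (dbarDir v F) := by
  have h := hF.continuous_fderiv (by simp)
  unfold dbarDir
  fun_prop

theorem dbarDir_eq_zero_of_notMem {F : Cn n × Cn n → ℂ} {q : Cn n × Cn n} (hq : q ∉ tsupport F)
    (v : Cn n × Cn n) : dbarDir v F q = 0 := by
  simp [dbarDir, fderiv_of_notMem_tsupport ℝ hq]

theorem tsupport_dbarDir_subset (F : Cn n × Cn n → ℂ) (v : Cn n × Cn n) :
    tsupport (dbarDir v F) ⊆ tsupport F :=
  tsupport_subset_of_eq_zero_off (isClosed_tsupport F) fun _ hq => dbarDir_eq_zero_of_notMem hq v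

theorem hasCompactSupport_dbarDir {F : Cn n × Cn n → ℂ} (hc : HasCompactSupport F)
    (v : Cn n × Cn n) : HasCompactSupport (dbarDir v F) :=
  hc.mono' ((subset_tsupport _).trans (tsupport_dbarDir_subset F v))

theorem integral_eq_zero_of_disjoint {A O : Set (Cn n × Cn n)} (h : Disjoint A O)
    {F : Cn n × Cn n → ℂ} (hF : tsupport F ⊆ O) {μ : Measure (Cn n)} (g : Cn n → ℂ) (z : Cn n) :
    ∫ w in fibre A z, F (z, w) * g w ∂μ = 0 := by
  refine setIntegral_eq_zero_of_forall_eq_zero fun w hw => ?_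
  rw [image_eq_zero_of_notMem_tsupport fun h' => disjoint_left.1 h hw (hF h'), zero_mul]

/-- Charts not meeting `∂D₁ ∖ D₂`. -/
theorem IsIntegrationChart.of_disjoint_surface {D₁ D₂ O : Set (Cn n × Cn n)} (hO : IsOpen O)
    (h₂ : IsOpen D₂) (hE : Disjoint (frontier D₁ \ D₂) O)
    (hvol : ∀ F : Cn n × Cn n → ℂ, ContDiff ℝ ∞ F → HasCompactSupport F → tsupport F ⊆ O →
      ∀ ζ₀ a, (∀ q ∈ tsupport F, (pairing (q.2 - q.1) ζ₀).re ≤ a) →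
        IsOsc ζ₀ a (fun p => ∫ w in fibre (D₁ \ D₂) p.1, kernelMul F p.2 (p.1, w)))
    (hst : Disjoint O (closure D₂) → ∀ F : Cn n × Cn n → ℂ, ContDiff ℝ ∞ F →
      HasCompactSupport F → tsupport F ⊆ O → ∀ k z,
        ∫ w in fibre (D₁ \ D₂) z, dbarDir (dir (toLex (Sum.inr k))) F (z, w) = 0) :
    IsIntegrationChart D₁ D₂ O := by
  have hEm : MeasurableSet (frontier D₁ \ D₂) := isClosed_frontier.measurableSet.diff h₂.measurableSet
  refine ⟨hO, hvol, ?_, ?_, ?_⟩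
  · intro F hF hc hFO k z
    refine (integrableOn_zero (μ := μHE[2 * n - 1])).congr_fun (fun w hw => ?_)
      (measurableSet_fibre hEm z)
    rw [image_eq_zero_of_notMem_tsupport fun h' => disjoint_left.1 hE hw (hFO h'), zero_mul]
  · intro F hF hc hFO k ζ₀ a h
    convert! IsOsc.zero (ζ₀ := ζ₀) (a := a) using 2 with p
    exact integral_eq_zero_of_disjoint hE ((tsupport_kernelMul_subset F _).trans hFO)  _ _
  · intro hd F hF hc hFO k z
    rw [hst hd F hF hc hFO k z, integral_eq_zero_of_disjoint hE hFO  _ _, mul_zero]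

/-- Charts not meeting `D₁ ∖ D₂`. -/
theorem IsIntegrationChart.of_disjoint {D₁ D₂ O : Set (Cn n × Cn n)} (hO : IsOpen O)
    (h₂ : IsOpen D₂) (hE : Disjoint (frontier D₁ \ D₂) O) (hD : Disjoint (D₁ \ D₂) O) :
    IsIntegrationChart D₁ D₂ O := by
  refine .of_disjoint_surface hO h₂ hE ?_ ?_
  · intro F hF hc hFO ζ₀ a h
    convert! IsOsc.zero (ζ₀ := ζ₀) (a := a) using 2 with p
    simpa using integral_eq_zero_of_disjoint hD ((tsupport_kernelMul_subset F p.2).trans hFO)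
      (μ := volume) (fun _ => 1) p.1
  · intro _ F hF hc hFO k z
    simpa using integral_eq_zero_of_disjoint hD ((tsupport_dbarDir_subset F _).trans hFO)
      (μ := volume) (fun _ => 1) z

theorem isOsc_integral_kernelMul {F : Cn n × Cn n → ℂ} (hF : ContDiff ℝ ∞ F)
    (hc : HasCompactSupport F) {ζ₀ : Cn n} {a : ℝ}
    (h : ∀ q ∈ tsupport F, (pairing (q.2 - q.1) ζ₀).re ≤ a) :
    IsOsc ζ₀ a (fun p => ∫ w, kernelMul F p.2 (p.1, w)) :=
  IsOsc.osc volume inferInstance F (fun q => q.2 - q.1) hF hc (contDiff_snd.sub contDiff_fst) h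

theorem integral_dbarDir_eq_zero {F : Cn n × Cn n → ℂ} (hF : ContDiff ℝ ∞ F)
    (hc : HasCompactSupport F) (k : Fin n) (z : Cn n) :
    ∫ w, dbarDir (dir (toLex (Sum.inr k))) F (z, w) = 0 := by
  have h0 : ∀ v : Cn n, ∫ w, fderiv ℝ F (z, w) (0, v) = 0 := fun v => by
    simpa using integral_fderiv_mul_fibre (f := fun _ => 1) contDiff_const hF hc v z
  have hi : ∀ v, Integrable (fun w => fderiv ℝ F (z, w) (0, v)) := fun v =>
    integrable_slice (F := fun q => fderiv ℝ F q (0, v))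
      ((hF.continuous_fderiv (by simp)).clm_apply continuous_const) (hc.fderiv_apply (𝕜 := ℝ) _) z
  simp_rw [dbarDir_dir_inr]
  rw [integral_const_mul, integral_add (hi _) ((hi _).const_mul _), integral_const_mul, h0, h0]
  simp

/-- The interior of `D₁ ∖ D₂`. -/
theorem IsIntegrationChart.interior {D₁ D₂ : Set (Cn n × Cn n)} (h₁ : IsOpen D₁)
    (h₂ : IsOpen D₂) : IsIntegrationChart D₁ D₂ (D₁ \ closure D₂) := by
  have hall : ∀ {F : Cn n × Cn n → ℂ}, tsupport F ⊆ D₁ \ closure D₂ → ∀ z,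
      ∫ w in fibre (D₁ \ D₂) z, F (z, w) = ∫ w, F (z, w) := by
    intro F hFO z
    refine setIntegral_eq_integral_of_forall_compl_eq_zero fun w hw => ?_
    refine image_eq_zero_of_notMem_tsupport fun h => hw ?_
    exact ⟨(hFO h).1, fun h' => (hFO h).2 (subset_closure h')⟩
  refine .of_disjoint_surface (h₁.sdiff isClosed_closure) h₂ ?_ ?_ ?_
  · rw [disjoint_left]
    rintro q ⟨hq, -⟩ ⟨hq1, -⟩
    rw [h₁.frontier_eq] at hq
    exact hq.2 hq1
  · intro F hF hc hFO ζ₀ a h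
    simp_rw [hall ((tsupport_kernelMul_subset F _).trans hFO)]
    exact isOsc_integral_kernelMul hF hc h
  · intro _ F hF hc hFO k z
    rw [hall ((tsupport_dbarDir_subset F _).trans hFO)]
    exact integral_dbarDir_eq_zero hF hc k z

/-! ### Integration charts obtained from straightenings -/

namespace Straightening

variable (S : Straightening n) {F : Cn n × Cn n → ℂ}

theorem integral_pullback_kernelMul (μ : Measure (Cn n)) (m : Cn n × Cn n → ℂ)
    (p : Cn n × Cn n) :
    ∫ s, S.pullback (kernelMul F p.2) m (p.1, s) ∂μ =
      ∫ s in {s | (p.1, s) ∈ S.target}, F (p.1, S.invFun (p.1, s)) * m (p.1, s) *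
        Complex.exp (pairing (S.invFun (p.1, s) - p.1) p.2) ∂μ := by
  rw [← setIntegral_eq_integral_pullback]
  congr 1
  funext s
  simp only [kernelMul]
  ring

theorem volume_osc {D : Set (Cn n × Cn n)} (hDm : MeasurableSet D) {Q : Set (Cn n)}
    (hQ : MeasurableSet Q) (hD : ∀ q ∈ S.source, q ∈ D ↔ S.toFun q ∈ Q)
    (hF : ContDiff ℝ ∞ F) (hc : HasCompactSupport F) (hFS : tsupport F ⊆ S.source)
    {ζ₀ : Cn n} {a : ℝ} (h : ∀ q ∈ tsupport F, (pairing (q.2 - q.1) ζ₀).re ≤ a) :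
    IsOsc ζ₀ a (fun p => ∫ w in fibre D p.1, kernelMul F p.2 (p.1, w)) := by
  convert! S.isOsc_pullback (μ := volume.restrict Q) hF hc hFS S.contDiffOn_ofReal_det h
    using 2 with p
  rw [S.integral_eq_pullback hDm hQ hD ((tsupport_kernelMul_subset F _).trans hFS),
    integral_pullback_kernelMul]

theorem surface_osc {d : ℕ} (hd : Module.finrank ℝ (Cn n) = d + 1)
    {ℓ : Cn n →L[ℝ] ℝ} (hℓ : ℓ ≠ 0) {ρ : Cn n × Cn n → ℝ} (hρ : ContDiff ℝ ∞ ρ)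
    (hℓρ : ∀ q, ℓ (S.toFun q) = ρ q) {D E : Set (Cn n × Cn n)}
    (hD : ∀ q ∈ S.source, q ∈ D ↔ ρ q < 0) {Q : Set (Cn n)} (hQ : MeasurableSet Q)
    (hQℓ : ∀ s ∈ Q, ℓ s = 0) (hEm : MeasurableSet E) (hE : ∀ q ∈ S.source, q ∈ E ↔ S.toFun q ∈ Q)
    (hF : ContDiff ℝ ∞ F) (hc : HasCompactSupport F) (hFS : tsupport F ⊆ S.source) (k : Fin n)
    {ζ₀ : Cn n} {a : ℝ} (h : ∀ q ∈ tsupport F, (pairing (q.2 - q.1) ζ₀).re ≤ a) :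
    IsOsc ζ₀ a (fun p => ∫ w in fibre E p.1,
        kernelMul F p.2 (p.1, w) * outerNormal (fibre D p.1) w k ∂μHE[d]) := by
  have hlf := isLocallyFiniteMeasure_restrict_ker hd hℓ hQℓ
  convert! S.isOsc_pullback (μ := (μHE[d] : Measure (Cn n)).restrict Q) hF hc hFS
    (S.contDiffOn_normalDensity hρ ℓ k) h using 2 with p
  rw [(S.integrableOn_and_integral_surface hd hℓ hρ hℓρ hD hQ hQℓ hEm hE
    (contDiff_kernelMul hF _) (hasCompactSupport_kernelMul hc _)
    ((tsupport_kernelMul_subset F _).trans hFS) k p.1).2, integral_pullback_kernelMul]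

/-- A straightening of `∂D₁` that also straightens `D₂` is a chart. -/
theorem isIntegrationChart (hn : 0 < n) {ℓ : Cn n →L[ℝ] ℝ} (hℓ : ℓ ≠ 0) {ρ : Cn n × Cn n → ℝ}
    (hρ : ContDiff ℝ ∞ ρ) (hℓρ : ∀ q, ℓ (S.toFun q) = ρ q) {D₁ D₂ : Set (Cn n × Cn n)}
    (h₁ : IsOpen D₁) (h₂ : IsOpen D₂) (hD₁ : ∀ q ∈ S.source, q ∈ D₁ ↔ ρ q < 0)
    (hfr : ∀ q ∈ S.source, q ∈ frontier D₁ ↔ ρ q = 0) {Q : Set (Cn n)} (hQ : MeasurableSet Q)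
    (hD₂ : ∀ q ∈ S.source, q ∉ D₂ ↔ S.toFun q ∈ Q) :
    IsIntegrationChart D₁ D₂ S.source := by
  have hd : Module.finrank ℝ (Cn n) = 2 * n - 1 + 1 := by
    have : Module.finrank ℝ (Cn n) = 2 * n := by simp [finrank_real_of_complex]
    omega
  have hDm : MeasurableSet (D₁ \ D₂) := h₁.measurableSet.diff h₂.measurableSet
  have hEm : MeasurableSet (frontier D₁ \ D₂) := isClosed_frontier.measurableSet.diff h₂.measurableSet
  have hQ0 : MeasurableSet {s : Cn n | ℓ s = 0} :=
    (isClosed_eq ℓ.continuous continuous_const).measurableSet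
  have hQ1 : MeasurableSet {s : Cn n | ℓ s < 0} :=
    (isOpen_lt ℓ.continuous continuous_const).measurableSet
  have hE : ∀ q ∈ S.source, q ∈ frontier D₁ \ D₂ ↔ S.toFun q ∈ {s | ℓ s = 0} ∩ Q := fun q hq => by
    rw [Set.mem_sdiff, hfr q hq, hD₂ q hq, mem_inter_iff, mem_ofPred_eq, hℓρ]
  have hD : ∀ q ∈ S.source, q ∈ D₁ \ D₂ ↔ S.toFun q ∈ {s | ℓ s < 0} ∩ Q := fun q hq => by
    rw [Set.mem_sdiff, hD₁ q hq, hD₂ q hq, mem_inter_iff, mem_ofPred_eq, hℓρ]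
  refine ⟨S.isOpen_source, ?_, ?_, ?_, ?_⟩
  · intro F hF hc hFO ζ₀ a h
    exact S.volume_osc hDm (hQ1.inter hQ) hD hF hc hFO h
  · intro F hF hc hFO k z
    exact (S.integrableOn_and_integral_surface hd hℓ hρ hℓρ hD₁ (hQ0.inter hQ) (fun s hs => hs.1)
      hEm hE hF hc hFO k z).1
  · intro F hF hc hFO k ζ₀ a h
    exact S.surface_osc hd hℓ hρ hℓρ hD₁ (hQ0.inter hQ) (fun s hs => hs.1) hEm hE hF hc hFO k h
  · intro hdis F hF hc hFO k z
    -- Away from the closure of D₂ the domain is just D₁ on the support of F, so there is no second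
    -- boundary contribution.
    have hnot : ∀ q ∈ S.source, q ∉ D₂ := fun q hq h =>
      disjoint_left.1 hdis hq (subset_closure h)
    have := S.integral_dbarDir_eq_surface hd hℓ hρ hℓρ h₁.measurableSet
      isClosed_frontier.measurableSet hD₁ hfr hF hc hFO k z
    rw [setIntegral_eq_of_subset_of_forall_sdiff_eq_zero (measurableSet_fibre h₁.measurableSet z)
      (s := fibre (D₁ \ D₂) z) (fun w hw => hw.1),
      setIntegral_eq_of_subset_of_forall_sdiff_eq_zero (measurableSet_fibre isClosed_frontier.measurableSet z)
      (s := fibre (frontier D₁ \ D₂) z) (fun w hw => hw.1)] at this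
    · exact this
    · intro w hw
      rw [image_eq_zero_of_notMem_tsupport (f := F), zero_mul]
      exact fun h => hw.2 ⟨hw.1, hnot _ (hFO h)⟩
    · intro w hw
      refine dbarDir_eq_zero_of_notMem (fun h => ?_) _
      exact hw.2 ⟨hw.1, hnot _ (hFO h)⟩

end Straightening

end

section

variable {n : ℕ}

/-! ### Gluing of integration charts -/

open scoped Manifold in
/-- A compactly supported function is a finite sum of functions supported in members of a given
open cover. -/
theorem exists_finite_decomposition {E : Type*} [NormedAddCommGroup E] [NormedSpace ℝ E]
    [FiniteDimensional ℝ E] {F : E → ℂ} (hF : ContDiff ℝ ∞ F) (hc : HasCompactSupport F)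
    {P : Set E → Prop} (hP : ∀ p ∈ tsupport F, ∃ O, IsOpen O ∧ p ∈ O ∧ P O) :
    ∃ (ι : Type) (s : Finset ι) (f : ι → E → ℂ), F = (fun x => ∑ i ∈ s, f i x) ∧
      ∀ i ∈ s, ContDiff ℝ ∞ (f i) ∧ HasCompactSupport (f i) ∧ tsupport (f i) ⊆ tsupport F ∧
        ∃ O, P O ∧ tsupport (f i) ⊆ O := by
  choose! O hO hpO hPO using hP
  obtain ⟨t, ht, htc⟩ := hc.isCompact.elim_nhds_subcover O
    fun p hp => (hO p hp).mem_nhds (hpO p hp)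
  obtain ⟨e⟩ : Nonempty (t ≃ Fin (Fintype.card t)) := ⟨Fintype.equivFin t⟩
  obtain ⟨χ, hχ⟩ := SmoothPartitionOfUnity.exists_isSubordinate 𝓘(ℝ, E) (isClosed_tsupport F)
    (fun i : Fin (Fintype.card t) => O (e.symm i))
    (fun i => hO _ (ht _ (e.symm i).2)) (by
      intro x hx
      obtain ⟨p, hp, hxp⟩ := mem_iUnion₂.1 (htc hx)
      exact mem_iUnion.2 ⟨e ⟨p, hp⟩, by simpa using hxp⟩)
  have hχs : ∀ i, ContDiff ℝ ∞ fun x => ((χ i x : ℝ) : ℂ) := fun i =>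
    Complex.ofRealCLM.contDiff.comp (χ i).contMDiff.contDiff
  refine ⟨Fin (Fintype.card t), Finset.univ, fun i x => ((χ i x : ℝ) : ℂ) * F x, ?_, fun i _ =>
    ⟨(hχs i).mul hF, hc.mul_left, tsupport_mul_subset_right, O (e.symm i),
      hPO _ (ht _ (e.symm i).2), ?_⟩⟩
  · funext x
    rw [← Finset.sum_mul]
    by_cases hx : x ∈ tsupport F
    · have h1 := χ.sum_eq_one hx
      rw [finsum_eq_sum_of_fintype] at h1
      rw [← Complex.ofReal_sum, h1]
      simp
    · rw [image_eq_zero_of_notMem_tsupport hx, mul_zero]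
  · refine tsupport_mul_subset_left.trans (subset_trans ?_ (hχ i))
    refine closure_mono fun x hx => ?_
    simpa using hx

/-- The field `stokes` is conditional on disjointness from the closure of D₂. A smaller set may
satisfy this when the larger one does not; `hdis` excludes that. -/
theorem IsIntegrationChart.mono {D₁ D₂ O O' : Set (Cn n × Cn n)} (h : IsIntegrationChart D₁ D₂ O)
    (hO' : IsOpen O') (hle : O' ⊆ O) (hdis : Disjoint O' (closure D₂) → Disjoint O (closure D₂)) :
    IsIntegrationChart D₁ D₂ O' :=
  ⟨hO', fun F hF hc hs => h.volume_osc F hF hc (hs.trans hle),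
    fun F hF hc hs => h.surface_integrable F hF hc (hs.trans hle),
    fun F hF hc hs => h.surface_osc F hF hc (hs.trans hle),
    fun hd F hF hc hs => h.stokes (hdis hd) F hF hc (hs.trans hle)⟩

theorem integral_finsetSum_mul {ι : Type} (s : Finset ι) {f : ι → Cn n → ℂ} {g : Cn n → ℂ}
    {μ : Measure (Cn n)} (h : ∀ i ∈ s, Integrable (fun w => f i w * g w) μ) :
    ∫ w, (∑ i ∈ s, f i w) * g w ∂μ = ∑ i ∈ s, ∫ w, f i w * g w ∂μ := by
  rw [← integral_finsetSum s h]
  simp_rw [Finset.sum_mul]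

/-- All the properties are linear in F, so a finite partition of unity reduces them to the small
charts. Its pieces keep their support inside that of F, which preserves the phase bound. -/
theorem IsIntegrationChart.glue {D₁ D₂ O : Set (Cn n × Cn n)} (hO : IsOpen O)
    (h : ∀ p ∈ O, ∃ O', p ∈ O' ∧ IsIntegrationChart D₁ D₂ O' ∧
      (Disjoint O (closure D₂) → Disjoint O' (closure D₂))) :
    IsIntegrationChart D₁ D₂ O := by
  have hP : ∀ F : Cn n × Cn n → ℂ, tsupport F ⊆ O → ∀ p ∈ tsupport F, ∃ O', IsOpen O' ∧ p ∈ O' ∧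
      (IsIntegrationChart D₁ D₂ O' ∧ (Disjoint O (closure D₂) → Disjoint O' (closure D₂))) := by
    intro F hF p hp
    obtain ⟨O', h1, h2, h3⟩ := h p (hF hp)
    exact ⟨O', h2.isOpen, h1, h2, h3⟩
  refine ⟨hO, ?_, ?_, ?_, ?_⟩
  · intro F hF hc hFO ζ₀ a hle
    obtain ⟨ι, s, f, rfl, hf⟩ := exists_finite_decomposition hF hc (hP F hFO)
    have := IsOsc.sum (ζ₀ := ζ₀) (a := a) s
      (fun i p => ∫ w in fibre (D₁ \ D₂) p.1, kernelMul (f i) p.2 (p.1, w)) fun i hi => by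
        obtain ⟨h1, h2, h3, O', h4, h5⟩ := hf i hi
        exact h4.1.volume_osc _ h1 h2 h5 ζ₀ a fun q hq => hle q (h3 hq)
    convert! this using 2 with p
    simp only [kernelMul]
    refine integral_finsetSum_mul s fun i hi => ?_
    exact (integrable_slice (contDiff_kernelMul (hf i hi).1 p.2).continuous
      (hasCompactSupport_kernelMul (hf i hi).2.1 _) p.1).integrableOn
  · intro F hF hc hFO k z
    obtain ⟨ι, s, f, rfl, hf⟩ := exists_finite_decomposition hF hc (hP F hFO)
    simp_rw [Finset.sum_mul]
    refine integrable_finsetSum s fun i hi => ?_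
    obtain ⟨h1, h2, h3, O', h4, h5⟩ := hf i hi
    exact h4.1.surface_integrable _ h1 h2 h5 k z
  · intro F hF hc hFO k ζ₀ a hle
    obtain ⟨ι, s, f, rfl, hf⟩ := exists_finite_decomposition hF hc (hP F hFO)
    have := IsOsc.sum (ζ₀ := ζ₀) (a := a) s
      (fun i p => ∫ w in fibre (frontier D₁ \ D₂) p.1, kernelMul (f i) p.2 (p.1, w) *
        outerNormal (fibre D₁ p.1) w k ∂μHE[2 * n - 1]) fun i hi => by
        obtain ⟨h1, h2, h3, O', h4, h5⟩ := hf i hi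
        exact h4.1.surface_osc _ h1 h2 h5 k ζ₀ a fun q hq => hle q (h3 hq)
    convert! this using 2 with p
    rw [← integral_finsetSum_mul s]
    · simp only [kernelMul, Finset.sum_mul]
    · intro i hi
      obtain ⟨h1, h2, h3, O', h4, h5⟩ := hf i hi
      exact h4.1.surface_integrable _ (contDiff_kernelMul h1 p.2)
        (hasCompactSupport_kernelMul h2 _) ((tsupport_kernelMul_subset _ _).trans h5) k p.1
  · intro hdis F hF hc hFO k z
    obtain ⟨ι, s, f, rfl, hf⟩ := exists_finite_decomposition hF hc (hP F hFO)
    have hdb : ∀ w, dbarDir (dir (toLex (Sum.inr k))) (fun x => ∑ i ∈ s, f i x) (z, w) =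
        ∑ i ∈ s, dbarDir (dir (toLex (Sum.inr k))) (f i) (z, w) := by
      intro w
      have : fderiv ℝ (fun x => ∑ i ∈ s, f i x) (z, w) = ∑ i ∈ s, fderiv ℝ (f i) (z, w) :=
        fderiv_fun_sum fun i hi => (hf i hi).1.differentiable (by simp) _
      simp only [dbarDir, this, FunLike.coe_sum, Finset.sum_apply, Finset.mul_sum,
        ← Finset.sum_add_distrib]
    simp_rw [hdb]
    rw [integral_finsetSum s, integral_finsetSum_mul s, Finset.mul_sum]
    · refine Finset.sum_congr rfl fun i hi => ?_
      obtain ⟨h1, h2, h3, O', h4, h5⟩ := hf i hi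
      exact h4.1.stokes (h4.2 hdis) _ h1 h2 h5 k z
    · intro i hi
      obtain ⟨h1, h2, h3, O', h4, h5⟩ := hf i hi
      exact h4.1.surface_integrable _ h1 h2 h5 k z
    · intro i hi
      exact (integrable_slice (continuous_dbarDir (hf i hi).1 _)
        (hasCompactSupport_dbarDir (hf i hi).2.1 _) z).integrableOn

/-! ### Charts of admissible domains -/

/-- A smooth defining function describes the boundary near points where it is a submersion. -/
theorem mem_frontier_iff {D W : Set (Cn n × Cn n)} (hD : IsOpen D) (hW : IsOpen W)
    {ρ : Cn n × Cn n → ℝ} (hρ : ContDiff ℝ ∞ ρ) (h : ∀ q ∈ W, q ∈ D ↔ ρ q < 0) {q : Cn n × Cn n}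
    (hq : q ∈ W) (hd : fibreDeriv ρ q ≠ 0) : q ∈ frontier D ↔ ρ q = 0 := by
  rw [hD.frontier_eq, Set.mem_sdiff]
  constructor
  · rintro ⟨h1, h2⟩
    rw [h q hq, not_lt] at h2
    refine le_antisymm ?_ h2
    by_contra h3
    push Not at h3
    obtain ⟨q', ⟨hq'1, hq'2⟩, hq'3⟩ := mem_closure_iff.1 h1 (W ∩ {q | 0 < ρ q})
      (hW.inter (isOpen_lt continuous_const hρ.continuous)) ⟨hq, h3⟩
    exact absurd ((h q' hq'1).1 hq'3) (not_lt.2 (le_of_lt hq'2))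
  · intro h0
    refine ⟨?_, by rw [h q hq, h0]; simp⟩
    obtain ⟨v, hv⟩ : ∃ v, fibreDeriv ρ q v < 0 := by
      by_contra hall
      push Not at hall
      apply hd
      ext v
      have h1 := hall v
      have h2 := hall (-v)
      rw [map_neg] at h2
      simp only [zero_apply]
      linarith
    have h1 := eventually_neg_of_hasFDerivAt (hasFDerivAt_fibre hρ q.1 q.2) h0 hv
    have h2 : Tendsto (fun t : ℝ => (q.1, q.2 + t • v)) (𝓝[>] 0) (𝓝 q) :=
      tendsto_const_nhds.prodMk_nhds (tendsto_add_smul_nhdsGT q.2 v)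
    refine mem_closure_of_tendsto h2 ?_
    filter_upwards [h1, h2.eventually (hW.mem_nhds hq)] with t ht1 ht2
    exact (h _ ht2).2 ht1

theorem linearIndependent_const_of_ne_zero {L : Cn n →L[ℝ] ℝ} (hL : L ≠ 0) :
    LinearIndependent ℝ fun _ : Unit => L :=
  LinearIndependent.of_subsingleton () hL

section

variable {V' U G Γ₁ Γ₂ D₁ D₂ : Set (Cn n × Cn n)}

/-- The position of p relative to D₁ and D₂ decides. In D₂ or off the closure of D₁ nothing is
integrated; in D₁ away from D₂ the whole fibre is; on one boundary that boundary is straightened,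
and at a corner both are at once. -/
theorem AdmissibleDomains.exists_chart (h : AdmissibleDomains V' U G Γ₁ Γ₂ D₁ D₂) (hn : 0 < n)
    {p : Cn n × Cn n} (hp : p.1 ∈ base V') {N : Set (Cn n × Cn n)} (hN : IsOpen N) (hpN : p ∈ N) :
    ∃ O, p ∈ O ∧ O ⊆ N ∧ IsIntegrationChart D₁ D₂ O := by
  have h₁ := h.isOpen₁
  have h₂ := h.isOpen₂
  have hfr₁ : Disjoint (frontier D₁) D₁ := by
    rw [h₁.frontier_eq]; exact disjoint_sdiff_left
  by_cases hp2 : p ∈ D₂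
  · refine ⟨D₂ ∩ N, ⟨hp2, hpN⟩, inter_subset_right, .of_disjoint (h₂.inter hN) h₂ ?_ ?_⟩
    · exact disjoint_sdiff_left.mono_right inter_subset_left
    · exact disjoint_sdiff_left.mono_right inter_subset_left
  by_cases hp1 : p ∈ closure D₁
  swap
  · refine ⟨(closure D₁)ᶜ ∩ N, ⟨hp1, hpN⟩, inter_subset_right,
      .of_disjoint (isClosed_closure.isOpen_compl.inter hN) h₂ ?_ ?_⟩
    · exact (disjoint_compl_right.mono_left (sdiff_subset.trans frontier_subset_closure)).mono_right
        inter_subset_left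
    · exact (disjoint_compl_right.mono_left (sdiff_subset.trans subset_closure)).mono_right
        inter_subset_left
  by_cases hp1' : p ∈ D₁
  · by_cases hpc : p ∈ closure D₂
    · have hpf : p ∈ frontier D₂ := by rw [h₂.frontier_eq]; exact ⟨hpc, hp2⟩
      obtain ⟨ρ, hρ⟩ := h.smooth₂ p hpf hp
      obtain ⟨W, hW, hWo, hpW⟩ := eventually_nhds_iff.1 hρ.mem_iff
      obtain ⟨S, hS1, hS2, hS3⟩ := exists_straightening_family (hWo.inter (hN.inter h₁))
        ⟨hpW, hpN, hp1'⟩ (ρ := fun _ : Unit => ρ) (fun _ => hρ.smooth)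
        (linearIndependent_const_of_ne_zero (h.transversal₂ p hpf hp ρ hρ))
      refine ⟨S.source, hS1, fun q hq => (hS2 hq).2.1, ?_⟩
      have hDm : MeasurableSet (D₁ \ D₂) := h₁.measurableSet.diff h₂.measurableSet
      refine .of_disjoint_surface S.isOpen_source h₂ ?_ ?_ ?_
      · exact (hfr₁.mono_left sdiff_subset).mono_right fun q hq => (hS2 hq).2.2
      · intro F hF hc hFO ζ₀ a hle
        refine S.volume_osc hDm (Q := {s | 0 ≤ fibreDeriv ρ p s})
          (isClosed_le continuous_const (fibreDeriv ρ p).continuous).measurableSet ?_ hF hc hFO hle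
        intro q hq
        rw [Set.mem_sdiff, mem_ofPred_eq, hS3 () q, hW q (hS2 hq).1, not_lt]
        exact and_iff_right (hS2 hq).2.2
      · intro hdis
        exact absurd hpc (disjoint_left.1 hdis hS1)
    · refine ⟨(D₁ \ closure D₂) ∩ N, ⟨⟨hp1', hpc⟩, hpN⟩, inter_subset_right,
        (IsIntegrationChart.interior h₁ h₂).mono ((h₁.sdiff isClosed_closure).inter hN)
          inter_subset_left fun _ => disjoint_sdiff_left⟩
  have hpf₁ : p ∈ frontier D₁ := by rw [h₁.frontier_eq]; exact ⟨hp1, hp1'⟩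
  obtain ⟨ρ₁, hρ₁⟩ := h.smooth₁ p hpf₁ hp
  have ht₁ := h.transversal₁ p hpf₁ hp ρ₁ hρ₁
  obtain ⟨W₁, hW₁, hWo₁, hpW₁⟩ := eventually_nhds_iff.1 hρ₁.mem_iff
  by_cases hpc : p ∈ closure D₂
  · have hpf₂ : p ∈ frontier D₂ := by rw [h₂.frontier_eq]; exact ⟨hpc, hp2⟩
    obtain ⟨ρ₂, hρ₂⟩ := h.smooth₂ p hpf₂ hp
    obtain ⟨W₂, hW₂, hWo₂, hpW₂⟩ := eventually_nhds_iff.1 hρ₂.mem_iff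
    -- Transversality inside the fibre is the linear independence that allows both defining
    -- functions to become linear coordinates; the complement of D₂ then is a fixed half-space
    -- cutting the fixed hyperplane.
    have hli := h.transversal₁₂ p ⟨hpf₁, hpf₂⟩ hp ρ₁ ρ₂ hρ₁ hρ₂
    obtain ⟨S, hS1, hS2, hS3⟩ := exists_straightening_family (hWo₁.inter (hN.inter hWo₂))
      ⟨hpW₁, hpN, hpW₂⟩ (ρ := ![ρ₁, ρ₂])
      (by intro i; fin_cases i; exacts [hρ₁.smooth, hρ₂.smooth])
      (by convert! hli using 1; funext i; fin_cases i <;> rfl)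
    refine ⟨S.source, hS1, fun q hq => (hS2 hq).2.1, ?_⟩
    have e₁ : ∀ q, fibreDeriv ρ₁ p (S.toFun q) = ρ₁ q := hS3 0
    have e₂ : ∀ q, fibreDeriv ρ₂ p (S.toFun q) = ρ₂ q := hS3 1
    refine S.isIntegrationChart hn ht₁ hρ₁.smooth e₁ h₁ h₂ (fun q hq => hW₁ q (hS2 hq).1)
      (fun q hq => mem_frontier_iff h₁ hWo₁ hρ₁.smooth hW₁ (hS2 hq).1
        (S.fibreDeriv_ne_zero ht₁ e₁ hq)) (Q := {s | 0 ≤ fibreDeriv ρ₂ p s})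
      (isClosed_le continuous_const (fibreDeriv ρ₂ p).continuous).measurableSet fun q hq => ?_
    rw [mem_ofPred_eq, e₂, hW₂ q (hS2 hq).2.2, not_lt]
  · obtain ⟨S, hS1, hS2, hS3⟩ := exists_straightening_family
      (hWo₁.inter (hN.inter isClosed_closure.isOpen_compl))
      ⟨hpW₁, hpN, hpc⟩ (ρ := fun _ : Unit => ρ₁) (fun _ => hρ₁.smooth)
      (linearIndependent_const_of_ne_zero ht₁)
    refine ⟨S.source, hS1, fun q hq => (hS2 hq).2.1, ?_⟩
    refine S.isIntegrationChart hn ht₁ hρ₁.smooth (hS3 ()) h₁ h₂ (fun q hq => hW₁ q (hS2 hq).1)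
      (fun q hq => mem_frontier_iff h₁ hWo₁ hρ₁.smooth hW₁ (hS2 hq).1
        (S.fibreDeriv_ne_zero ht₁ (hS3 ()) hq)) (Q := univ) MeasurableSet.univ fun q hq => ?_
    simpa using fun h' => (hS2 hq).2.2 (subset_closure h')

theorem AdmissibleDomains.isIntegrationChart (h : AdmissibleDomains V' U G Γ₁ Γ₂ D₁ D₂)
    (hn : 0 < n) {O : Set (Cn n × Cn n)} (hO : IsOpen O) (hOV : ∀ p ∈ O, p.1 ∈ base V') :
    IsIntegrationChart D₁ D₂ O :=
  .glue hO fun p hp => by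
    obtain ⟨O', h1, h2, h3⟩ := h.exists_chart hn (hOV p hp) hO hp
    exact ⟨O', h1, h3, fun hd => hd.mono_left h2⟩

/-- The surface of integration lies in the closure of the domain of integration. -/
theorem AdmissibleDomains.surface_subset_closure (h : AdmissibleDomains V' U G Γ₁ Γ₂ D₁ D₂)
    {p : Cn n × Cn n} (hp : p.1 ∈ base V') (hp₁ : p ∈ frontier D₁) (hp₂ : p ∉ D₂) :
    p ∈ closure (D₁ \ D₂) := by
  have h₁ := h.isOpen₁
  have h₂ := h.isOpen₂
  by_cases hpc : p ∈ closure D₂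
  · have hpf₂ : p ∈ frontier D₂ := by rw [h₂.frontier_eq]; exact ⟨hpc, hp₂⟩
    obtain ⟨ρ₁, hρ₁⟩ := h.smooth₁ p hp₁ hp
    obtain ⟨ρ₂, hρ₂⟩ := h.smooth₂ p hpf₂ hp
    obtain ⟨W₁, hW₁, hWo₁, hpW₁⟩ := eventually_nhds_iff.1 hρ₁.mem_iff
    obtain ⟨W₂, hW₂, hWo₂, hpW₂⟩ := eventually_nhds_iff.1 hρ₂.mem_iff
    have ht₁ := h.transversal₁ p hp₁ hp ρ₁ hρ₁
    have ht₂ := h.transversal₂ p hpf₂ hp ρ₂ hρ₂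
    have h01 := (mem_frontier_iff h₁ hWo₁ hρ₁.smooth hW₁ hpW₁ ht₁).1 hp₁
    have h02 := (mem_frontier_iff h₂ hWo₂ hρ₂.smooth hW₂ hpW₂ ht₂).1 hpf₂
    -- The direction e 1 - e 0 decreases the first defining function and increases the second: it
    -- enters D₁ and leaves D₂.
    obtain ⟨e, he⟩ := exists_dual_family (h.transversal₁₂ p ⟨hp₁, hpf₂⟩ hp ρ₁ ρ₂ hρ₁ hρ₂)
    have e00 := he 0 0
    have e01 := he 0 1
    have e10 := he 1 0
    have e11 := he 1 1
    simp at e00 e01 e10 e11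
    have hv₁ : fibreDeriv ρ₁ p (e 1 - e 0) < 0 := by rw [map_sub, e00, e01]; norm_num
    have hv₂ : (-fibreDeriv ρ₂ p) (e 1 - e 0) < 0 := by
      rw [neg_apply, map_sub, e10, e11]; norm_num
    have t₁ := eventually_neg_of_hasFDerivAt (hasFDerivAt_fibre hρ₁.smooth p.1 p.2) h01 hv₁
    have t₂ := eventually_neg_of_hasFDerivAt (r := fun w => -ρ₂ (p.1, w))
      (hasFDerivAt_fibre hρ₂.smooth p.1 p.2).neg (by simp [h02]) hv₂
    have ht : Tendsto (fun t : ℝ => (p.1, p.2 + t • (e 1 - e 0))) (𝓝[>] 0) (𝓝 p) :=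
      tendsto_const_nhds.prodMk_nhds (tendsto_add_smul_nhdsGT p.2 _)
    refine mem_closure_of_tendsto ht ?_
    filter_upwards [t₁, t₂, ht.eventually (hWo₁.mem_nhds hpW₁), ht.eventually (hWo₂.mem_nhds hpW₂)]
      with t s₁ s₂ s₃ s₄
    refine ⟨(hW₁ _ s₃).2 s₁, fun hD => ?_⟩
    have := (hW₂ _ s₄).1 hD
    linarith
  · rw [mem_closure_iff]
    intro O hO hpO
    obtain ⟨q, ⟨hq1, hq2⟩, hq3⟩ := mem_closure_iff.1 (frontier_subset_closure hp₁)
      (O ∩ (closure D₂)ᶜ) (hO.inter isClosed_closure.isOpen_compl) ⟨hpO, hpc⟩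
    exact ⟨q, hq1, hq3, fun h' => hq2 (subset_closure h')⟩

end

end

section

variable {n : ℕ}

/-! ### The geometry of admissible cones and domains near a point -/

theorem ConeRelCompact.subset {V' V : Set (Cn n × Cn n)} (h : ConeRelCompact V' V)
    (hV : IsCone V) : V' ⊆ V := by
  obtain ⟨K, hK, rfl⟩ := h
  rintro p ⟨q, hq, t, ht, rfl⟩
  exact hV.smul_mem q (hK.2 (subset_closure hq)) t ht

theorem isOpen_base {V : Set (Cn n × Cn n)} (hV : IsOpen V) : IsOpen (base V) :=
  isOpenMap_fst V hV

/-- The real part of the exponent `⟨z' - z, ζ₀⟩`. -/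
def phase (ζ₀ : Cn n) (q : Cn n × Cn n) : ℝ := (pairing (q.2 - q.1) ζ₀).re

theorem contDiff_phase (ζ₀ : Cn n) : ContDiff ℝ ∞ (phase ζ₀) :=
  Complex.reCLM.contDiff.comp (contDiff_pairing (contDiff_snd.sub contDiff_fst) contDiff_const)

theorem continuous_phase (ζ₀ : Cn n) : Continuous (phase ζ₀) := (contDiff_phase ζ₀).continuous

/-- The complex conjugate vector. -/
def conjVec (v : Cn n) : Cn n := WithLp.toLp 2 fun i => (starRingEnd ℂ) (v i)

theorem pairing_conjVec (v : Cn n) : pairing v (conjVec v) = (‖v‖ ^ 2 : ℝ) := by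
  rw [EuclideanSpace.norm_sq_eq, pairing]
  push_cast
  refine Finset.sum_congr rfl fun i _ => ?_
  rw [conjVec]
  exact (Complex.mul_conj' _)

theorem pairing_comm (v ζ : Cn n) : pairing v ζ = pairing ζ v := by
  simp only [pairing, mul_comm]

theorem norm_conjVec (v : Cn n) : ‖conjVec v‖ = ‖v‖ := by
  simp [EuclideanSpace.norm_eq, conjVec]

theorem pairing_add_right (v ζ ξ : Cn n) : pairing v (ζ + ξ) = pairing v ζ + pairing v ξ := by
  rw [pairing_comm, pairing_add_left, pairing_comm ζ, pairing_comm ξ]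

/-- A polar vector of a neighbourhood of `ζ₀` pairs negatively with `ζ₀`. -/
theorem re_pairing_le_of_ball {ζ₀ v : Cn n} {δ : ℝ} (hδ : 0 < δ)
    (h : ∀ ζ ∈ Metric.ball ζ₀ δ, (pairing v ζ).re ≤ 0) :
    (pairing v ζ₀).re ≤ -(δ / 2) * ‖v‖ := by
  by_cases hv : v = 0
  · subst hv; simp [pairing]
  have hv' : 0 < ‖v‖ := norm_pos_iff.2 hv
  -- The test covector moves half the radius in the direction of the conjugate of v, where the real
  -- pairing with v increases fastest.
  have h1 := h (ζ₀ + (δ / 2 * ‖v‖⁻¹) • conjVec v) (by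
    rw [mem_ball_iff_norm, add_sub_cancel_left, norm_smul, norm_conjVec, Real.norm_of_nonneg
      (by positivity)]
    field_simp
    linarith)
  rw [pairing_add_right, pairing_smul_right, pairing_conjVec, Complex.add_re, ← Complex.ofReal_mul,
    Complex.ofReal_re] at h1
  have h2 : δ / 2 * ‖v‖⁻¹ * ‖v‖ ^ 2 = δ / 2 * ‖v‖ := by field_simp
  rw [h2] at h1
  linarith

/-- The zero vector is not interior to a fibre of the polar. -/
theorem zero_notMem_interior_polar {Γ : Set (Cn n × Cn n)} {z₀ ζ₀ : Cn n} (h : (z₀, ζ₀) ∈ Γ)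
    (hζ : ζ₀ ≠ 0) : (z₀, (0 : Cn n)) ∉ interior (polar Γ) := by
  intro h0
  -- These vectors tend to 0 and pair with ζ₀ to t|ζ₀|² > 0, so none of them lies in the polar.
  have h1 : Tendsto (fun t : ℝ => (z₀, (0 : Cn n) + t • conjVec ζ₀)) (𝓝[>] 0) (𝓝 (z₀, 0)) :=
    tendsto_const_nhds.prodMk_nhds (tendsto_add_smul_nhdsGT 0 _)
  obtain ⟨t, ht, ht0⟩ := ((h1.eventually (mem_interior_iff_mem_nhds.1 h0)).and
    self_mem_nhdsWithin).exists
  have h2 := ht.2 ζ₀ h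
  have ht0' : 0 < t := ht0
  simp only [zero_add] at h2
  rw [pairing_comm, pairing_smul_right, pairing_conjVec, ← Complex.ofReal_mul,
    Complex.ofReal_re] at h2
  have : 0 < ‖ζ₀‖ := norm_pos_iff.2 hζ
  exact absurd h2 (not_le.2 (by positivity))

/-- The data at a point `(z₀, ζ₀)` that the estimates of the integrals depend on: over the ball of
radius `r` about `z₀` the domain of integration is relatively compact in `U`, and the size of the
exponential is controlled on `D₂` and on `G`. -/
structure IsLocalFrame (U G D₁ D₂ : Set (Cn n × Cn n)) (z₀ ζ₀ : Cn n) (r c : ℝ) : Prop where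
  r_pos : 0 < r
  c_pos : 0 < c
  isOpen₁ : IsOpen D₁
  isOpen₂ : IsOpen D₂
  compact_D : IsCompact (closure (D₁ \ D₂) ∩ Prod.fst ⁻¹' Metric.closedBall z₀ r)
  closure_D : ∀ p ∈ closure (D₁ \ D₂), p.1 ∈ Metric.closedBall z₀ r → p ∈ U
  closure_E : ∀ p ∈ closure (frontier D₁ \ D₂), p.1 ∈ Metric.closedBall z₀ r →
    p ∈ closure (D₁ \ D₂) ∧ p ∉ G
  phase_D₂ : ∀ p ∈ closure D₂, p.1 ∈ Metric.closedBall z₀ r → phase ζ₀ p ≤ -(4 * c)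
  mem_of_G : ∀ p ∈ G, p ∈ U → p.1 ∈ Metric.closedBall z₀ r → p ∈ D₁ ∧ phase ζ₀ p ≤ 0
  chart : ∀ O : Set (Cn n × Cn n), IsOpen O → (∀ p ∈ O, p.1 ∈ Metric.ball z₀ r) →
    IsIntegrationChart D₁ D₂ O

theorem IsLocalFrame.mono {U G D₁ D₂ : Set (Cn n × Cn n)} {z₀ ζ₀ : Cn n} {r c r' c' : ℝ}
    (h : IsLocalFrame U G D₁ D₂ z₀ ζ₀ r c) (hr' : 0 < r') (hc' : 0 < c') (hr : r' ≤ r)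
    (hc : c' ≤ c) : IsLocalFrame U G D₁ D₂ z₀ ζ₀ r' c' := by
  have hb := Metric.closedBall_subset_closedBall (x := z₀) hr
  exact {
    r_pos := hr'
    c_pos := hc'
    isOpen₁ := h.isOpen₁
    isOpen₂ := h.isOpen₂
    compact_D := h.compact_D.of_isClosed_subset
      (isClosed_closure.inter (Metric.isClosed_closedBall.preimage continuous_fst))
      (inter_subset_inter_right _ (preimage_mono hb))
    closure_D := fun p hp hp' => h.closure_D p hp (hb hp')
    closure_E := fun p hp hp' => h.closure_E p hp (hb hp')
    phase_D₂ := fun p hp hp' => (h.phase_D₂ p hp (hb hp')).trans (by linarith)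
    mem_of_G := fun p hp hU hp' => h.mem_of_G p hp hU (hb hp')
    chart := fun O hO hp => h.chart O hO fun p hp' => Metric.ball_subset_ball hr (hp p hp') }

theorem rho_injective : Function.Injective (rho (n := n)) := by
  rintro ⟨a, b⟩ ⟨a', b'⟩ h
  simp only [rho, Prod.mk.injEq] at h
  obtain ⟨rfl, h⟩ := h
  simpa using h

/-- The diagonal point corresponds to the zero vector, and stability under addition of the polar
puts 0 + v into the domain. Applied to D₁ and G, it places G inside D₁. -/
theorem mem_of_rho_mem_polar {Γ D : Set (Cn n × Cn n)} (h : IsGammaOpen (polar Γ) (rho '' D))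
    {z w : Cn n} (hz : (z, z) ∈ D) (hw : rho (z, w) ∈ polar Γ) : (z, w) ∈ D := by
  have h1 : (z, w - z) ∈ fibreSum (rho '' D) (polar Γ) :=
    Or.inr ⟨0, ⟨(z, z), hz, by simp [rho]⟩, w - z, hw, by simp⟩
  rw [h.2] at h1
  obtain ⟨q, hq, he⟩ := h1
  rwa [rho_injective (he.trans (show (z, w - z) = rho (z, w) from rfl))] at hq

section

variable {V V' U G Γ₁ Γ₂ D₁ D₂ : Set (Cn n × Cn n)}

theorem closure_inter_fst_subset {A : Set (Cn n × Cn n)} {O : Set (Cn n)} (hO : IsOpen O)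
    {p : Cn n × Cn n} (hp : p ∈ closure A) (hpO : p.1 ∈ O) :
    p ∈ closure (A ∩ Prod.fst ⁻¹' O) := by
  rw [mem_closure_iff]
  intro N hN hpN
  obtain ⟨q, ⟨hq1, hq2⟩, hq3⟩ := mem_closure_iff.1 hp (N ∩ Prod.fst ⁻¹' O)
    (hN.inter (hO.preimage continuous_fst)) ⟨hpN, hpO⟩
  exact ⟨q, hq1, hq3, hq2⟩

/-- V' contains a product neighbourhood of the point, so polarity yields phase ≤ -(δ/2)|z' - z|
uniformly for z near the centre. Over such z the closure of D₂ stays at distance at least r from the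
diagonal, and the choice c = δr/8 turns this into phase ≤ -4c. -/
theorem exists_isLocalFrame (hV' : IsOpenConvexProperCone V')
    (hc : AdmissibleCones V V' U G Γ₁ Γ₂) (hd : AdmissibleDomains V' U G Γ₁ Γ₂ D₁ D₂)
    {p : Cn n × Cn n} (hp : p ∈ V') : ∃ r c, IsLocalFrame U G D₁ D₂ p.1 p.2 r c := by
  have hn : 0 < n := by
    -- In dimension 0 there are no nonzero covectors, so V' is empty; positivity of n keeps 2n - 1
    -- from being truncated.
    rcases Nat.eq_zero_or_pos n with rfl | h
    · exact absurd (Subsingleton.elim _ _) (hV'.isCone.ne_zero p hp)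
    · exact h
  have hb := isOpen_base hV'.isOpen
  have hζ := hV'.isCone.ne_zero p hp
  have hpb : p.1 ∈ base V' := ⟨p, hp, rfl⟩
  have hV2 := hc.sub₂.subset hc.cone₂.isCone
  have hV1 := hV2.trans (hc.sub₁₂.subset hc.cone₁.isCone)
  obtain ⟨r₁, hr₁, hr₁b⟩ := Metric.isOpen_iff.1 hb _ hpb
  obtain ⟨δ, hδ, hδV⟩ := Metric.isOpen_iff.1 hV'.isOpen p hp
  have hpc : (p.1, p.1) ∉ closure D₂ := fun h => by
    have := hd.closure₂ _ h hpb
    simp only [rho, sub_self] at this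
    exact zero_notMem_interior_polar (hV2 hp) hζ this
  obtain ⟨s, hs, hsD⟩ := Metric.isOpen_iff.1 isClosed_closure.isOpen_compl _ hpc
  -- 2r < r₁ leaves a larger compact ball inside the base, r < δ keeps the product neighbourhood in
  -- V', and 2r < s makes a pair with both z near the centre and |z' - z| < r avoid the closure of
  -- D₂.
  obtain ⟨r, hr, hrr₁, hrδ, hrs⟩ : ∃ r, 0 < r ∧ 2 * r < r₁ ∧ r < δ ∧ 2 * r < s :=
    ⟨min r₁ (min δ s) / 4, by positivity, by
      have := min_le_left r₁ (min δ s); have : 0 < min r₁ (min δ s) := by positivity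
      linarith, by
      have := (min_le_right r₁ (min δ s)).trans (min_le_left _ _)
      have : 0 < min r₁ (min δ s) := by positivity
      linarith, by
      have := (min_le_right r₁ (min δ s)).trans (min_le_right _ _)
      have : 0 < min r₁ (min δ s) := by positivity
      linarith⟩
  have hball : Metric.closedBall p.1 r ⊆ base V' :=
    (Metric.closedBall_subset_ball (by linarith)).trans hr₁b
  have hball2 : Metric.closedBall p.1 (2 * r) ⊆ base V' :=
    (Metric.closedBall_subset_ball (by linarith)).trans hr₁b
  have hmem : ∀ z ∈ Metric.closedBall p.1 r, ∀ ζ ∈ Metric.ball p.2 δ, (z, ζ) ∈ V' := by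
    intro z hz ζ hζ'
    refine hδV ?_
    rw [Metric.mem_ball, Prod.dist_eq]
    exact max_lt (lt_of_le_of_lt hz hrδ) hζ'
  have hneg : ∀ q : Cn n × Cn n, q.1 ∈ Metric.closedBall p.1 r →
      (∀ ζ, (q.1, ζ) ∈ V' → (pairing (q.2 - q.1) ζ).re ≤ 0) →
      phase p.2 q ≤ -(δ / 2) * ‖q.2 - q.1‖ := fun q hq h =>
    re_pairing_le_of_ball hδ fun ζ hζ' => h ζ (hmem _ hq _ hζ')
  have hneg₂ : ∀ q ∈ closure D₂, q.1 ∈ Metric.closedBall p.1 r →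
      phase p.2 q ≤ -(δ / 2) * ‖q.2 - q.1‖ := fun q hq hq1 =>
    hneg q hq1 fun ζ h => (interior_subset (hd.closure₂ q hq (hball hq1))).2 ζ (hV2 h)
  refine ⟨r, δ * r / 8, {
    r_pos := hr
    c_pos := by positivity
    isOpen₁ := hd.isOpen₁
    isOpen₂ := hd.isOpen₂
    compact_D := ?_
    closure_D := fun q hq hq1 => hd.closure_D q hq (hball hq1)
    closure_E := fun q hq hq1 => ⟨?_, (hd.closure_E q hq (hball hq1)).2⟩
    phase_D₂ := fun q hq hq1 => (hneg₂ q hq hq1).trans ?_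
    mem_of_G := fun q hq hqU hq1 => ?_
    chart := fun O hO h =>
      hd.isIntegrationChart hn hO fun q hq => hball (Metric.ball_subset_closedBall (h q hq)) }⟩
  · refine Metric.isCompact_of_isClosed_isBounded (isClosed_closure.inter
      (Metric.isClosed_closedBall.preimage continuous_fst)) ?_
    -- Points of the closure over the ball of radius r may be limits of points lying slightly
    -- outside it, hence the boundedness over the ball of radius 2r.
    refine (hd.bounded _ (isCompact_closedBall p.1 (2 * r)) hball2).closure.subset ?_
    rintro q ⟨hq, hq1⟩
    refine closure_mono (inter_subset_inter_right _ (preimage_mono Metric.ball_subset_closedBall))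
      (closure_inter_fst_subset (Metric.isOpen_ball (x := p.1) (ε := 2 * r)) hq ?_)
    exact Metric.closedBall_subset_ball (by linarith) hq1
  -- The surface is controlled only over the base of V'; that base is open, so the closure may be
  -- formed from points over it.
  · have h1 := closure_inter_fst_subset hb hq (hball hq1)
    refine closure_minimal ?_ isClosed_closure h1
    rintro x ⟨⟨hx1, hx2⟩, hx3⟩
    exact hd.surface_subset_closure hx3 hx1 hx2
  · have h1 : r ≤ ‖q.2 - q.1‖ := by
      by_contra h
      push Not at h
      refine hsD (a := q) ?_ hq
      rw [Metric.mem_ball, Prod.dist_eq]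
      refine max_lt (lt_of_le_of_lt hq1 (by linarith)) ?_
      calc dist q.2 p.1 ≤ dist q.2 q.1 + dist q.1 p.1 := dist_triangle _ _ _
        _ < r + r := by
          refine add_lt_add_of_lt_of_le ?_ hq1
          rwa [dist_eq_norm]
        _ < s := by linarith
    nlinarith
  · rcases hc.support q ⟨hq, hqU⟩ (hball hq1) with h | h
    · have h' := interior_subset h
      refine ⟨mem_of_rho_mem_polar hd.gammaOpen₁ (hd.diag_mem _ (hball hq1)) h', ?_⟩
      refine (hneg q hq1 fun ζ hζ' => h'.2 ζ (hV1 hζ')).trans ?_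
      have := norm_nonneg (q.2 - q.1)
      nlinarith
    · have he : q = (q.1, q.1) := Prod.ext rfl h
      refine ⟨by rw [he]; exact hd.diag_mem _ (hball hq1), ?_⟩
      simp [phase, h, pairing]

end

end

section

variable {n : ℕ}

/-! ### The operators `∂/∂z̄` -/

section dbarDir

variable {v w p : Cn n × Cn n} {f g : Cn n × Cn n → ℂ}

theorem dbarDir_congr (h : f =ᶠ[𝓝 p] g) (v : Cn n × Cn n) : dbarDir v f p = dbarDir v g p := by
  simp only [dbarDir, h.fderiv_eq]

theorem dbarDir_sub (hf : DifferentiableAt ℝ f p) (hg : DifferentiableAt ℝ g p) :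
    dbarDir v (fun q => f q - g q) p = dbarDir v f p - dbarDir v g p := by
  simp only [dbarDir, fderiv_fun_sub hf hg, sub_apply]
  ring

theorem dbarDir_const_mul (c : ℂ) (hf : DifferentiableAt ℝ f p) :
    dbarDir v (fun q => c * f q) p = c * dbarDir v f p := by
  simp only [dbarDir, fderiv_const_mul hf c, smul_apply, smul_eq_mul]
  ring

theorem dbarDir_mul (hf : DifferentiableAt ℝ f p) (hg : DifferentiableAt ℝ g p) :
    dbarDir v (fun q => f q * g q) p = f p * dbarDir v g p + dbarDir v f p * g p := by
  simp only [dbarDir, fderiv_fun_mul hf hg, add_apply, smul_apply, smul_eq_mul]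
  ring

theorem dbarDir_sum {ι : Type*} {s : Finset ι} {f : ι → Cn n × Cn n → ℂ}
    (hf : ∀ i ∈ s, DifferentiableAt ℝ (f i) p) :
    dbarDir v (fun q => ∑ i ∈ s, f i q) p = ∑ i ∈ s, dbarDir v (f i) p := by
  simp only [dbarDir, fderiv_fun_sum hf, FunLike.coe_sum, Finset.sum_apply, Finset.mul_sum,
    ← Finset.sum_add_distrib]

theorem dbarDir_eq_zero_of_holomorphic (hf : DifferentiableAt ℂ f p) : dbarDir v f p = 0 := by
  have h1 := hf.hasFDerivAt.restrictScalars ℝ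
  rw [dbarDir, h1.fderiv]
  simp only [ContinuousLinearMap.coe_restrictScalars', map_smul, smul_eq_mul]
  rw [← mul_assoc, Complex.I_mul_I]
  ring

theorem contDiffOn_dbarDir {R : Set (Cn n × Cn n)} (hR : IsOpen R) (hf : ContDiffOn ℝ ∞ f R)
    (v : Cn n × Cn n) : ContDiffOn ℝ ∞ (dbarDir v f) R := by
  have h := hf.fderiv_of_isOpen hR (m := ∞) (by simp)
  exact contDiffOn_const.mul ((h.clm_apply contDiffOn_const).add
    (contDiffOn_const.mul (h.clm_apply contDiffOn_const)))

theorem contDiff_dbarDir (hf : ContDiff ℝ ∞ f) (v : Cn n × Cn n) : ContDiff ℝ ∞ (dbarDir v f) :=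
  contDiffOn_univ.1 (contDiffOn_dbarDir isOpen_univ hf.contDiffOn v)

/-- Both sides are complex combinations of second real derivatives, which are symmetric. -/
theorem dbarDir_comm (hf : ContDiffAt ℝ ∞ f p) :
    dbarDir v (dbarDir w f) p = dbarDir w (dbarDir v f) p := by
  have hsymm : ∀ a b, fderiv ℝ (fderiv ℝ f) p a b = fderiv ℝ (fderiv ℝ f) p b a :=
    (hf.isSymmSndFDerivAt (by
      simpa using (WithTop.coe_le_coe.2 le_top : ((2 : ℕ∞) : WithTop ℕ∞) ≤ ((⊤ : ℕ∞) : WithTop ℕ∞)))).eq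
  have hd : DifferentiableAt ℝ (fderiv ℝ f) p :=
    (hf.fderiv_right (m := ∞) (by simp)).differentiableAt (by simp)
  have key : ∀ a b, fderiv ℝ (dbarDir b f) p a =
      (1 / 2) * (fderiv ℝ (fderiv ℝ f) p a b + Complex.I * fderiv ℝ (fderiv ℝ f) p a
        (Complex.I • b)) := by
    intro a b
    have h1 : ∀ c, HasFDerivAt (fun q => fderiv ℝ f q c)
        ((fderiv ℝ (fderiv ℝ f) p).flip c) p := fun c => by
      simpa using hd.hasFDerivAt.clm_apply (hasFDerivAt_const c p)
    have h2 := ((h1 b).fun_add ((h1 (Complex.I • b)).const_mul Complex.I)).const_mul (1 / 2 : ℂ)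
    have h3 : fderiv ℝ (dbarDir b f) p = _ := h2.fderiv
    rw [h3]
    simp
    ring
  rw [dbarDir, dbarDir, key, key, key, key, hsymm v w, hsymm v (Complex.I • w),
    hsymm (Complex.I • v) w, hsymm (Complex.I • v) (Complex.I • w)]
  ring

end dbarDir

theorem dbarDir_kernel (ζ : Cn n) (v q : Cn n × Cn n) :
    dbarDir v (fun q => Complex.exp (pairing (q.2 - q.1) ζ)) q = 0 := by
  refine dbarDir_eq_zero_of_holomorphic (DifferentiableAt.cexp ?_)
  simp only [pairing]
  fun_prop

/-- The exponential is holomorphic in z and z' jointly, so antiholomorphic derivatives act on the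
amplitude alone. Integrations by parts therefore never produce powers of ζ. -/
theorem dbarDir_kernelMul {F : Cn n × Cn n → ℂ} (hF : ContDiff ℝ ∞ F) (ζ : Cn n)
    (v q : Cn n × Cn n) : dbarDir v (kernelMul F ζ) q = kernelMul (dbarDir v F) ζ q := by
  have := dbarDir_mul (v := v) (hF.differentiable (by simp) q)
    ((contDiff_kernel ζ).differentiable (by simp) q)
  rw [dbarDir_kernel, mul_zero, zero_add] at this
  exact this

/-! ### The Dolbeault operator in coefficients -/

theorem card_fibreIdx : (fibreIdx n).card = n := by
  rw [fibreIdx, Finset.card_image_of_injective]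
  · simp
  · intro a b h
    simpa using h

theorem inr_mem_fibreIdx (k : Fin n) : (toLex (Sum.inr k) : Idx n) ∈ fibreIdx n := by
  simp [fibreIdx]

theorem inl_notMem_fibreIdx (i : Fin n) : (toLex (Sum.inl i) : Idx n) ∉ fibreIdx n := by
  simp [fibreIdx]

theorem sum_fibreIdx (f : Idx n → ℂ) :
    ∑ k ∈ fibreIdx n, f k = ∑ k : Fin n, f (toLex (Sum.inr k)) := by
  rw [fibreIdx, Finset.sum_image]
  intro a _ b _ h
  simpa using h

theorem card_filter_fibreIdx (k : Fin n) :
    ((fibreIdx n).filter (· < toLex (Sum.inr k))).card = k := by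
  rw [fibreIdx, Finset.filter_image, Finset.card_image_of_injective]
  · simp [Finset.filter_gt_eq_Iio]
  · intro a b h
    simpa using h

/-- The signs obtained by sorting are exactly those in `density01`, which is what lets ∂̄ along the
fibre cancel the surface integral. -/
theorem dbar_fibreIdx (f : Coeffs n) (p : Cn n × Cn n) :
    dbar f (fibreIdx n) p = ∑ k : Fin n, (-1) ^ (n + (k : ℕ)) *
      dbarDir (dir (toLex (Sum.inr k))) (f ((fibreIdx n).erase (toLex (Sum.inr k)))) p := by
  rw [dbar, sum_fibreIdx, Finset.mul_sum]
  refine Finset.sum_congr rfl fun k _ => ?_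
  rw [card_filter_fibreIdx, pow_add, mul_assoc]

/-- Removing the smaller index lowers the position of the larger by one, while removing the larger
does not affect the smaller. The two orders of removal thus have opposite signs. -/
theorem neg_one_pow_card_filter_swap {K : Finset (Idx n)} {k l : Idx n} (hk : k ∈ K)
    (hl : l ∈ K) (hkl : k ≠ l) :
    (-1 : ℂ) ^ (K.filter (· < k)).card * (-1) ^ ((K.erase k).filter (· < l)).card +
      (-1) ^ (K.filter (· < l)).card * (-1) ^ ((K.erase l).filter (· < k)).card = 0 := by
  wlog h : k < l generalizing k l
  · have := this hl hk hkl.symm (lt_of_le_of_ne (not_lt.1 h) hkl.symm)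
    rw [add_comm]
    exact this
  have h1 : (K.erase l).filter (· < k) = K.filter (· < k) := by
    ext x
    simp only [Finset.mem_filter, Finset.mem_erase]
    constructor
    · rintro ⟨⟨_, h1⟩, h2⟩; exact ⟨h1, h2⟩
    · rintro ⟨h1, h2⟩; exact ⟨⟨(h2.trans h).ne, h1⟩, h2⟩
  have h2 : (K.erase k).filter (· < l) = (K.filter (· < l)).erase k := by
    ext x
    simp only [Finset.mem_filter, Finset.mem_erase]
    tauto
  have h3 : k ∈ K.filter (· < l) := Finset.mem_filter.2 ⟨hk, h⟩
  have h4 := Finset.card_erase_add_one h3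
  rw [h1, h2, ← h4, pow_succ]
  ring

/-- The term for (k, l) cancels the one for (l, k): opposite signs, equal mixed derivatives. -/
theorem dbar_dbar {R : Set (Cn n × Cn n)} (hR : IsOpen R) {f : Coeffs n} {r : ℤ}
    (hf : ∀ K : Finset (Idx n), (K.card : ℤ) = r → ContDiffOn ℝ ∞ (f K) R)
    {K : Finset (Idx n)} (hK : (K.card : ℤ) = r + 2) {p : Cn n × Cn n} (hp : p ∈ R) :
    dbar (dbar f) K p = 0 := by
  have hcard : ∀ k ∈ K, ∀ l ∈ K.erase k, (((K.erase k).erase l).card : ℤ) = r := by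
    intro k hk l hl
    have h1 := Finset.card_erase_add_one hk
    have h2 := Finset.card_erase_add_one hl
    push_cast [← h1, ← h2] at hK
    linarith
  have hat : ∀ k ∈ K, ∀ l ∈ K.erase k, ContDiffAt ℝ ∞ (f ((K.erase k).erase l)) p :=
    fun k hk l hl => (hf _ (hcard k hk l hl)).contDiffAt (hR.mem_nhds hp)
  have hdat : ∀ k ∈ K, ∀ l ∈ K.erase k,
      DifferentiableAt ℝ (dbarDir (dir l) (f ((K.erase k).erase l))) p := fun k hk l hl =>
    ((contDiffOn_dbarDir hR (hf _ (hcard k hk l hl)) _).contDiffAt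
      (hR.mem_nhds hp)).differentiableAt (by simp)
  have h1 : ∀ k ∈ K, dbarDir (dir k) (dbar f (K.erase k)) p =
      (-1) ^ n * ∑ l ∈ K.erase k, (-1) ^ ((K.erase k).filter (· < l)).card *
        dbarDir (dir k) (dbarDir (dir l) (f ((K.erase k).erase l))) p := by
    intro k hk
    have e : dbar f (K.erase k) = fun q => (-1) ^ n * ∑ l ∈ K.erase k,
      (-1) ^ ((K.erase k).filter (· < l)).card * dbarDir (dir l) (f ((K.erase k).erase l)) q := rfl
    rw [e, dbarDir_const_mul, dbarDir_sum]
    · congr 1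
      exact Finset.sum_congr rfl fun l hl => dbarDir_const_mul _ (hdat k hk l hl)
    · exact fun l hl => (hdat k hk l hl).const_mul _
    · exact DifferentiableAt.fun_sum fun l hl => (hdat k hk l hl).const_mul _
  rw [dbar, Finset.sum_congr rfl fun k hk => by rw [h1 k hk]]
  simp_rw [Finset.mul_sum]
  rw [Finset.sum_sigma']
  refine Finset.sum_involution (fun x _ => ⟨x.2, x.1⟩) ?_ ?_ ?_ ?_
  · rintro ⟨k, l⟩ hx
    simp only [Finset.mem_sigma] at hx
    obtain ⟨hk, hl⟩ := hx
    obtain ⟨hlk, hlK⟩ := Finset.mem_erase.1 hl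
    have hs := neg_one_pow_card_filter_swap hk hlK hlk.symm
    simp only
    rw [dbarDir_comm (v := dir l) (f := f ((K.erase l).erase k))
      (by rw [Finset.erase_right_comm]; exact hat k hk l hl),
      Finset.erase_right_comm (a := l) (b := k)]
    linear_combination ((-1) ^ n * (-1) ^ n *
      dbarDir (dir k) (dbarDir (dir l) (f ((K.erase k).erase l))) p) * hs
  · rintro ⟨k, l⟩ hx _ he
    simp only [Finset.mem_sigma] at hx
    have := (Finset.mem_erase.1 hx.2).1
    simp only [Sigma.mk.injEq] at he
    exact this he.1
  · rintro ⟨k, l⟩ hx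
    simp only [Finset.mem_sigma] at hx ⊢
    obtain ⟨hlk, hlK⟩ := Finset.mem_erase.1 hx.2
    exact ⟨hlK, Finset.mem_erase.2 ⟨hlk.symm, hx.1⟩⟩
  · rintro ⟨k, l⟩ hx
    rfl

/-- If the component of `∂̄f` at `dz̄ᵢ ∧ ⋀ₖ dz̄'ₖ` vanishes, the derivative in `z̄ᵢ` of the fibre
component of `f` is a divergence along the fibre. -/
theorem exists_divergence_of_dbar_eq_zero (i : Fin n) : ∃ (c : Fin n → ℂ) (J : Fin n → Finset (Idx n)),
    (∀ k, (J k).card = n) ∧ ∀ (f : Coeffs n) (p : Cn n × Cn n),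
      dbar f (insert (toLex (Sum.inl i)) (fibreIdx n)) p = 0 →
      dbarDir (dir (toLex (Sum.inl i))) (f (fibreIdx n)) p =
        ∑ k : Fin n, c k * dbarDir (dir (toLex (Sum.inr k))) (f (J k)) p := by
  set K := insert (toLex (Sum.inl i)) (fibreIdx n)
  have hcK : K.card = n + 1 := by
    rw [Finset.card_insert_of_notMem (inl_notMem_fibreIdx i), card_fibreIdx]
  set s : Idx n → ℂ := fun k => (-1) ^ (K.filter (· < k)).card
  have hs : ∀ k, s k ≠ 0 := fun k => pow_ne_zero _ (by norm_num)
  refine ⟨fun k => -(s (toLex (Sum.inl i)))⁻¹ * s (toLex (Sum.inr k)),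
    fun k => K.erase (toLex (Sum.inr k)), fun k => ?_, fun f p h => ?_⟩
  · rw [Finset.card_erase_of_mem (Finset.mem_insert_of_mem (inr_mem_fibreIdx k)), hcK]
    rfl
  · have h1 : (-1 : ℂ) ^ n ≠ 0 := pow_ne_zero _ (by norm_num)
    rw [dbar, mul_eq_zero, or_iff_right h1, Finset.sum_insert (inl_notMem_fibreIdx i),
      Finset.erase_insert (inl_notMem_fibreIdx i), sum_fibreIdx] at h
    change s (toLex (Sum.inl i)) * _ + ∑ k : Fin n, s (toLex (Sum.inr k)) *
      dbarDir (dir (toLex (Sum.inr k))) (f (K.erase (toLex (Sum.inr k)))) p = 0 at h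
    simp_rw [mul_assoc]
    rw [← Finset.mul_sum]
    have h2 := hs (toLex (Sum.inl i))
    rw [← mul_right_inj' h2, eq_neg_of_add_eq_zero_left h]
    field_simp

end

section

variable {n : ℕ}

/-! ### Cutting off -/

/-- A smooth function of the phase that is `0` for phase at most `a` and `1` for phase at least
`b`. -/
def ramp (ζ₀ : Cn n) (a b : ℝ) (q : Cn n × Cn n) : ℂ :=
  (Real.smoothTransition ((phase ζ₀ q - a) / (b - a)) : ℝ)

section ramp

variable {ζ₀ : Cn n} {a b : ℝ} {q : Cn n × Cn n}

theorem contDiff_ramp (ζ₀ : Cn n) (a b : ℝ) : ContDiff ℝ ∞ (ramp ζ₀ a b) :=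
  Complex.ofRealCLM.contDiff.comp (Real.smoothTransition.contDiff.comp
    (((contDiff_phase ζ₀).sub contDiff_const).div_const _))

theorem ramp_eq_zero (hab : a < b) (hq : phase ζ₀ q ≤ a) : ramp ζ₀ a b q = 0 := by
  rw [ramp, Real.smoothTransition.zero_of_nonpos, Complex.ofReal_zero]
  exact div_nonpos_of_nonpos_of_nonneg (by linarith) (by linarith)

theorem ramp_eq_one (hab : a < b) (hq : b ≤ phase ζ₀ q) : ramp ζ₀ a b q = 1 := by
  rw [ramp, Real.smoothTransition.one_of_one_le, Complex.ofReal_one]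
  rw [le_div_iff₀ (by linarith)]
  linarith

theorem ramp_eventually_eq_one (hab : a < b) (hq : b < phase ζ₀ q) :
    ∀ᶠ q' in 𝓝 q, ramp ζ₀ a b q' = 1 := by
  filter_upwards [(continuous_phase ζ₀).continuousAt.eventually (lt_mem_nhds hq)] with q' h
  exact ramp_eq_one hab h.le

theorem ramp_eventually_eq_zero (hab : a < b) (hq : phase ζ₀ q < a) :
    ∀ᶠ q' in 𝓝 q, ramp ζ₀ a b q' = 0 := by
  filter_upwards [(continuous_phase ζ₀).continuousAt.eventually (gt_mem_nhds hq)] with q' h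
  exact ramp_eq_zero hab h.le

end ramp

theorem tsupport_subset_phase_le {F : Cn n × Cn n → ℂ} {ζ₀ : Cn n} {a : ℝ}
    (h : ∀ q, F q ≠ 0 → phase ζ₀ q ≤ a) : ∀ q ∈ tsupport F, (pairing (q.2 - q.1) ζ₀).re ≤ a :=
  fun _ hq => closure_minimal h (isClosed_le (continuous_phase ζ₀) continuous_const) hq

/-- A smooth function on an open set coincides near a closed set, over a neighbourhood of `z₀`,
with a compactly supported smooth function. -/
theorem exists_local_extension {S T : Set (Cn n × Cn n)} (hT : IsOpen T) {z₀ : Cn n} {r : ℝ}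
    (hr : 0 < r) (hc : IsCompact (S ∩ Prod.fst ⁻¹' Metric.closedBall z₀ r))
    (hST : ∀ p ∈ S, p.1 ∈ Metric.closedBall z₀ r → p ∈ T) {f : Cn n × Cn n → ℂ}
    (hf : ContDiffOn ℝ ∞ f (T ∩ Prod.fst ⁻¹' Metric.ball z₀ r)) :
    ∃ A : Cn n × Cn n → ℂ, ContDiff ℝ ∞ A ∧ HasCompactSupport A ∧
      tsupport A ⊆ Prod.fst ⁻¹' Metric.ball z₀ r ∧ (∀ q, f q = 0 → A q = 0) ∧
      ∀ᶠ z in 𝓝 z₀, ∀ w, (z, w) ∈ S → A =ᶠ[𝓝 (z, w)] f := by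
  -- θ truncates to a compact part of T and β to the ball about z₀. Both are 1 near the points of S
  -- over a neighbourhood of z₀, so the germs of f there are unchanged.
  obtain ⟨θ, hθ, hθc, hθT, hθ1⟩ := exists_contDiff_cutoff hc hT fun p hp => hST p hp.1 hp.2
  obtain ⟨β, hβ, hβc, hβT, hβ1⟩ := exists_contDiff_cutoff (isCompact_singleton (x := z₀))
    (Metric.isOpen_ball (x := z₀) (ε := r)) (by simpa using hr)
  rw [nhdsSet_singleton] at hβ1
  set A : Cn n × Cn n → ℂ := fun q => ((θ q * β q.1 : ℝ) : ℂ) * f q with hA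
  have hbo : IsOpen (Prod.fst ⁻¹' Metric.ball z₀ r : Set (Cn n × Cn n)) :=
    Metric.isOpen_ball.preimage continuous_fst
  have hK : IsClosed (tsupport θ ∩ Prod.fst ⁻¹' tsupport β) :=
    (isClosed_tsupport θ).inter ((isClosed_tsupport β).preimage continuous_fst)
  have hA0 : ∀ q ∉ tsupport θ ∩ Prod.fst ⁻¹' tsupport β, A q = 0 := by
    intro q hq
    by_cases h1 : q ∈ tsupport θ
    · have h2 : β q.1 = 0 := image_eq_zero_of_notMem_tsupport fun h => hq ⟨h1, h⟩
      simp [hA, h2]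
    · simp [hA, image_eq_zero_of_notMem_tsupport h1]
  have hAt := tsupport_subset_of_eq_zero_off hK hA0
  refine ⟨A, ?_, ?_, ?_, fun q hq => by simp [hA, hq], ?_⟩
  · refine contDiff_of_eq_zero_off (hT.inter hbo) hK (inter_subset_inter hθT (preimage_mono hβT))
      ?_ hA0
    exact (Complex.ofRealCLM.contDiff.comp (hθ.mul (hβ.comp contDiff_fst))).contDiffOn.mul hf
  · exact hθc.mono' ((subset_tsupport _).trans (hAt.trans inter_subset_left))
  · exact hAt.trans (inter_subset_right.trans (preimage_mono hβT))
  · filter_upwards [eventually_eventually_nhds.2 hβ1, Metric.closedBall_mem_nhds z₀ hr]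
      with z hz hzr w hw
    have h1 : ∀ᶠ q in 𝓝 (z, w), θ q = 1 :=
      (eventually_nhdsSet_iff_forall.1 hθ1) _ ⟨hw, hzr⟩
    have h2 : ∀ᶠ q : Cn n × Cn n in 𝓝 (z, w), β q.1 = 1 :=
      (continuous_fst.tendsto (z, w)).eventually hz
    filter_upwards [h1, h2] with q hq1 hq2
    simp [hA, hq1, hq2]

/-- A phase bound over a neighbourhood of the base point suffices: multiplication by a cut-off in z
makes it global without changing the integral near that point. -/
theorem isLocOsc_integral_kernelMul {F : Cn n × Cn n → ℂ} (hF : ContDiff ℝ ∞ F)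
    (hc : HasCompactSupport F) {p₀ : Cn n × Cn n} {a : ℝ}
    (h : ∀ᶠ z in 𝓝 p₀.1, ∀ w, F (z, w) ≠ 0 → phase p₀.2 (z, w) ≤ a) :
    IsLocOsc p₀ a (fun p => ∫ w, kernelMul F p.2 (p.1, w)) := by
  obtain ⟨T, hT, hTo, hp⟩ := eventually_nhds_iff.1 h
  obtain ⟨β, hβ, hβc, hβT, hβ1⟩ := exists_contDiff_cutoff (isCompact_singleton (x := p₀.1))
    hTo (by simpa using hp)
  rw [nhdsSet_singleton] at hβ1
  refine ⟨_, isOsc_integral_kernelMul (F := fun q => (β q.1 : ℂ) * F q)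
    ((Complex.ofRealCLM.contDiff.comp (hβ.comp contDiff_fst)).mul hF) hc.mul_left
    (tsupport_subset_phase_le fun q hq => hT q.1 (hβT ?_) q.2 (right_ne_zero_of_mul hq)), ?_⟩
  · refine subset_tsupport _ fun h0 => left_ne_zero_of_mul hq ?_
    rw [h0, Complex.ofReal_zero]
  · filter_upwards [hβ1] with z hz ζ
    simp [kernelMul, hz]

/-! ### Functions on a region that vanish off the support of a cut-off function -/

/-- `f` is smooth on `R` and vanishes there off `L`. -/
structure IsSupportedOn (R L : Set (Cn n × Cn n)) (f : Cn n × Cn n → ℂ) : Prop where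
  smooth : ContDiffOn ℝ ∞ f R
  eq_zero : ∀ q ∈ R, q ∉ L → f q = 0

/-- The product `χ f`, extended by zero off `L`. -/
def cut (L : Set (Cn n × Cn n)) (χ f : Cn n × Cn n → ℂ) : Cn n × Cn n → ℂ :=
  L.indicator fun q => χ q * f q

section cut

variable {R L : Set (Cn n × Cn n)} {χ f : Cn n × Cn n → ℂ}

theorem IsSupportedOn.dbarDir (hR : IsOpen R) (hL : IsClosed L) (hf : IsSupportedOn R L f)
    (v : Cn n × Cn n) : IsSupportedOn R L (dbarDir v f) := by
  refine ⟨contDiffOn_dbarDir hR hf.smooth v, fun q hq hqL => ?_⟩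
  have : f =ᶠ[𝓝 q] fun _ => 0 := by
    filter_upwards [hR.mem_nhds hq, hL.isOpen_compl.mem_nhds hqL] with q' h1 h2
    exact hf.eq_zero q' h1 h2
  rw [dbarDir_congr this]
  simp [CDSymbol.dbarDir]

theorem cut_eq_of_mem (hf : IsSupportedOn R L f) {q : Cn n × Cn n} (hq : q ∈ R) :
    cut L χ f q = χ q * f q := by
  by_cases h : q ∈ L
  · rw [cut, indicator_of_mem h]
  · rw [cut, indicator_of_notMem h, hf.eq_zero q hq h, mul_zero]

theorem cut_eq_zero {q : Cn n × Cn n} (hq : q ∉ L ∩ tsupport χ) : cut L χ f q = 0 := by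
  by_cases h : q ∈ L
  · rw [cut, indicator_of_mem h, image_eq_zero_of_notMem_tsupport fun h' => hq ⟨h, h'⟩, zero_mul]
  · rw [cut, indicator_of_notMem h]

theorem cut_eq_zero_of_eq_zero {q : Cn n × Cn n} (hq : χ q = 0) : cut L χ f q = 0 := by
  by_cases h : q ∈ L
  · rw [cut, indicator_of_mem h, hq, zero_mul]
  · rw [cut, indicator_of_notMem h]

theorem mem_of_cut_ne_zero {q : Cn n × Cn n} (hq : cut L χ f q ≠ 0) : q ∈ L := by
  by_contra h
  exact hq (by rw [cut, indicator_of_notMem h])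

/-- The form is known only on R, but the product is supported in a closed set contained in R and
extends by zero. -/
theorem contDiff_cut (hR : IsOpen R) (hL : IsClosed L) (hχ : ContDiff ℝ ∞ χ)
    (hLχ : L ∩ tsupport χ ⊆ R) (hf : IsSupportedOn R L f) : ContDiff ℝ ∞ (cut L χ f) :=
  contDiff_of_eq_zero_off hR (hL.inter (isClosed_tsupport χ)) hLχ
    ((hχ.contDiffOn.mul hf.smooth).congr fun _ hq => cut_eq_of_mem hf hq) fun _ => cut_eq_zero

theorem hasCompactSupport_cut (hL : IsCompact L) : HasCompactSupport (cut L χ f) :=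
  HasCompactSupport.of_support_subset_isCompact hL fun _ hq => mem_of_cut_ne_zero hq

/-- By the product rule the cut-off commutes with the derivative wherever the derivative of χ
vanishes; off R both sides are zero. -/
theorem dbarDir_cut (hR : IsOpen R) (hL : IsClosed L) (hχ : ContDiff ℝ ∞ χ)
    (hLχ : L ∩ tsupport χ ⊆ R) (hf : IsSupportedOn R L f) {v q : Cn n × Cn n}
    (hq : dbarDir v χ q = 0) : dbarDir v (cut L χ f) q = cut L χ (dbarDir v f) q := by
  by_cases h : q ∈ R
  · have h1 : cut L χ f =ᶠ[𝓝 q] fun q => χ q * f q := by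
      filter_upwards [hR.mem_nhds h] with q' hq'
      exact cut_eq_of_mem hf hq'
    rw [dbarDir_congr h1, dbarDir_mul (hχ.differentiable (by simp) q)
      ((hf.smooth.contDiffAt (hR.mem_nhds h)).differentiableAt (by simp)), hq, zero_mul, add_zero,
      cut_eq_of_mem (hf.dbarDir hR hL v) h]
  · have h1 : q ∉ L ∩ tsupport χ := fun h' => h (hLχ h')
    have h2 : cut L χ f =ᶠ[𝓝 q] fun _ => 0 := by
      filter_upwards [(hL.inter (isClosed_tsupport χ)).isOpen_compl.mem_nhds h1] with q' hq'
      exact cut_eq_zero hq'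
    rw [dbarDir_congr h2, cut_eq_zero h1]
    simp [dbarDir]

/-- The integral of a divergence that has been cut off comes from where the cut-off function is not
locally constant. -/
theorem isLocOsc_integral_cut_of_divergence (hR : IsOpen R) (hL : IsCompact L)
    (hχ : ContDiff ℝ ∞ χ) (hLχ : L ∩ tsupport χ ⊆ R) (hf : IsSupportedOn R L f)
    {μ : Fin n → Cn n × Cn n → ℂ} (hμ : ∀ k, IsSupportedOn R L (μ k)) (c : Fin n → ℂ)
    (hdiv : ∀ q ∈ R, f q = ∑ k, c k * dbarDir (dir (toLex (Sum.inr k))) (μ k) q)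
    {p₀ : Cn n × Cn n} {a : ℝ}
    (ha : ∀ q, a < phase p₀.2 q → ∀ k, dbarDir (dir (toLex (Sum.inr k))) χ q = 0) :
    IsLocOsc p₀ a (fun p => ∫ w, kernelMul (cut L χ f) p.2 (p.1, w)) := by
  set D : Fin n → Cn n × Cn n → ℂ := fun k =>
    dbarDir (dir (toLex (Sum.inr k))) (cut L χ (μ k)) with hD
  have hsm : ∀ k, ContDiff ℝ ∞ (cut L χ (μ k)) := fun k =>
    contDiff_cut hR hL.isClosed hχ hLχ (hμ k)
  have hcc : ∀ k, HasCompactSupport (cut L χ (μ k)) := fun k => hasCompactSupport_cut hL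
  have hDs : ∀ k, ContDiff ℝ ∞ (D k) := fun k => contDiff_dbarDir (hsm k) _
  have hDc : ∀ k, HasCompactSupport (D k) := fun k => hasCompactSupport_dbarDir (hcc k) _
  have hfs := contDiff_cut hR hL.isClosed hχ hLχ hf
  have hfc : HasCompactSupport (cut L χ f) := hasCompactSupport_cut hL
  -- W differs from the cut-off function by divergences, which integrate to zero against the kernel.
  -- Where the phase exceeds a, χ has no fibre derivative and W vanishes.
  set W : Cn n × Cn n → ℂ := fun q => cut L χ f q - ∑ k, c k * D k q with hW
  have hWs : ContDiff ℝ ∞ W := hfs.sub (ContDiff.sum fun k _ => contDiff_const.mul (hDs k))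
  have hWz : ∀ q ∉ L, W q = 0 := by
    intro q hq
    have h1 : ∀ k, D k q = 0 := fun k => dbarDir_eq_zero_of_notMem (fun h => hq
      (closure_minimal (fun q hq => mem_of_cut_ne_zero hq) hL.isClosed h)) _
    simp [hW, h1, cut, indicator_of_notMem hq]
  have hWc : HasCompactSupport W := HasCompactSupport.intro hL hWz
  refine (isLocOsc_integral_kernelMul hWs hWc (Eventually.of_forall fun z w hne => ?_)).congr
    (Eventually.of_forall fun z ζ => ?_)
  · by_contra hlt
    push Not at hlt
    apply hne
    have h1 : ∀ k, D k (z, w) = cut L χ (dbarDir (dir (toLex (Sum.inr k))) (μ k)) (z, w) := fun k =>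
      dbarDir_cut hR hL.isClosed hχ hLχ (hμ k) (ha _ hlt k)
    simp only [hW, h1]
    by_cases h : (z, w) ∈ R
    · rw [cut_eq_of_mem hf h, hdiv _ h, Finset.mul_sum, sub_eq_zero]
      refine Finset.sum_congr rfl fun k _ => ?_
      rw [cut_eq_of_mem ((hμ k).dbarDir hR hL.isClosed _) h]
      ring
    · have h' : (z, w) ∉ L ∩ tsupport χ := fun h' => h (hLχ h')
      simp [cut_eq_zero h']
  · have i0 := integrable_slice (contDiff_kernelMul hfs ζ).continuous
      (hasCompactSupport_kernelMul hfc ζ) z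
    have i1 : ∀ k, Integrable fun w => kernelMul (D k) ζ (z, w) := fun k =>
      integrable_slice (contDiff_kernelMul (hDs k) ζ).continuous
        (hasCompactSupport_kernelMul (hDc k) ζ) z
    have h0 : ∀ k, ∫ w, kernelMul (D k) ζ (z, w) = 0 := fun k => by
      rw [← integral_dbarDir_eq_zero (contDiff_kernelMul (hsm k) ζ)
        (hasCompactSupport_kernelMul (hcc k) ζ) k z]
      simp_rw [dbarDir_kernelMul (hsm k)]
      rfl
    have h2 : ∀ w, kernelMul W ζ (z, w) = kernelMul (cut L χ f) ζ (z, w) -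
        ∑ k, c k * kernelMul (D k) ζ (z, w) := by
      intro w
      simp only [kernelMul, hW, sub_mul, Finset.sum_mul, mul_assoc]
    simp only [h2]
    rw [integral_sub i0 (integrable_finsetSum _ fun k _ => (i1 k).const_mul _),
      integral_finsetSum _ fun k _ => (i1 k).const_mul _]
    simp only [integral_const_mul, h0]
    simp

end cut

end

section

variable {n : ℕ}

/-! ### Removing the singularity of the second component of a cochain -/

/-- The product of a form with `1 - φ`. -/
def offMul (φ : Cn n × Cn n → ℝ) (f : Coeffs n) : Coeffs n := fun K p => ((1 - φ p : ℝ) : ℂ) * f K p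

/-- The open set of points of `U` over the ball of radius `r` about `z₀` with phase larger
than `-3c`. -/
def region (U : Set (Cn n × Cn n)) (z₀ ζ₀ : Cn n) (r c : ℝ) : Set (Cn n × Cn n) :=
  {p | p ∈ U ∧ p.1 ∈ Metric.ball z₀ r ∧ -(3 * c) < phase ζ₀ p}

theorem isOpen_region {U : Set (Cn n × Cn n)} (hU : IsOpen U) (z₀ ζ₀ : Cn n) (r c : ℝ) :
    IsOpen (region U z₀ ζ₀ r c) :=
  hU.inter ((Metric.isOpen_ball.preimage continuous_fst).inter
    (isOpen_lt continuous_const (continuous_phase ζ₀)))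

/-- `φ` is a smooth compactly supported function in `U`, equal to `1` near the part of `G` in the
region. -/
structure IsSingularCutoff (U G : Set (Cn n × Cn n)) (z₀ ζ₀ : Cn n) (r c : ℝ)
    (φ : Cn n × Cn n → ℝ) : Prop where
  smooth : ContDiff ℝ ∞ φ
  compact : HasCompactSupport φ
  subset : tsupport φ ⊆ U
  eq_one : ∀ p ∈ G, p ∈ region U z₀ ζ₀ r c → ∀ᶠ q in 𝓝 p, φ q = 1

/-- The part of G with phase at least -3c lies in D₁ and cannot meet D₂, where the phase is at most
-4c. It is thus inside the relatively compact domain of integration, and a compactly supported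
cut-off exists although G itself need not be compact. T will be D₁, or D₁ ∩ D₁' when two domains are
compared. -/
theorem exists_isSingularCutoff {U G D₁ D₂ : Set (Cn n × Cn n)} {z₀ ζ₀ : Cn n} {r c : ℝ}
    (hU : IsOpen U) (hG : IsClosed G) (h : IsLocalFrame U G D₁ D₂ z₀ ζ₀ r c)
    {T : Set (Cn n × Cn n)} (hT : IsOpen T)
    (hGT : ∀ p ∈ G, p ∈ U → p.1 ∈ Metric.closedBall z₀ r → p ∈ T) {ε : ℝ} (hε : 0 < ε) :
    ∃ φ, IsSingularCutoff U G z₀ ζ₀ r c φ ∧ ∀ p ∈ tsupport φ, p ∈ T ∧ phase ζ₀ p < ε := by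
  set K := (closure (D₁ \ D₂) ∩ Prod.fst ⁻¹' Metric.closedBall z₀ r) ∩
    (G ∩ {p | -(3 * c) ≤ phase ζ₀ p})
  have hK : IsCompact K := h.compact_D.inter_right
    (hG.inter (isClosed_le continuous_const (continuous_phase ζ₀)))
  have hKU : ∀ p ∈ K, p ∈ U := fun p hp => h.closure_D p hp.1.1 hp.1.2
  obtain ⟨φ, h1, h2, h3, h4⟩ := exists_contDiff_cutoff hK
    (hU.inter (hT.inter (isOpen_lt (continuous_phase ζ₀) continuous_const))) (fun p hp =>
      ⟨hKU p hp, hGT p hp.2.1 (hKU p hp) hp.1.2,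
        lt_of_le_of_lt (h.mem_of_G p hp.2.1 (hKU p hp) hp.1.2).2 hε⟩)
  refine ⟨φ, ⟨h1, h2, fun p hp => (h3 hp).1, fun p hpG hp => ?_⟩, fun p hp => (h3 hp).2⟩
  have hpb := Metric.ball_subset_closedBall hp.2.1
  refine eventually_nhdsSet_iff_forall.1 h4 p ⟨⟨subset_closure ⟨?_, fun h2 => ?_⟩, hpb⟩, hpG,
    hp.2.2.le⟩
  · exact (h.mem_of_G p hpG hp.1 hpb).1
  · have h5 := h.phase_D₂ p (subset_closure h2) hpb
    have h6 := hp.2.2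
    have := h.c_pos
    linarith

section

variable {U G : Set (Cn n × Cn n)} {z₀ ζ₀ : Cn n} {r c : ℝ} {φ : Cn n × Cn n → ℝ}

theorem IsSingularCutoff.notMem (hφ : IsSingularCutoff U G z₀ ζ₀ r c φ) {p : Cn n × Cn n}
    (hp : p ∈ region U z₀ ζ₀ r c) (hpφ : p ∉ tsupport φ) : p ∉ G := fun hG => by
  have := (hφ.eq_one p hG hp).self_of_nhds
  rw [image_eq_zero_of_notMem_tsupport hpφ] at this
  exact zero_ne_one this

/-- The factor 1 - φ is zero near the points of G in the region, so the product extends smoothly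
across the singularities. -/
theorem IsSingularCutoff.contDiffOn_offMul (hU : IsOpen U) (hG : IsClosed G)
    (hφ : IsSingularCutoff U G z₀ ζ₀ r c φ) {f : Coeffs n} {K : Finset (Idx n)}
    (hf : ContDiffOn ℝ ∞ (f K) (U \ G)) :
    ContDiffOn ℝ ∞ (offMul φ f K) (region U z₀ ζ₀ r c) := by
  intro p hp
  refine ContDiffAt.contDiffWithinAt ?_
  by_cases hpG : p ∈ G
  · refine (contDiffAt_const (c := (0 : ℂ))).congr_of_eventuallyEq ?_
    filter_upwards [hφ.eq_one p hpG hp] with q hq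
    simp [offMul, hq]
  · exact (Complex.ofRealCLM.contDiff.comp (contDiff_const.sub hφ.smooth)).contDiffAt.mul
      (hf.contDiffAt ((hU.sdiff hG).mem_nhds ⟨hp.1, hpG⟩))

theorem offMul_eventuallyEq {p : Cn n × Cn n} (hp : p ∉ tsupport φ) (f : Coeffs n)
    (K : Finset (Idx n)) : offMul φ f K =ᶠ[𝓝 p] f K := by
  filter_upwards [(isClosed_tsupport φ).isOpen_compl.mem_nhds hp] with q hq
  simp [offMul, image_eq_zero_of_notMem_tsupport hq]

theorem dbar_congr {f g : Coeffs n} {K : Finset (Idx n)} {p : Cn n × Cn n}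
    (h : ∀ k ∈ K, f (K.erase k) =ᶠ[𝓝 p] g (K.erase k)) : dbar f K p = dbar g K p := by
  simp only [dbar]
  congr 1
  exact Finset.sum_congr rfl fun k hk => by rw [dbarDir_congr (h k hk)]

theorem contDiffOn_dbar {R : Set (Cn n × Cn n)} (hR : IsOpen R) {f : Coeffs n}
    {K : Finset (Idx n)} (hf : ∀ k ∈ K, ContDiffOn ℝ ∞ (f (K.erase k)) R) :
    ContDiffOn ℝ ∞ (dbar f K) R :=
  contDiffOn_const.mul (ContDiffOn.sum fun k hk =>
    contDiffOn_const.mul (contDiffOn_dbarDir hR (hf k hk) _))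

theorem card_erase_int {K : Finset (Idx n)} {k : Idx n} (hk : k ∈ K) {m : ℤ}
    (hK : (K.card : ℤ) = m) : ((K.erase k).card : ℤ) = m - 1 := by
  have := Finset.card_erase_add_one hk
  push_cast [← this] at hK
  linarith

theorem dbar_sub {R : Set (Cn n × Cn n)} (hR : IsOpen R) {f g : Coeffs n} {K : Finset (Idx n)}
    (hf : ∀ k ∈ K, ContDiffOn ℝ ∞ (f (K.erase k)) R)
    (hg : ∀ k ∈ K, ContDiffOn ℝ ∞ (g (K.erase k)) R) {p : Cn n × Cn n} (hp : p ∈ R) :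
    dbar (fun K p => f K p - g K p) K p = dbar f K p - dbar g K p := by
  simp only [dbar]
  rw [← mul_sub, ← Finset.sum_sub_distrib]
  congr 1
  refine Finset.sum_congr rfl fun k hk => ?_
  rw [dbarDir_sub (((hf k hk).contDiffAt (hR.mem_nhds hp)).differentiableAt (by simp))
    (((hg k hk).contDiffAt (hR.mem_nhds hp)).differentiableAt (by simp)), mul_sub]

variable {m : ℤ}

/-- The first component of a cochain after the second one has been extended across `G`. -/
def reduced (φ : Cn n × Cn n → ℝ) (η : Cochain U G m) : Coeffs n := fun K p =>
  η.form1 K p - dbar (offMul φ η.form01) K p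

theorem region_subset : region U z₀ ζ₀ r c ⊆ U := fun _ hp => hp.1

/-- Off the support of φ the factor 1 - φ is 1, and the expression becomes ω₁ - ∂̄ω₀₁, zero by the
cocycle condition. -/
theorem isSupportedOn_reduced (hU : IsOpen U) (hG : IsClosed G)
    (hφ : IsSingularCutoff U G z₀ ζ₀ r c φ) {η : Cochain U G m} (hη : IsCocycle η)
    {K : Finset (Idx n)} (hK : (K.card : ℤ) = m) :
    IsSupportedOn (region U z₀ ζ₀ r c) (tsupport φ) (reduced φ η K) := by
  refine ⟨((η.smooth1 K hK).mono region_subset).sub (contDiffOn_dbar (isOpen_region hU _ _ _ _)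
    fun k hk => hφ.contDiffOn_offMul hU hG (η.smooth01 _ (card_erase_int hk hK))), ?_⟩
  intro q hq hqφ
  have h1 := hη.2 K hK q ⟨hq.1, hφ.notMem hq hqφ⟩
  rw [reduced, dbar_congr fun k _ => offMul_eventuallyEq hqφ η.form01 _]
  exact h1

theorem dbar_reduced (hU : IsOpen U) (hG : IsClosed G)
    (hφ : IsSingularCutoff U G z₀ ζ₀ r c φ) {η : Cochain U G m} (hη : IsCocycle η)
    {K : Finset (Idx n)} (hK : (K.card : ℤ) = m + 1) {p : Cn n × Cn n}
    (hp : p ∈ region U z₀ ζ₀ r c) : dbar (reduced φ η) K p = 0 := by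
  have hR := isOpen_region hU z₀ ζ₀ r c
  have hoff : ∀ J : Finset (Idx n), (J.card : ℤ) = m - 1 →
      ContDiffOn ℝ ∞ (offMul φ η.form01 J) (region U z₀ ζ₀ r c) := fun J hJ =>
    hφ.contDiffOn_offMul hU hG (η.smooth01 J hJ)
  have hcard : ∀ k ∈ K, ((K.erase k).card : ℤ) = m := fun k hk => by
    rw [card_erase_int hk hK]; ring
  have h1 : dbar (reduced φ η) K p = dbar η.form1 K p - dbar (dbar (offMul φ η.form01)) K p :=
    dbar_sub hR (fun k hk => (η.smooth1 _ (hcard k hk)).mono region_subset)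
      (fun k hk => contDiffOn_dbar hR fun l hl => hoff _ (card_erase_int hl (hcard k hk))) hp
  rw [h1, hη.1 K hK p hp.1, dbar_dbar hR hoff (by rw [hK]; ring) hp]
  simp

/-- The reduced form of a coboundary is a differential of a form with the same support. -/
theorem exists_primitive_reduced (hU : IsOpen U) (hG : IsClosed G)
    (hφ : IsSingularCutoff U G z₀ ζ₀ r c φ) {η : Cochain U G m} (hη : IsCoboundary η) :
    ∃ σ : Coeffs n, (∀ K : Finset (Idx n), (K.card : ℤ) = m - 1 →
      IsSupportedOn (region U z₀ ζ₀ r c) (tsupport φ) (σ K)) ∧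
      ∀ K : Finset (Idx n), (K.card : ℤ) = m → ∀ p ∈ region U z₀ ζ₀ r c,
        reduced φ η K p = dbar σ K p := by
  obtain ⟨τ, hτ1, hτ2⟩ := hη
  have hR := isOpen_region hU z₀ ζ₀ r c
  have hoff : ∀ J : Finset (Idx n), (J.card : ℤ) = m - 1 →
      ContDiffOn ℝ ∞ (offMul φ η.form01 J) (region U z₀ ζ₀ r c) := fun J hJ =>
    hφ.contDiffOn_offMul hU hG (η.smooth01 J hJ)
  have hoffτ : ∀ J : Finset (Idx n), (J.card : ℤ) = m - 1 - 1 →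
      ContDiffOn ℝ ∞ (offMul φ τ.form01 J) (region U z₀ ζ₀ r c) := fun J hJ =>
    hφ.contDiffOn_offMul hU hG (τ.smooth01 J hJ)
  have hs1 : ∀ J : Finset (Idx n), (J.card : ℤ) = m - 1 → ContDiffOn ℝ ∞
      (fun p => τ.form1 J p - offMul φ η.form01 J p) (region U z₀ ζ₀ r c) := fun J hJ =>
    ((τ.smooth1 J hJ).mono region_subset).sub (hoff J hJ)
  have hs2 : ∀ J : Finset (Idx n), (J.card : ℤ) = m - 1 → ContDiffOn ℝ ∞
      (dbar (offMul φ τ.form01) J) (region U z₀ ζ₀ r c) := fun J hJ =>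
    contDiffOn_dbar hR fun k hk => hoffτ _ (card_erase_int hk hJ)
  -- The primitive is τ₁ - (1 - φ)ω₀₁ - ∂̄((1 - φ)τ₀₁). The last term is closed, so it does not
  -- affect the differential; it is there to make the primitive vanish off supp φ, by ω₀₁ = τ₁ -
  -- ∂̄τ₀₁.
  refine ⟨fun K p => (fun K p => τ.form1 K p - offMul φ η.form01 K p) K p -
    dbar (offMul φ τ.form01) K p, fun K hK => ⟨(hs1 K hK).sub (hs2 K hK), ?_⟩, fun K hK p hp => ?_⟩
  · intro q hq hqφ
    have h1 := hτ2 K hK q ⟨hq.1, hφ.notMem hq hqφ⟩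
    simp only
    rw [dbar_congr fun k _ => offMul_eventuallyEq hqφ τ.form01 _,
      (offMul_eventuallyEq hqφ η.form01 K).self_of_nhds, ← h1]
    ring
  · rw [dbar_sub hR (fun k hk => hs1 _ (card_erase_int hk hK))
      (fun k hk => hs2 _ (card_erase_int hk hK)) hp,
      dbar_sub hR (fun k hk => (τ.smooth1 _ (card_erase_int hk hK)).mono region_subset)
      (fun k hk => hoff _ (card_erase_int hk hK)) hp, dbar_dbar hR hoffτ (by rw [hK]; ring) hp,
      hτ1 K (by rw [hK]; ring) p hp.1, reduced, sub_zero]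

end

end

section

variable {n : ℕ}

/-! ### The local formula for the symbol -/

/-- The index of the component `dz' ∧ ⋀_{j ≠ k} dz̄'_j`. -/
abbrev faceIdx (k : Fin n) : Finset (Idx n) := (fibreIdx n).erase (toLex (Sum.inr k))

theorem card_faceIdx (k : Fin n) : ((faceIdx k).card : ℤ) = (n : ℤ) - 1 :=
  card_erase_int (inr_mem_fibreIdx k) (by rw [card_fibreIdx])

/-- The product of a function of `z` with a ramp. -/
def window (β : Cn n → ℝ) (ζ₀ : Cn n) (c : ℝ) (q : Cn n × Cn n) : ℂ :=
  (β q.1 : ℂ) * ramp ζ₀ (-c) (-(c / 2)) q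

section window

variable {U : Set (Cn n × Cn n)} {β : Cn n → ℝ} {z₀ ζ₀ : Cn n} {r c : ℝ}

theorem contDiff_window (hβ : ContDiff ℝ ∞ β) : ContDiff ℝ ∞ (window β ζ₀ c) :=
  (Complex.ofRealCLM.contDiff.comp (hβ.comp contDiff_fst)).mul (contDiff_ramp _ _ _)

theorem tsupport_window_subset (hc : 0 < c) :
    tsupport (window β ζ₀ c) ⊆ {q | q.1 ∈ tsupport β ∧ -c ≤ phase ζ₀ q} := by
  refine closure_minimal (fun q hq => ⟨subset_tsupport β fun h => hq ?_, ?_⟩)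
    (((isClosed_tsupport β).preimage continuous_fst).inter
      (isClosed_le continuous_const (continuous_phase ζ₀)))
  · simp [window, h]
  · by_contra h
    push Not at h
    exact hq (by rw [window, ramp_eq_zero (by linarith) h.le, mul_zero])

theorem inter_tsupport_window_subset (hc : 0 < c) (hβ : tsupport β ⊆ Metric.ball z₀ r)
    {L : Set (Cn n × Cn n)} (hL : L ⊆ U) :
    L ∩ tsupport (window β ζ₀ c) ⊆ region U z₀ ζ₀ r c := by
  rintro q ⟨hq, hq'⟩
  obtain ⟨h1, h2⟩ := tsupport_window_subset hc hq'
  exact ⟨hL hq, hβ h1, by linarith⟩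

theorem window_eventuallyEq (hc : 0 < c) {q : Cn n × Cn n} (hq : -(c / 2) < phase ζ₀ q) :
    window β ζ₀ c =ᶠ[𝓝 q] fun q => (β q.1 : ℂ) := by
  filter_upwards [ramp_eventually_eq_one (a := -c) (by linarith) hq] with q' h
  rw [window, h, mul_one]

/-- For phase above -c/2 the ramp is 1 and the window depends on z alone. -/
theorem dbarDir_inr_window (hc : 0 < c) (hβ : ContDiff ℝ ∞ β) {q : Cn n × Cn n}
    (hq : -(c / 2) < phase ζ₀ q) (k : Fin n) :
    dbarDir (dir (toLex (Sum.inr k))) (window β ζ₀ c) q = 0 := by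
  rw [dbarDir_congr (window_eventuallyEq hc hq), dbarDir_dir_inr]
  have h1 : HasFDerivAt (fun q : Cn n × Cn n => (β q.1 : ℂ)) (Complex.ofRealCLM.comp
      ((fderiv ℝ β q.1).comp (ContinuousLinearMap.fst ℝ (Cn n) (Cn n)))) q :=
    Complex.ofRealCLM.hasFDerivAt.comp q
      ((hβ.differentiable (by simp) q.1).hasFDerivAt.comp q hasFDerivAt_fst)
  rw [h1.fderiv]
  simp

theorem dbarDir_window (hc : 0 < c) {q : Cn n × Cn n} (hq : -(c / 2) < phase ζ₀ q)
    (hβ : ∀ᶠ z in 𝓝 q.1, β z = 1) (v : Cn n × Cn n) : dbarDir v (window β ζ₀ c) q = 0 := by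
  have h1 : window β ζ₀ c =ᶠ[𝓝 q] fun _ => 1 := by
    filter_upwards [window_eventuallyEq (β := β) hc hq,
      (continuous_fst.tendsto q).eventually hβ] with q' h2 h3
    rw [h2, h3, Complex.ofReal_one]
  rw [dbarDir_congr h1]
  simp [dbarDir]

end window

section

variable {U G D₁ D₂ : Set (Cn n × Cn n)} {z₀ ζ₀ : Cn n} {r c : ℝ}

theorem IsLocalFrame.compact_E (h : IsLocalFrame U G D₁ D₂ z₀ ζ₀ r c) :
    IsCompact (closure (frontier D₁ \ D₂) ∩ Prod.fst ⁻¹' Metric.closedBall z₀ r) :=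
  h.compact_D.of_isClosed_subset
    (isClosed_closure.inter (Metric.isClosed_closedBall.preimage continuous_fst))
    fun p hp => ⟨(h.closure_E p hp.1 hp.2).1, hp.2⟩

theorem IsLocalFrame.exists_volume_extension (hU : IsOpen U)
    (h : IsLocalFrame U G D₁ D₂ z₀ ζ₀ r c) (η : Cochain U G (n : ℤ)) :
    ∃ A : Cn n × Cn n → ℂ, ContDiff ℝ ∞ A ∧ HasCompactSupport A ∧
      tsupport A ⊆ Prod.fst ⁻¹' Metric.ball z₀ r ∧
      ∀ᶠ z in 𝓝 z₀, ∀ w, (z, w) ∈ closure (D₁ \ D₂) → A (z, w) = η.form1 (fibreIdx n) (z, w) := by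
  obtain ⟨A, h1, h2, h3, -, h4⟩ := exists_local_extension hU h.r_pos h.compact_D h.closure_D
    ((η.smooth1 (fibreIdx n) (by rw [card_fibreIdx])).mono inter_subset_left)
  exact ⟨A, h1, h2, h3, h4.mono fun z hz w hw => (hz w hw).self_of_nhds⟩

theorem IsLocalFrame.exists_surface_extension (hU : IsOpen U) (hG : IsClosed G)
    (h : IsLocalFrame U G D₁ D₂ z₀ ζ₀ r c) (η : Cochain U G (n : ℤ)) :
    ∃ C : Fin n → Cn n × Cn n → ℂ, (∀ k, ContDiff ℝ ∞ (C k) ∧ HasCompactSupport (C k) ∧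
      tsupport (C k) ⊆ Prod.fst ⁻¹' Metric.ball z₀ r) ∧
      ∀ᶠ z in 𝓝 z₀, ∀ w, (z, w) ∈ frontier D₁ \ D₂ → ∀ k,
        C k (z, w) = η.form01 (faceIdx k) (z, w) := by
  choose C h1 h2 h3 _ h4 using fun k => exists_local_extension (hU.sdiff hG) h.r_pos h.compact_E
    (fun p hp hp' => ⟨h.closure_D p (h.closure_E p hp hp').1 hp', (h.closure_E p hp hp').2⟩)
    ((η.smooth01 (faceIdx k) (card_faceIdx k)).mono inter_subset_left)
  refine ⟨C, fun k => ⟨h1 k, h2 k, h3 k⟩, ?_⟩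
  filter_upwards [eventually_all.2 h4] with z hz w hw k
  exact (hz k w (subset_closure hw)).self_of_nhds

theorem boundaryDensity_eq {b : Coeffs n} {C : Fin n → Cn n × Cn n → ℂ} {z w : Cn n}
    (h : ∀ k, C k (z, w) = b (faceIdx k) (z, w)) (ζ : Cn n) :
    boundaryDensity D₁ b z ζ w = volConst n * ∑ k : Fin n, ((-1) ^ (n + (k : ℕ)) / 2) *
      (kernelMul (C k) ζ (z, w) * outerNormal (fibre D₁ z) w k) := by
  rw [boundaryDensity, density01]
  congr 1
  refine Finset.sum_congr rfl fun k _ => ?_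
  rw [kernelMul, h k]
  ring

theorem IsLocalFrame.measurableSet_D (h : IsLocalFrame U G D₁ D₂ z₀ ζ₀ r c) (z : Cn n) :
    MeasurableSet (fibre (D₁ \ D₂) z) :=
  measurableSet_fibre (h.isOpen₁.measurableSet.diff h.isOpen₂.measurableSet) z

theorem IsLocalFrame.measurableSet_E (h : IsLocalFrame U G D₁ D₂ z₀ ζ₀ r c) (z : Cn n) :
    MeasurableSet (fibre (frontier D₁ \ D₂) z) :=
  measurableSet_fibre (isClosed_frontier.measurableSet.diff h.isOpen₂.measurableSet) z

theorem isOpen_fst_ball (z₀ : Cn n) (r : ℝ) :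
    IsOpen (Prod.fst ⁻¹' Metric.ball z₀ r : Set (Cn n × Cn n)) :=
  Metric.isOpen_ball.preimage continuous_fst

theorem IsLocalFrame.surface_integrable (h : IsLocalFrame U G D₁ D₂ z₀ ζ₀ r c)
    {C : Cn n × Cn n → ℂ} (hC : ContDiff ℝ ∞ C) (hc : HasCompactSupport C)
    (hs : tsupport C ⊆ Prod.fst ⁻¹' Metric.ball z₀ r) (k : Fin n) (z ζ : Cn n) :
    IntegrableOn (fun w => kernelMul C ζ (z, w) * outerNormal (fibre D₁ z) w k)
      (fibre (frontier D₁ \ D₂) z) μHE[2 * n - 1] :=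
  (h.chart _ (isOpen_fst_ball z₀ r) fun _ hp => hp).surface_integrable _ (contDiff_kernelMul hC ζ)
    (hasCompactSupport_kernelMul hc ζ) ((tsupport_kernelMul_subset C ζ).trans hs) k z

/-- The integrals that define the symbol converge near a point. -/
theorem IsLocalFrame.integrable (hU : IsOpen U) (hG : IsClosed G)
    (h : IsLocalFrame U G D₁ D₂ z₀ ζ₀ r c) (η : Cochain U G (n : ℤ)) :
    ∀ᶠ z in 𝓝 z₀, ∀ ζ, IntegrableOn (density1 η.form1 z ζ) (fibre (D₁ \ D₂) z) volume ∧
      IntegrableOn (boundaryDensity D₁ η.form01 z ζ) (fibre (frontier D₁ \ D₂) z)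
        μHE[2 * n - 1] := by
  obtain ⟨A, hA1, hA2, -, hA4⟩ := h.exists_volume_extension hU η
  obtain ⟨C, hC, hC4⟩ := h.exists_surface_extension hU hG η
  filter_upwards [hA4, hC4] with z hzA hzC ζ
  constructor
  · have h1 : IntegrableOn (fun w => volConst n * kernelMul A ζ (z, w)) (fibre (D₁ \ D₂) z) :=
      ((integrable_slice (contDiff_kernelMul hA1 ζ).continuous
        (hasCompactSupport_kernelMul hA2 ζ) z).const_mul _).integrableOn
    refine h1.congr_fun (fun w hw => ?_) (h.measurableSet_D z)
    simp only [density1, kernelMul]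
    rw [hzA w (subset_closure hw)]
  · have h1 : IntegrableOn (fun w => volConst n * ∑ k : Fin n, ((-1) ^ (n + (k : ℕ)) / 2) *
        (kernelMul (C k) ζ (z, w) * outerNormal (fibre D₁ z) w k)) (fibre (frontier D₁ \ D₂) z)
        μHE[2 * n - 1] :=
      (integrable_finsetSum _ fun k _ => (h.surface_integrable (hC k).1 (hC k).2.1 (hC k).2.2 k z
        ζ).const_mul _).const_mul _
    exact h1.congr_fun (fun w hw => (boundaryDensity_eq (fun k => hzC w hw k) ζ).symm)
      (h.measurableSet_E z)

variable {φ : Cn n × Cn n → ℝ} {β : Cn n → ℝ}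

/-- The density over the fibre that represents the symbol up to a null-symbol. -/
def mainDensity (φ : Cn n × Cn n → ℝ) (β : Cn n → ℝ) (ζ₀ : Cn n) (c : ℝ)
    (η : Cochain U G (n : ℤ)) : Cn n × Cn n → ℂ :=
  cut (tsupport φ) (window β ζ₀ c) (reduced φ η (fibreIdx n))

/-- φ controls G only where the phase exceeds -3c. The ramp vanishes for phase below -2c, so the
product is smooth on the remainder as well. -/
theorem contDiffOn_ramp_mul_offMul (hU : IsOpen U) (hG : IsClosed G) (hc : 0 < c)
    (hφ : IsSingularCutoff U G z₀ ζ₀ r c φ) {f : Coeffs n} {K : Finset (Idx n)}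
    (hf : ContDiffOn ℝ ∞ (f K) (U \ G)) :
    ContDiffOn ℝ ∞ (fun q => ramp ζ₀ (-(2 * c)) (-c) q * offMul φ f K q)
      (U ∩ Prod.fst ⁻¹' Metric.ball z₀ r) := by
  intro p hp
  refine ContDiffAt.contDiffWithinAt ?_
  by_cases h : -(3 * c) < phase ζ₀ p
  · exact (contDiff_ramp _ _ _).contDiffAt.mul ((hφ.contDiffOn_offMul hU hG hf).contDiffAt
      ((isOpen_region hU _ _ _ _).mem_nhds ⟨hp.1, hp.2, h⟩))
  · refine (contDiffAt_const (c := (0 : ℂ))).congr_of_eventuallyEq ?_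
    filter_upwards [ramp_eventually_eq_zero (a := -(2 * c)) (b := -c) (by linarith)
      (by linarith : phase ζ₀ p < -(2 * c))] with q hq
    rw [hq, zero_mul]

/-- The local formula: up to exponentially small terms the symbol is an integral over the whole
fibre of a density that does not depend on the domains. -/
theorem IsLocalFrame.isLocOsc_symbolMap_sub (hU : IsOpen U) (hG : IsClosed G)
    (h : IsLocalFrame U G D₁ D₂ z₀ ζ₀ r c) (η : Cochain U G (n : ℤ)) (hη : IsCocycle η)
    (hφ : IsSingularCutoff U G z₀ ζ₀ r c φ) (hφD : tsupport φ ⊆ D₁)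
    (hβ1 : ∀ᶠ z in 𝓝 z₀, β z = 1) :
    IsLocOsc (z₀, ζ₀) (-(c / 2)) (fun p => symbolMap D₁ D₂ η p -
      volConst n * ∫ w, kernelMul (mainDensity φ β ζ₀ c η) p.2 (p.1, w)) := by
  have hc := h.c_pos
  have hR := isOpen_region hU z₀ ζ₀ r c
  obtain ⟨A, hA1, hA2, hA3, hA4⟩ := h.exists_volume_extension hU η
  obtain ⟨C, hC, hC4⟩ := h.exists_surface_extension hU hG η
  -- B k is a global version of κ₁(1 - φ)ω₀₁. The ramp κ₁ keeps its support at phase at least -2c,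
  -- hence off the closure of D₂, where the phase is at most -4c.
  choose B hB1 hB2 hB3 hB5 hB4 using fun k : Fin n => exists_local_extension hU h.r_pos h.compact_D
    h.closure_D (contDiffOn_ramp_mul_offMul hU hG hc hφ (η.smooth01 (faceIdx k) (card_faceIdx k)))
  set ε : Fin n → ℂ := fun k => (-1) ^ (n + (k : ℕ)) with hε
  set dB : Fin n → Cn n × Cn n → ℂ := fun k => dbarDir (dir (toLex (Sum.inr k))) (B k) with hdB
  -- H is the fibre coefficient of ω₁ minus the differential of the form with coefficients B k; on
  -- the domain it is the reduced form wherever the phase exceeds -c.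
  set H : Cn n × Cn n → ℂ := fun q => A q - ∑ k, ε k * dB k q with hH
  set κ₁ : Cn n × Cn n → ℂ := ramp ζ₀ (-(2 * c)) (-c) with hκ₁
  set κ₂ : Cn n × Cn n → ℂ := ramp ζ₀ (-c) (-(c / 2)) with hκ₂
  have hdBs : ∀ k, ContDiff ℝ ∞ (dB k) := fun k => contDiff_dbarDir (hB1 k) _
  have hdBc : ∀ k, HasCompactSupport (dB k) := fun k => hasCompactSupport_dbarDir (hB2 k) _
  have hHs : ContDiff ℝ ∞ H := hA1.sub (ContDiff.sum fun k _ => contDiff_const.mul (hdBs k))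
  have hcl : tsupport H ⊆ tsupport A ∪ ⋃ k, tsupport (B k) := by
    refine tsupport_subset_of_eq_zero_off ((isClosed_tsupport A).union
      (isClosed_iUnion_of_finite fun k => isClosed_tsupport (B k))) fun q hq => ?_
    rw [mem_union, mem_iUnion, not_or, not_exists] at hq
    have h1 : ∀ k, dB k q = 0 := fun k => dbarDir_eq_zero_of_notMem (hq.2 k) _
    simp only [hH, h1, image_eq_zero_of_notMem_tsupport hq.1]
    simp
  have hHc : HasCompactSupport H :=
    HasCompactSupport.of_support_subset_isCompact
      (hA2.isCompact.union (isCompact_iUnion fun k => (hB2 k).isCompact))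
      ((subset_tsupport H).trans hcl)
  have hHt : tsupport H ⊆ Prod.fst ⁻¹' Metric.ball z₀ r :=
    hcl.trans (union_subset hA3 (iUnion_subset hB3))
  have hκ₁s : ContDiff ℝ ∞ κ₁ := contDiff_ramp _ _ _
  have hκ₂s : ContDiff ℝ ∞ κ₂ := contDiff_ramp _ _ _
  have hchart := h.chart _ (isOpen_fst_ball z₀ r) fun _ hp => hp
  -- First remainder: the volume part with phase at most -c/2.
  set H' : Cn n × Cn n → ℂ := fun q => (1 - κ₂ q) * H q with hH'
  have hH's : ContDiff ℝ ∞ H' := (contDiff_const.sub hκ₂s).mul hHs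
  have hH'c : HasCompactSupport H' := hHc.mul_left
  have hvol := hchart.volume_osc H' hH's hH'c (tsupport_mul_subset_right.trans hHt) ζ₀ (-(c / 2))
    (tsupport_subset_phase_le fun q hq => by
      by_contra hlt
      push Not at hlt
      exact left_ne_zero_of_mul hq (by rw [hκ₂, ramp_eq_one (by linarith) hlt.le, sub_self]))
  -- Second remainder: the surface part not captured by B k, with phase at most -c.
  set C' : Fin n → Cn n × Cn n → ℂ := fun k q => (1 - κ₁ q) * C k q with hC'
  have hC's : ∀ k, ContDiff ℝ ∞ (C' k) := fun k => (contDiff_const.sub hκ₁s).mul (hC k).1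
  have hC'c : ∀ k, HasCompactSupport (C' k) := fun k => (hC k).2.1.mul_left
  have hC't : ∀ k, tsupport (C' k) ⊆ Prod.fst ⁻¹' Metric.ball z₀ r := fun k =>
    tsupport_mul_subset_right.trans (hC k).2.2
  have hsurf := fun k => hchart.surface_osc (C' k) (hC's k) (hC'c k) (hC't k) k ζ₀ (-(c / 2))
    (tsupport_subset_phase_le fun q hq => by
      by_contra hlt
      push Not at hlt
      exact left_ne_zero_of_mul hq (by rw [hκ₁, ramp_eq_one (by linarith) (by linarith), sub_self]))
  refine ⟨_, (hvol.const_mul (volConst n)).add _ _ (IsOsc.sum Finset.univ _ fun k _ =>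
    (hsurf k).const_mul (-(volConst n * (ε k / 2)))), ?_⟩
  filter_upwards [hA4, hC4, eventually_all.2 hB4, eventually_eventually_nhds.2 hβ1,
    Metric.ball_mem_nhds z₀ h.r_pos] with z hzA hzC hzB hzβ hzr ζ
  have hzr' := Metric.ball_subset_closedBall hzr
  simp only
  set D := fibre (D₁ \ D₂) z
  set E := fibre (frontier D₁ \ D₂) z
  have hDm : MeasurableSet D := h.measurableSet_D z
  have hEm : MeasurableSet E := h.measurableSet_E z
  have iD : ∀ {F : Cn n × Cn n → ℂ}, ContDiff ℝ ∞ F → HasCompactSupport F →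
      IntegrableOn (fun w => kernelMul F ζ (z, w)) D := fun hF hFc =>
    (integrable_slice (contDiff_kernelMul hF ζ).continuous
      (hasCompactSupport_kernelMul hFc ζ) z).integrableOn
  have e1 : ∫ w in D, density1 η.form1 z ζ w = volConst n * ∫ w in D, kernelMul A ζ (z, w) := by
    rw [← integral_const_mul]
    refine setIntegral_congr_fun hDm fun w hw => ?_
    simp only [density1, kernelMul]
    rw [hzA w (subset_closure hw)]
  have e2 : ∫ w in E, boundaryDensity D₁ η.form01 z ζ w ∂μHE[2 * n - 1] = volConst n *
      ∑ k, (ε k / 2) * ∫ w in E, kernelMul (C k) ζ (z, w) * outerNormal (fibre D₁ z) w k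
        ∂μHE[2 * n - 1] := by
    rw [setIntegral_congr_fun hEm fun w hw => boundaryDensity_eq (fun k => hzC w hw k) ζ,
      integral_const_mul, integral_finsetSum _ fun k _ => (h.surface_integrable (hC k).1 (hC k).2.1
        (hC k).2.2 k z ζ).const_mul _]
    simp_rw [integral_const_mul]
    rfl
  have e3 : ∀ k, ∫ w in E, kernelMul (C k) ζ (z, w) * outerNormal (fibre D₁ z) w k
        ∂μHE[2 * n - 1] =
      ∫ w in E, kernelMul (B k) ζ (z, w) * outerNormal (fibre D₁ z) w k ∂μHE[2 * n - 1] +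
      ∫ w in E, kernelMul (C' k) ζ (z, w) * outerNormal (fibre D₁ z) w k ∂μHE[2 * n - 1] := by
    intro k
    rw [← integral_add (h.surface_integrable (hB1 k) (hB2 k) (hB3 k) k z ζ)
      (h.surface_integrable (hC's k) (hC'c k) (hC't k) k z ζ)]
    refine setIntegral_congr_fun hEm fun w hw => ?_
    have hcD : (z, w) ∈ closure (D₁ \ D₂) := (h.closure_E _ (subset_closure hw) hzr').1
    have hb : B k (z, w) = κ₁ (z, w) * C k (z, w) := by
      -- supp φ lies in the open set D₁, which is disjoint from its frontier; so on the surface B k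
      -- and κ₁ω₀₁ agree.
      have hφ0 : φ (z, w) = 0 := image_eq_zero_of_notMem_tsupport fun h' => by
        have h1 := hw.1
        rw [h.isOpen₁.frontier_eq] at h1
        exact h1.2 (hφD h')
      rw [(hzB k w hcD).self_of_nhds, hzC w hw k]
      simp [offMul, hφ0]
    simp only [kernelMul, hC', hb]
    ring
  have e4 : ∀ k, ∫ w in D, kernelMul (dB k) ζ (z, w) = (1 / 2) *
      ∫ w in E, kernelMul (B k) ζ (z, w) * outerNormal (fibre D₁ z) w k ∂μHE[2 * n - 1] := by
    intro k
    have hO : IsOpen (Prod.fst ⁻¹' Metric.ball z₀ r ∩ (closure D₂)ᶜ : Set (Cn n × Cn n)) :=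
      (isOpen_fst_ball z₀ r).inter isClosed_closure.isOpen_compl
    have ht : tsupport (B k) ⊆ Prod.fst ⁻¹' Metric.ball z₀ r ∩ (closure D₂)ᶜ := by
      intro q hq
      refine ⟨hB3 k hq, fun hq2 => ?_⟩
      have h1 : -(2 * c) ≤ phase ζ₀ q := by
        refine closure_minimal (fun q hq => ?_)
          (isClosed_le continuous_const (continuous_phase ζ₀)) hq
        by_contra hlt
        rw [mem_ofPred_eq] at hlt
        push Not at hlt
        exact hq (hB5 k q (by
          rw [show κ₁ q = 0 from ramp_eq_zero (by linarith) hlt.le, zero_mul]))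
      have h2 := h.phase_D₂ q hq2 (Metric.ball_subset_closedBall (hB3 k hq))
      linarith
    have := (h.chart _ hO fun p hp => hp.1).stokes (disjoint_compl_left.mono_left inter_subset_right)
      (kernelMul (B k) ζ) (contDiff_kernelMul (hB1 k) ζ) (hasCompactSupport_kernelMul (hB2 k) ζ)
      ((tsupport_kernelMul_subset _ _).trans ht) k z
    rw [← this]
    simp_rw [dbarDir_kernelMul (hB1 k)]
    rfl
  have e5 : ∫ w in D, kernelMul A ζ (z, w) = (∫ w in D, kernelMul H ζ (z, w)) +
      ∑ k, ε k * ∫ w in D, kernelMul (dB k) ζ (z, w) := by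
    simp_rw [← integral_const_mul]
    rw [← integral_finsetSum _ fun k _ => (iD (hdBs k) (hdBc k)).const_mul _,
      ← integral_add (iD hHs hHc)
        (integrable_finsetSum _ fun k _ => (iD (hdBs k) (hdBc k)).const_mul _)]
    congr 1
    funext w
    simp only [kernelMul, hH, sub_mul, Finset.sum_mul, mul_assoc]
    ring
  set H₂ : Cn n × Cn n → ℂ := fun q => κ₂ q * H q with hH₂
  have e6 : ∫ w in D, kernelMul H ζ (z, w) = (∫ w in D, kernelMul H₂ ζ (z, w)) +
      ∫ w in D, kernelMul H' ζ (z, w) := by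
    rw [← integral_add (iD (hκ₂s.mul hHs) hHc.mul_left) (iD hH's hH'c)]
    congr 1
    funext w
    simp only [kernelMul, hH']
    ring
  have hsup := isSupportedOn_reduced hU hG hφ hη (K := fibreIdx n) (by rw [card_fibreIdx])
  -- For phase at most -c both densities vanish; above it κ₁ is locally 1 and they agree on the
  -- domain. Outside the domain the main density vanishes as well, being supported in D₁ and killed
  -- by its ramp on D₂, so the integral extends to the whole fibre.
  have e7 : ∫ w in D, kernelMul H₂ ζ (z, w) =
      ∫ w, kernelMul (mainDensity φ β ζ₀ c η) ζ (z, w) := by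
    rw [← setIntegral_eq_integral_of_forall_compl_eq_zero (s := D)
      (f := fun w => kernelMul (mainDensity φ β ζ₀ c η) ζ (z, w))]
    · refine setIntegral_congr_fun hDm fun w hw => ?_
      simp only [kernelMul]
      congr 1
      have hβz : β z = 1 := hzβ.self_of_nhds
      by_cases hph : phase ζ₀ (z, w) ≤ -c
      · have h0 : κ₂ (z, w) = 0 := ramp_eq_zero (by linarith) hph
        rw [mainDensity, cut_eq_zero_of_eq_zero]
        · simp [hH₂, h0]
        · rw [window, ← hκ₂, h0, mul_zero]
      push Not at hph
      have hq : (z, w) ∈ region U z₀ ζ₀ r c :=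
        ⟨h.closure_D _ (subset_closure hw) hzr', hzr, by linarith⟩
      rw [mainDensity, cut_eq_of_mem hsup hq, window, hβz, Complex.ofReal_one, one_mul]
      simp only [hH₂, hH, reduced, dbar_fibreIdx]
      rw [hzA w (subset_closure hw)]
      congr 2
      refine Finset.sum_congr rfl fun k _ => ?_
      congr 1
      refine dbarDir_congr ?_ _
      filter_upwards [hzB k w (subset_closure hw),
        ramp_eventually_eq_one (a := -(2 * c)) (b := -c) (by linarith) hph] with q h1 h2
      rw [h1, hκ₁, h2, one_mul]
    · intro w hw
      simp only [kernelMul, mul_eq_zero]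
      left
      by_contra hne
      refine hw ⟨hφD (mem_of_cut_ne_zero hne), fun h2 => ?_⟩
      have h3 := h.phase_D₂ _ (subset_closure h2) hzr'
      refine hne (cut_eq_zero_of_eq_zero ?_)
      rw [window, ramp_eq_zero (by linarith) (by linarith), mul_zero]
  rw [symbolMap, e1, e2, e5, e6, e7]
  simp_rw [e3, e4]
  rw [← sub_eq_zero]
  simp only [Finset.mul_sum, mul_add, neg_mul, Finset.sum_neg_distrib, Finset.sum_add_distrib]
  have e8 : ∀ X : Fin n → ℂ, ∑ k, volConst n * (ε k * (1 / 2 * X k)) =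
      ∑ k, volConst n * (ε k / 2 * X k) := fun X =>
    Finset.sum_congr rfl fun k _ => by ring
  have e9 : ∀ X : Fin n → ℂ, ∑ k, volConst n * (ε k / 2) * X k =
      ∑ k, volConst n * (ε k / 2 * X k) := fun X =>
    Finset.sum_congr rfl fun k _ => by ring
  rw [e8, e9]
  ring

end

end

section

variable {n : ℕ}

/-! ### The symbol map -/

theorem IsLocOsc.const_mul {p₀ : Cn n × Cn n} {a : ℝ} {f : Cn n × Cn n → ℂ} (c : ℂ)
    (hf : IsLocOsc p₀ a f) : IsLocOsc p₀ a (fun p => c * f p) := by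
  obtain ⟨g, hg, he⟩ := hf
  exact ⟨_, .const_mul c g hg, by filter_upwards [he] with z h ζ; rw [h]⟩

theorem IsLocOsc.sub {p₀ : Cn n × Cn n} {a : ℝ} {f g : Cn n × Cn n → ℂ}
    (hf : IsLocOsc p₀ a f) (hg : IsLocOsc p₀ a g) : IsLocOsc p₀ a (fun p => f p - g p) :=
  (hf.add (hg.const_mul (-1))).congr (Eventually.of_forall fun z ζ => by ring)

theorem contDiff_integral_kernelMul {F : Cn n × Cn n → ℂ} (hF : ContDiff ℝ ∞ F)
    (hc : HasCompactSupport F) :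
    ContDiff ℝ ∞ fun p : Cn n × Cn n => ∫ w, kernelMul F p.2 (p.1, w) :=
  contDiff_oscInt (μ := volume) (Φ := fun q => q.2 - q.1) hF hc (contDiff_snd.sub contDiff_fst)

/-- Differentiation under the integral sign; the kernel is holomorphic in z and contributes nothing.
-/
theorem dzbar_integral_kernelMul {F : Cn n × Cn n → ℂ} (hF : ContDiff ℝ ∞ F)
    (hc : HasCompactSupport F) (i : Fin n) (p : Cn n × Cn n) :
    dzbar i (fun p => ∫ w, kernelMul F p.2 (p.1, w)) p =
      ∫ w, kernelMul (dbarDir (dir (toLex (Sum.inl i))) F) p.2 (p.1, w) := by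
  have hG := contDiff_kernelMul hF p.2
  have hGc := hasCompactSupport_kernelMul hc p.2
  have hk : IsCompact (Prod.snd '' tsupport F) := hc.isCompact.image continuous_snd
  obtain ⟨hint, hder⟩ := hasFDerivAt_integral_param (μ := (volume : Measure (Cn n))) hk hG
    (fun z w hw => image_eq_zero_of_notMem_tsupport fun h =>
      hw ⟨(z, w), tsupport_kernelMul_subset F _ h, rfl⟩) p.1
  have hfd : ∀ v : Cn n, fderiv ℝ (fun p : Cn n × Cn n => ∫ w, kernelMul F p.2 (p.1, w)) p (v, 0) =
      ∫ w, fderiv ℝ (kernelMul F p.2) (p.1, w) (v, 0) := by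
    intro v
    have h1 := ((contDiff_integral_kernelMul hF hc).differentiable (by simp) p).hasFDerivAt
    have h2 := HasFDerivAt.comp (f := fun z => (z, p.2)) p.1 h1 (hasFDerivAt_prodMk_left p.1 p.2)
    have h3 := congrArg (fun L : Cn n →L[ℝ] ℂ => L v) (h2.unique hder)
    rw [ContinuousLinearMap.integral_apply hint] at h3
    simpa using h3
  have hi : ∀ v : Cn n, Integrable fun w => fderiv ℝ (kernelMul F p.2) (p.1, w) (v, 0) := fun v =>
    integrable_slice (F := fun q => fderiv ℝ (kernelMul F p.2) q (v, 0))
      ((hG.continuous_fderiv (by simp)).clm_apply continuous_const) (hGc.fderiv_apply (𝕜 := ℝ) _) p.1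
  have hdir : (dir (toLex (Sum.inl i)) : Cn n × Cn n) = (EuclideanSpace.single i 1, 0) := rfl
  have hI : Complex.I • ((EuclideanSpace.single i 1, 0) : Cn n × Cn n) =
      (Complex.I • EuclideanSpace.single i 1, 0) := by simp
  simp_rw [← dbarDir_kernelMul hF]
  simp only [dzbar, dbarDir, hdir, hI]
  rw [hfd, hfd, integral_const_mul, integral_add (hi _) ((hi _).const_mul _), integral_const_mul]

theorem IsLocOsc.dzbar_of_sub {p₀ : Cn n × Cn n} {a : ℝ} {f M : Cn n × Cn n → ℂ}
    (h : IsLocOsc p₀ a (fun p => f p - M p)) (hM : ContDiff ℝ ∞ M) (i : Fin n)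
    (hd : IsLocOsc p₀ a (CDSymbol.dzbar i M)) : IsLocOsc p₀ a (CDSymbol.dzbar i f) := by
  obtain ⟨g, hg, he⟩ := h
  refine (IsLocOsc.add ⟨_, hg.dzbar i, Eventually.of_forall fun z ζ => rfl⟩ hd).congr ?_
  filter_upwards [eventually_eventually_nhds.2 he] with z hz ζ
  have h1 : f =ᶠ[𝓝 (z, ζ)] fun p => g p + M p := by
    filter_upwards [(continuous_fst.tendsto (z, ζ)).eventually hz] with q hq
    rw [← hq q.2]
    ring
  simp only [CDSymbol.dzbar, dbarDir, h1.fderiv_eq]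
  rw [fderiv_fun_add (hg.contDiff.differentiable (by simp) _) (hM.differentiable (by simp) _)]
  simp only [add_apply]
  ring

section

variable {V V' U G Γ₁ Γ₂ D₁ D₂ D₁' D₂' : Set (Cn n × Cn n)} {z₀ ζ₀ : Cn n} {r c : ℝ}
  {φ : Cn n × Cn n → ℝ} {β : Cn n → ℝ} {η : Cochain U G (n : ℤ)}

theorem exists_window (z₀ : Cn n) (hr : 0 < r) : ∃ β : Cn n → ℝ, ContDiff ℝ ∞ β ∧
    tsupport β ⊆ Metric.ball z₀ r ∧ ∀ᶠ z in 𝓝 z₀, β z = 1 := by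
  obtain ⟨β, hβ, -, hβT, hβ1⟩ := exists_contDiff_cutoff (isCompact_singleton (x := z₀))
    (Metric.isOpen_ball (x := z₀) (ε := r)) (by simpa using hr)
  rw [nhdsSet_singleton] at hβ1
  exact ⟨β, hβ, hβT, hβ1⟩

theorem contDiff_mainDensity (hU : IsOpen U) (hG : IsClosed G) (hc : 0 < c) (hη : IsCocycle η)
    (hφ : IsSingularCutoff U G z₀ ζ₀ r c φ) (hβ : ContDiff ℝ ∞ β)
    (hβT : tsupport β ⊆ Metric.ball z₀ r) : ContDiff ℝ ∞ (mainDensity φ β ζ₀ c η) :=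
  contDiff_cut (isOpen_region hU z₀ ζ₀ r c) (isClosed_tsupport φ) (contDiff_window hβ)
    (inter_tsupport_window_subset hc hβT hφ.subset)
    (isSupportedOn_reduced hU hG hφ hη (by rw [card_fibreIdx]))

theorem hasCompactSupport_mainDensity (hφ : IsSingularCutoff U G z₀ ζ₀ r c φ) :
    HasCompactSupport (mainDensity φ β ζ₀ c η) := hasCompactSupport_cut hφ.compact

/-- The derivatives `∂/∂z̄ᵢ` of the main term are exponentially small. -/
theorem isLocOsc_dzbar_main (hU : IsOpen U) (hG : IsClosed G) (hc : 0 < c) (hη : IsCocycle η)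
    (hφ : IsSingularCutoff U G z₀ ζ₀ r c φ) (hβ : ContDiff ℝ ∞ β)
    (hβT : tsupport β ⊆ Metric.ball z₀ r) (hβ1 : ∀ᶠ z in 𝓝 z₀, β z = 1) (i : Fin n) :
    IsLocOsc (z₀, ζ₀) (-(c / 2))
      (dzbar i fun p => ∫ w, kernelMul (mainDensity φ β ζ₀ c η) p.2 (p.1, w)) := by
  have hR := isOpen_region hU z₀ ζ₀ r c
  have hms := contDiff_mainDensity hU hG hc hη hφ hβ hβT
  have hmc : HasCompactSupport (mainDensity φ β ζ₀ c η) := hasCompactSupport_mainDensity hφ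
  have hsub := inter_tsupport_window_subset (ζ₀ := ζ₀) (r := r) hc hβT hφ.subset
  have hsup : ∀ K : Finset (Idx n), K.card = n →
      IsSupportedOn (region U z₀ ζ₀ r c) (tsupport φ) (reduced φ η K) := fun K hK =>
    isSupportedOn_reduced hU hG hφ hη (by rw [hK])
  have hL : IsClosed (tsupport φ) := isClosed_tsupport φ
  have hf := hsup _ card_fibreIdx
  set v : Cn n × Cn n := dir (toLex (Sum.inl i))
  have hfv := hf.dbarDir hR hL v
  obtain ⟨b, J, hJ, hdiv⟩ := exists_divergence_of_dbar_eq_zero i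
  have h1 : IsLocOsc (z₀, ζ₀) (-(c / 2)) (fun p => ∫ w, kernelMul
      (cut (tsupport φ) (window β ζ₀ c) (dbarDir v (reduced φ η (fibreIdx n)))) p.2 (p.1, w)) :=
    isLocOsc_integral_cut_of_divergence hR hφ.compact (contDiff_window hβ) hsub hfv
      (fun k => hsup (J k) (hJ k)) b (fun q hq => hdiv _ q (dbar_reduced hU hG hφ hη (by
        rw [Finset.card_insert_of_notMem (inl_notMem_fibreIdx i), card_fibreIdx]; push_cast; rfl)
        hq)) fun q hq k => dbarDir_inr_window hc hβ hq k
  have hcs := contDiff_cut hR hL (contDiff_window (ζ₀ := ζ₀) (c := c) hβ) hsub hfv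
  have hcc : HasCompactSupport
      (cut (tsupport φ) (window β ζ₀ c) (dbarDir v (reduced φ η (fibreIdx n)))) :=
    hasCompactSupport_cut hφ.compact
  have hds := contDiff_dbarDir hms v
  have hdc := hasCompactSupport_dbarDir hmc v
  -- Moving ∂/∂z̄ᵢ past the window costs a derivative of the window. Near z₀, where β = 1, this
  -- lives at phase at most -c/2.
  have h2 : IsLocOsc (z₀, ζ₀) (-(c / 2)) (fun p => ∫ w, kernelMul (fun q =>
      dbarDir v (mainDensity φ β ζ₀ c η) q -
      cut (tsupport φ) (window β ζ₀ c) (dbarDir v (reduced φ η (fibreIdx n))) q) p.2 (p.1, w)) := by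
    refine isLocOsc_integral_kernelMul (hds.sub hcs) (hdc.sub hcc) ?_
    filter_upwards [eventually_eventually_nhds.2 hβ1] with z hz w hne
    by_contra hlt
    push Not at hlt
    exact hne (sub_eq_zero.2 (dbarDir_cut hR hL (contDiff_window hβ) hsub hf
      (dbarDir_window hc hlt hz v)))
  refine (h1.add h2).congr (Eventually.of_forall fun z ζ => ?_)
  rw [dzbar_integral_kernelMul hms hmc, ← integral_add
    (integrable_slice (contDiff_kernelMul hcs ζ).continuous (hasCompactSupport_kernelMul hcc ζ) z)
    (integrable_slice (contDiff_kernelMul (hds.sub hcs) ζ).continuous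
      (hasCompactSupport_kernelMul (hdc.sub hcc) ζ) z)]
  congr 1
  funext w
  simp only [kernelMul]
  ring

/-- The main term of a coboundary is exponentially small. -/
theorem isLocOsc_main_of_isCoboundary (hU : IsOpen U) (hG : IsClosed G) (hc : 0 < c)
    (hη : IsCocycle η) (hη' : IsCoboundary η) (hφ : IsSingularCutoff U G z₀ ζ₀ r c φ)
    (hβ : ContDiff ℝ ∞ β) (hβT : tsupport β ⊆ Metric.ball z₀ r) :
    IsLocOsc (z₀, ζ₀) (-(c / 2))
      (fun p => ∫ w, kernelMul (mainDensity φ β ζ₀ c η) p.2 (p.1, w)) := by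
  obtain ⟨σ, hσ, hσ'⟩ := exists_primitive_reduced hU hG hφ hη'
  have hcard : ((fibreIdx n).card : ℤ) = n := by rw [card_fibreIdx]
  refine isLocOsc_integral_cut_of_divergence (isOpen_region hU z₀ ζ₀ r c) hφ.compact
    (contDiff_window hβ) (inter_tsupport_window_subset hc hβT hφ.subset)
    (isSupportedOn_reduced hU hG hφ hη hcard) (fun k => hσ (faceIdx k) (card_faceIdx k))
    (fun k => (-1) ^ (n + (k : ℕ))) (fun q hq => ?_) fun q hq k => dbarDir_inr_window hc hβ hq k
  rw [hσ' _ hcard q hq, dbar_fibreIdx]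

/-- The consequences of the local formula for one choice of domains. -/
theorem IsLocalFrame.isLocOsc_symbolMap (hU : IsOpen U) (hG : IsClosed G)
    (h : IsLocalFrame U G D₁ D₂ z₀ ζ₀ r c) (hη : IsCocycle η) :
    (∀ a > 0, IsLocOsc (z₀, ζ₀) a (symbolMap D₁ D₂ η)) ∧
    (∀ i, IsLocOsc (z₀, ζ₀) (-(c / 2)) (dzbar i (symbolMap D₁ D₂ η))) ∧
    (IsCoboundary η → IsLocOsc (z₀, ζ₀) (-(c / 2)) (symbolMap D₁ D₂ η)) := by
  have hc := h.c_pos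
  obtain ⟨β, hβ, hβT, hβ1⟩ := exists_window z₀ h.r_pos
  have hex := fun (ε : ℝ) (hε : 0 < ε) => exists_isSingularCutoff hU hG h h.isOpen₁
    (fun p hp hpU hpr => (h.mem_of_G p hp hpU hpr).1) hε
  refine ⟨fun a ha => ?_, fun i => ?_, fun hη' => ?_⟩
  -- Only the growth estimate needs supp φ in {phase < a} for the given a. For the other two claims
  -- any bound serves, and 1 is taken.
  · obtain ⟨φ, hφ, hφ'⟩ := hex a ha
    have h1 := (h.isLocOsc_symbolMap_sub hU hG η hη hφ (fun p hp => (hφ' p hp).1) hβ1).mono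
      (by linarith : -(c / 2) ≤ a)
    have h2 : IsLocOsc (z₀, ζ₀) a
        (fun p => ∫ w, kernelMul (mainDensity φ β ζ₀ c η) p.2 (p.1, w)) :=
      isLocOsc_integral_kernelMul (contDiff_mainDensity hU hG hc hη hφ hβ hβT)
        (hasCompactSupport_mainDensity hφ)
        (Eventually.of_forall fun z w hne => (hφ' _ (mem_of_cut_ne_zero hne)).2.le)
    exact (h1.add (h2.const_mul (volConst n))).congr (Eventually.of_forall fun z ζ => by ring)
  · obtain ⟨φ, hφ, hφ'⟩ := hex 1 one_pos
    have h1 := h.isLocOsc_symbolMap_sub hU hG η hη hφ (fun p hp => (hφ' p hp).1) hβ1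
    have hM := contDiff_integral_kernelMul (contDiff_mainDensity hU hG hc hη hφ hβ hβT)
      (hasCompactSupport_mainDensity hφ)
    refine h1.dzbar_of_sub (contDiff_const.mul hM) i ?_
    refine ((isLocOsc_dzbar_main hU hG hc hη hφ hβ hβT hβ1 i).const_mul (volConst n)).congr
      (Eventually.of_forall fun z ζ => ?_)
    exact dbarDir_const_mul _ (hM.differentiable (by simp) _)
  · obtain ⟨φ, hφ, hφ'⟩ := hex 1 one_pos
    have h1 := h.isLocOsc_symbolMap_sub hU hG η hη hφ (fun p hp => (hφ' p hp).1) hβ1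
    have h2 := isLocOsc_main_of_isCoboundary hU hG hc hη hη' hφ hβ hβT
    exact (h1.add (h2.const_mul (volConst n))).congr (Eventually.of_forall fun z ζ => by ring)

/-- The symbol depends on the domains only up to exponentially small terms. -/
theorem IsLocalFrame.isLocOsc_sub (hU : IsOpen U) (hG : IsClosed G)
    (h : IsLocalFrame U G D₁ D₂ z₀ ζ₀ r c) (h' : IsLocalFrame U G D₁' D₂' z₀ ζ₀ r c)
    (hη : IsCocycle η) :
    IsLocOsc (z₀, ζ₀) (-(c / 2)) (fun p => symbolMap D₁ D₂ η p - symbolMap D₁' D₂' η p) := by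
  obtain ⟨β, hβ, hβT, hβ1⟩ := exists_window z₀ h.r_pos
  -- With a single φ supported in both first domains, and the same β and c, the two local formulas
  -- have literally the same main term.
  obtain ⟨φ, hφ, hφ'⟩ := exists_isSingularCutoff hU hG h (h.isOpen₁.inter h'.isOpen₁)
    (fun p hp hpU hpr => ⟨(h.mem_of_G p hp hpU hpr).1, (h'.mem_of_G p hp hpU hpr).1⟩) one_pos
  have h1 := h.isLocOsc_symbolMap_sub hU hG η hη hφ (fun p hp => (hφ' p hp).1.1) hβ1
  have h2 := h'.isLocOsc_symbolMap_sub hU hG η hη hφ (fun p hp => (hφ' p hp).1.2) hβ1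
  exact (h1.sub h2).congr (Eventually.of_forall fun z ζ => by ring)

/-- The difference of two cochains. -/
def Cochain.sub {m : ℤ} (η η' : Cochain U G m) : Cochain U G m where
  form1 := η.form1 - η'.form1
  form01 := η.form01 - η'.form01
  smooth1 K hK := (η.smooth1 K hK).sub (η'.smooth1 K hK)
  smooth01 K hK := (η.smooth01 K hK).sub (η'.smooth01 K hK)

theorem isCocycle_sub {m : ℤ} (hU : IsOpen U) (hG : IsClosed G) {η η' : Cochain U G m}
    (hη : IsCocycle η) (hη' : IsCocycle η') : IsCocycle (η.sub η') := by
  constructor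
  · intro K hK p hp
    have hcard : ∀ k ∈ K, ((K.erase k).card : ℤ) = m := fun k hk => by
      rw [card_erase_int hk hK]; ring
    have h1 := dbar_sub hU (fun k hk => η.smooth1 _ (hcard k hk))
      (fun k hk => η'.smooth1 _ (hcard k hk)) hp
    rw [hη.1 K hK p hp, hη'.1 K hK p hp, sub_self] at h1
    exact h1
  · intro K hK p hp
    have h1 := dbar_sub (hU.sdiff hG) (fun k hk => η.smooth01 _ (card_erase_int hk hK))
      (fun k hk => η'.smooth01 _ (card_erase_int hk hK)) hp
    have h2 := hη.2 K hK p hp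
    have h3 := hη'.2 K hK p hp
    change η.form1 K p - η'.form1 K p - dbar (fun K p => η.form01 K p - η'.form01 K p) K p = 0
    rw [h1]
    simp only [Pi.zero_apply] at h2 h3
    linear_combination h2 - h3

theorem density01_sub (b b' : Coeffs n) (ν z ζ w : Cn n) :
    density01 (b - b') ν z ζ w = density01 b ν z ζ w - density01 b' ν z ζ w := by
  simp only [density01, Pi.sub_apply]
  rw [← mul_sub, ← Finset.sum_sub_distrib]
  congr 1
  exact Finset.sum_congr rfl fun k _ => by ring

/-- Additivity of the Bochner integral requires integrability, so linearity of the symbol map is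
available only together with the convergence statement. -/
theorem IsLocalFrame.symbolMap_sub (hU : IsOpen U) (hG : IsClosed G)
    (h : IsLocalFrame U G D₁ D₂ z₀ ζ₀ r c) (η η' : Cochain U G (n : ℤ)) :
    ∀ᶠ z in 𝓝 z₀, ∀ ζ, symbolMap D₁ D₂ η (z, ζ) - symbolMap D₁ D₂ η' (z, ζ) =
      symbolMap D₁ D₂ (η.sub η') (z, ζ) := by
  filter_upwards [h.integrable hU hG η, h.integrable hU hG η'] with z h1 h2 ζ
  have e1 : ∀ w, density1 (η.sub η').form1 z ζ w =
      density1 η.form1 z ζ w - density1 η'.form1 z ζ w := fun w => by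
    simp only [density1, Cochain.sub, Pi.sub_apply]
    ring
  have e2 : ∀ w, boundaryDensity D₁ (η.sub η').form01 z ζ w =
      boundaryDensity D₁ η.form01 z ζ w - boundaryDensity D₁ η'.form01 z ζ w := fun w =>
    density01_sub _ _ _ _ _ _
  simp only [symbolMap, e1, e2]
  rw [integral_sub (h1 ζ).1 (h2 ζ).1, integral_sub (h1 ζ).2 (h2 ζ).2]
  ring

theorem exists_common_frame (hV' : IsOpenConvexProperCone V')
    {Γ₁' Γ₂' : Set (Cn n × Cn n)}
    (hc : AdmissibleCones V V' U G Γ₁ Γ₂) (hd : AdmissibleDomains V' U G Γ₁ Γ₂ D₁ D₂)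
    (hc' : AdmissibleCones V V' U G Γ₁' Γ₂') (hd' : AdmissibleDomains V' U G Γ₁' Γ₂' D₁' D₂')
    {p : Cn n × Cn n} (hp : p ∈ V') :
    ∃ r c, IsLocalFrame U G D₁ D₂ p.1 p.2 r c ∧ IsLocalFrame U G D₁' D₂' p.1 p.2 r c := by
  obtain ⟨r, c, h⟩ := exists_isLocalFrame hV' hc hd hp
  obtain ⟨r', c', h'⟩ := exists_isLocalFrame hV' hc' hd' hp
  have hr := lt_min h.r_pos h'.r_pos
  have hcc := lt_min h.c_pos h'.c_pos
  exact ⟨min r r', min c c', h.mono hr hcc (min_le_left _ _) (min_le_left _ _),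
    h'.mono hr hcc (min_le_right _ _) (min_le_right _ _)⟩

end

end

end CDSymbol

end

/-! ### From local estimates to symbols and null-symbols -/

theorem proposition4 {n : ℕ} (V V' U G : Set (Cn n × Cn n))
    (hV : IsOpenConvexProperCone V) (hV' : IsOpenConvexProperCone V')
    (hVV' : ConeRelCompact V' V)
    (hbV : IsCompact (closure (base V))) (hbV' : IsCompact (closure (base V')))
    (hU : IsOpen U) (hUV : U ∩ {p | p.2 = p.1} = {p | p.1 ∈ base V ∧ p.2 = p.1})
    (hG : IsClosed G) :
    -- the integrals converge, the image is a symbol, and it is null when the class is zero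
    (∀ Γ₁ Γ₂ D₁ D₂ : Set (Cn n × Cn n),
      AdmissibleCones V V' U G Γ₁ Γ₂ → AdmissibleDomains V' U G Γ₁ Γ₂ D₁ D₂ →
      ∀ η : Cochain U G (n : ℤ), IsCocycle η →
        IntegralsConverge V' D₁ D₂ η.form1 η.form01 ∧
        IsSymbol V' (symbolMap D₁ D₂ η) ∧
        (IsCoboundary η → IsNullSymbol V' (symbolMap D₁ D₂ η))) ∧
    -- independence, modulo null-symbols, of the domains and of the representative
    (∀ Γ₁ Γ₂ D₁ D₂ Γ₁' Γ₂' D₁' D₂' : Set (Cn n × Cn n),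
      AdmissibleCones V V' U G Γ₁ Γ₂ → AdmissibleDomains V' U G Γ₁ Γ₂ D₁ D₂ →
      AdmissibleCones V V' U G Γ₁' Γ₂' → AdmissibleDomains V' U G Γ₁' Γ₂' D₁' D₂' →
      (∀ η : Cochain U G (n : ℤ), IsCocycle η →
        IsNullSymbol V' (symbolMap D₁ D₂ η - symbolMap D₁' D₂' η)) ∧
      (∀ η η' : Cochain U G (n : ℤ), IsCocycle η → IsCocycle η' → Cohomologous η η' →
        IsNullSymbol V' (symbolMap D₁ D₂ η - symbolMap D₁' D₂' η'))) := by
  refine ⟨fun Γ₁ Γ₂ D₁ D₂ hc hd η hη => ⟨fun z hz ζ => ?_, ?_, fun hη' => ?_⟩,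
    fun Γ₁ Γ₂ D₁ D₂ Γ₁' Γ₂' D₁' D₂' hc hd hc' hd' =>
      ⟨fun η hη => ?_, fun η η' hη hη' hηη' => ?_⟩⟩
  · obtain ⟨p, hp, rfl⟩ := hz
    obtain ⟨r, c, h⟩ := exists_isLocalFrame hV' hc hd hp
    exact (h.integrable hU hG η).self_of_nhds ζ
  · refine isSymbol_of_isLocOsc hV'.isOpen hV'.isCone (fun p hp a ha => ?_) fun i =>
      isNullSymbol_of_isLocOsc hV'.isOpen hV'.isCone fun p hp => ?_
    · obtain ⟨r, c, h⟩ := exists_isLocalFrame hV' hc hd hp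
      exact (h.isLocOsc_symbolMap hU hG hη).1 a ha
    · obtain ⟨r, c, h⟩ := exists_isLocalFrame hV' hc hd hp
      exact ⟨_, neg_lt_zero.2 (half_pos h.c_pos), (h.isLocOsc_symbolMap hU hG hη).2.1 i⟩
  · refine isNullSymbol_of_isLocOsc hV'.isOpen hV'.isCone fun p hp => ?_
    obtain ⟨r, c, h⟩ := exists_isLocalFrame hV' hc hd hp
    exact ⟨_, neg_lt_zero.2 (half_pos h.c_pos), (h.isLocOsc_symbolMap hU hG hη).2.2 hη'⟩
  · refine isNullSymbol_of_isLocOsc hV'.isOpen hV'.isCone fun p hp => ?_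
    obtain ⟨r, c, h, h'⟩ := exists_common_frame hV' hc hd hc' hd' hp
    exact ⟨_, neg_lt_zero.2 (half_pos h.c_pos), h.isLocOsc_sub hU hG h' hη⟩
  · refine isNullSymbol_of_isLocOsc hV'.isOpen hV'.isCone fun p hp => ?_
    obtain ⟨r, c, h, h'⟩ := exists_common_frame hV' hc hd hc' hd' hp
    obtain ⟨τ, hτ⟩ := hηη'
    -- The difference is split in two: the domains are changed for the fixed representative η, then
    -- the representative is changed on the second domains, where the difference is the symbol of a
    -- coboundary.
    have h1 := h.isLocOsc_sub hU hG h' hη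
    have h2 := ((h'.isLocOsc_symbolMap hU hG (isCocycle_sub hU hG hη hη')).2.2 ⟨τ, hτ⟩).congr
      (g := fun q => symbolMap D₁' D₂' η q - symbolMap D₁' D₂' η' q) (h'.symbolMap_sub hU hG η η')
    exact ⟨_, neg_lt_zero.2 (half_pos h.c_pos), (h1.add h2).congr
      (Eventually.of_forall fun z ζ => (sub_add_sub_cancel _ _ _).symm)⟩
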